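/- **Setting.** For monomorphisms into an object $x$, subobjects of $x$ are equivalence classes under mutual factorization; write $u\subseteq x$ for subobjects, ordered by inclusion. A morphism $f:x\to y$ is *surjective* ($f:x\twoheadrightarrow y$) if its image (the smallest subobject of $y$ through which it factors) is $y$. Let $\mathcal A$ be a category with a terminal object $*$ and binary products which is *regular*: every morphism has an image; the pullback of $x\to z\leftarrow y$ exists as soon as some commutative square over it exists; the pullback of a surjective morphism by an arbitrary morphism exists and is surjective. Assume that every object of $\mathcal A$ has only finitely many subobjects, and let $\mu$ denote the Möbius function of the poset of subobjects of an object. Let $K$ be a commutative ring and let $\delta$ be a $K$-valued *degree function*: it assigns to each surjective $e$ an element $\delta(e)\in K$ with $\delta(\mathrm{id})=1$, $\delta(e')=\delta(e)$ if $e'$ is a pullback of $e$, and $\delta(ee')=\delta(e)\delta(e')$. Let $\mathcal T^0$ be the category with one object $[x]$ for each object $x$ of $\mathcal A$, where $\mathrm{Hom}([x],[y])$ is the free $K$-module on symbols $\langle r\rangle$, $r\subseteq x\times y$, with $K$-bilinear composition such that $\langle s\rangle\langle r\rangle=\delta(r\times_ys\twoheadrightarrow s\circ r)\langle s\circ r\rangle$,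 $s\circ r:=\mathrm{im}(r\times_ys\to x\times z)$, if $r\times_ys$ exists, and $\langle s\rangle\langle r\rangle=0$ otherwise. It is symmetric monoidal with $[x]\otimes[y]=[x\times y]$, $\langle r\rangle\otimes\langle s\rangle=\langle r\times s\rangle$, unit $[*]$ and the constraints of the direct product. Let $\mathcal T=\mathcal T(\mathcal A,\delta)$ be its pseudo-abelian closure (objects $pX$ with $p$ an idempotent endomorphism of a formal finite direct sum $X$ of objects $[x_\nu]$). For $f:x\to y$ let $[f]:[x]\to[y]$ be the class of its graph and $[f]^\vee:[y]\to[x]$ that of the transposed graph. For a subobject $i:u\hookrightarrow x$ put $p_u=[i][i]^\vee$, let $p_x^*=\sum_{u\subseteq x}\mu(u,x)p_u$ (an idempotent of $[x]$) and $[x]^*:=p_x^*[x]$. Let $R(x,y)$ be the set of $r\subseteq x\times y$ whose projections $a:r\to x$, $b:r\to y$ are both surjective, and put $$(r):=p_y^*[b]\,p_r^*\,[a]^\vee p_x^*,\qquad \{r\}:=p_y^*\langle r\rangle p_x^*\qquad\text{in }\mathrm{Hom}_{\mathcal T}([x]^*,[y]^*).$$ For $e:x\twoheadrightarrow y$ let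 $\omega_e=\sum\mu(u,x)\,\delta(u\twoheadrightarrow y)$, the sum over those $u\subseteq x$ that map surjectively onto $y$. **Theorem.** The morphisms $[y]^*\hookrightarrow[y]\to[x]$ induce an isomorphism $\bigoplus_{y\subseteq x}[y]^*\xrightarrow{\sim}[x]$ for every $x$. Moreover: 1. The $[x]^*$ are natural with respect to isomorphisms (for $f:x\xrightarrow\sim y$, $[f]$ restricts to an isomorphism $[x]^*\to[y]^*$, and it is the morphism $(r)=\{r\}$ with $r$ the graph of $f$), and they generate $\mathcal T$ as a pseudo-abelian category: every object is a direct summand of a finite direct sum of objects $[x]^*$. 2. Each of the families $(r)$ and $\{r\}$, $r\in R(x,y)$, is a basis of $\mathrm{Hom}_{\mathcal T}([x]^*,[y]^*)$, natural with respect to isomorphisms of $x$ and $y$. 3. For $r\in R(x,y)$ and $s\in R(y,z)$, $$(s)(r)=\sum_{u\in R(r,s),\ u\subseteq r\times_ys}\omega_{u\twoheadrightarrow\bar u}\,(\bar u),\qquad \bar u=\mathrm{im}(u\to x\times z),$$ $$\{s\}\{r\}=\sum_{y'}\mu(y',y)\,\delta(r\times_{y'}s\twoheadrightarrow r\circ_{y'}s)\,\{r\circ_{y'}s\},$$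 where $y'$ runs through the subobjects of $y$ such that $r\times_yy'\to x$ and $y'\times_ys\to z$ are surjective, $r\times_{y'}s=r\times_yy'\times_ys$ and $r\circ_{y'}s=\mathrm{im}(r\times_{y'}s\to x\times z)$. 4. For $t\in R(x,y)$, with projections $a$, $b$, the restriction of $[(a,b)]:[t]\to[x\times y]=[x]\otimes[y]$, composed with the projection, is an inclusion $[t]^*\to[x]^*\otimes[y]^*$, the analogous restriction of $[(a,b)]^\vee$ is a projection $[x]^*\otimes[y]^*\to[t]^*$, and these make $[x]^*\otimes[y]^*$ the direct sum of the $[t]^*$, $t\in R(x,y)$, naturally with respect to isomorphisms. In the same way the unit object $[*]$ is the direct sum of the $[u]^*$ with $u\subseteq *$. The constraints are induced by those of the direct product: if $w\subseteq x\times y\times z$ has image $r$ in $x\times y$ and image $s$ in $y\times z$ and maps surjectively to $x$, $y$ and $z$, then the associativity constraint identifies the summand $[w]^*$ of $[r]^*\otimes[z]^*\subseteq([x]^*\otimes[y]^*)\otimes[z]^*$ with the summand $[w]^*$ of $[x]^*\otimes[s]^*\subseteq[x]^*\otimes([y]^*\otimes[z]^*)$; the symmetry constraint identifies the summands given by $(a,b):t\to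 x\times y$ and $(b,a):t\to y\times x$; and if $u$ is the image of $x$ in $*$, the unital constraints restrict to the identity of $[x]^*$ on the summand $[x]^*$ of $[u]^*\otimes[x]^*\subseteq[*]\otimes[x]^*$ and of $[x]^*\otimes[u]^*\subseteq[x]^*\otimes[*]$. 5. For $r\in R(x,y)$ and $r'\in R(x',y')$, $$(r)\otimes(r')=\sum_{w\in R(r,r')}\tau_w,\qquad \tau_w:[x]^*\otimes[x']^*\twoheadrightarrow[r_w]^*\xrightarrow{(w)}[r'_w]^*\hookrightarrow[y]^*\otimes[y']^*,$$ where $r_w$ and $r'_w$ are the images of $w$ in $x\times x'$ and $y\times y'$ and $w$ is regarded as an element of $R(r_w,r'_w)$; and $$\{r\}\otimes\{r'\}=\sum_{u\in R(x,x'),\,v\in R(y,y')}\sigma_{u,v},\qquad \sigma_{u,v}:[x]^*\otimes[x']^*\twoheadrightarrow[u]^*\xrightarrow{\{w_{u,v}\}}[v]^*\hookrightarrow[y]^*\otimes[y']^*,$$ where $w_{u,v}=u\times_{x\times x'}(r\times r')\times_{y\times y'}v$, and $\sigma_{u,v}:=0$ if this pullback does not exist or is not in $R(u,v)$. Finally,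 $\mathcal T$ is uniquely determined by 1–5, with either of the two families $(r)$ or $\{r\}$: let $\mathcal D$ be a $K$-linear symmetric monoidal category (with $K$-bilinear tensor product), with finite direct sums and split idempotents, equipped with objects $x^*$, morphisms indexed by the sets $R(x,y)$, and inclusions and projections between $t^*$ and $x^*\otimes y^*$ ($t\in R(x,y)$) and between $u^*$ and $\mathbf 1$ ($u\subseteq *$), which have the properties 1–5 for one of the two families. Then there is a $K$-linear symmetric monoidal equivalence $\mathcal T\to\mathcal D$, together with isomorphisms from the images of the $[x]^*$ to the $x^*$, which is compatible with the morphisms indexed by the $R(x,y)$ and with the inclusions. -/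

import Mathlib

open CategoryTheory CategoryTheory.Limits CategoryTheory.MonoidalCategory
open CategoryTheory.CartesianMonoidalCategory CategoryTheory.Idempotents

universe v u w v₁ u₁ v₂ u₂

namespace TensorEnvelope

/-! ### Regular categories -/

section Regular

variable {A : Type u} [Category.{v} A]

/-- A morphism `f : x ⟶ y` is surjective (an extremal epimorphism) if its image is all of `y`,
i.e. `y` itself is the only subobject of `y` through which `f` factors. -/
class IsSurj {x y : A} (f : x ⟶ y) : Prop where
  eq_top : ∀ m : Subobject y, m.Factors f → m = ⊤

variable (A) in
/-- Regular categories.  The terminal object and the binary products are those of the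
`CartesianMonoidalCategory` structure (`𝟙_ A` and `x ⊗ y`).  Pullbacks are only required to exist if
the cospan can be completed to a commutative square, or if one of its legs is surjective. -/
class IsRegular [CartesianMonoidalCategory A] : Prop where
  /-- Every morphism has an image, i.e. a smallest subobject through which it factors. -/
  exists_image : ∀ {x y : A} (f : x ⟶ y), ∃ m : Subobject y, IsLeast {m | m.Factors f} m
  /-- If a cospan can be completed to a commutative square, then its pullback exists. -/
  hasPullback_of_comm : ∀ {t x y z : A} (a : t ⟶ x) (b : t ⟶ y) (f : x ⟶ z) (g : y ⟶ z),
    a ≫ f = b ≫ g → HasPullback f g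
  /-- The pullback of a surjective morphism by an arbitrary morphism exists ... -/
  hasPullback_of_surj : ∀ {x y z : A} (f : x ⟶ z) (g : y ⟶ z), IsSurj f → HasPullback f g
  /-- ... and is surjective. -/
  surj_snd : ∀ {x y z : A} (f : x ⟶ z) (g : y ⟶ z) [HasPullback f g], IsSurj f →
    IsSurj (pullback.snd f g)

variable (A) in
/-- Every object has only finitely many subobjects. -/
class SubobjectFinite : Prop where
  finite : ∀ x : A, Finite (Subobject x)

instance [SubobjectFinite A] (x : A) : Finite (Subobject x) := SubobjectFinite.finite x

noncomputable instance [SubobjectFinite A] (x : A) : Fintype (Subobject x) := Fintype.ofFinite _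

noncomputable instance [SubobjectFinite A] (x : A) : LocallyFiniteOrder (Subobject x) :=
  open scoped Classical in Fintype.toLocallyFiniteOrder

/-- The Möbius function of the poset of subobjects of `x`. -/
noncomputable def mu [SubobjectFinite A] {x : A} (a b : Subobject x) : ℤ :=
  open scoped Classical in (IncidenceAlgebra.mu ℤ : IncidenceAlgebra ℤ (Subobject x)) a b

theorem isIso_of_isSurj_comp {x t y : A} {f : x ⟶ y} (hf : IsSurj f) (g : x ⟶ t) (m : t ⟶ y)
    [Mono m] (h : g ≫ m = f) : IsIso m := by
  rw [Subobject.isIso_iff_mk_eq_top]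
  exact hf.eq_top _ ((Subobject.mk_factors_iff m f).2 ⟨g, h⟩)

theorem isSurj_of_forall {x y : A} {f : x ⟶ y}
    (h : ∀ {t : A} (g : x ⟶ t) (m : t ⟶ y) [Mono m], g ≫ m = f → IsIso m) : IsSurj f where
  eq_top m hm := by
    have := h (m.factorThru f hm) m.arrow (m.factorThru_arrow f hm)
    exact Subobject.eq_top_of_isIso_arrow m

theorem isIso_of_isSurj_of_mono {x y : A} {f : x ⟶ y} (hf : IsSurj f) [Mono f] : IsIso f :=
  isIso_of_isSurj_comp hf (𝟙 x) f (Category.id_comp f)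

instance isSurj_of_iso {x y : A} (f : x ⟶ y) [IsIso f] : IsSurj f :=
  isSurj_of_forall fun g m _ h => by
    have : IsSplitEpi m := ⟨⟨⟨inv f ≫ g, by simp [h]⟩⟩⟩
    exact isIso_of_mono_of_isSplitEpi m

theorem IsSurj.of_comp {x y z : A} (f : x ⟶ y) (g : y ⟶ z) (h : IsSurj (f ≫ g)) : IsSurj g :=
  isSurj_of_forall fun k m _ hk => isIso_of_isSurj_comp h (f ≫ k) m (by simp [hk])

variable [CartesianMonoidalCategory A] [IsRegular A]

theorem IsSurj.lift {x y z t : A} {e : x ⟶ y} (he : IsSurj e) (f : y ⟶ z) (m : t ⟶ z) [Mono m]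
    (g : x ⟶ t) (h : g ≫ m = e ≫ f) : ∃ k : y ⟶ t, k ≫ m = f := by
  have : HasPullback m f := IsRegular.hasPullback_of_comm g e m f h
  have : IsIso (pullback.snd m f) :=
    isIso_of_isSurj_comp he (pullback.lift g e h) _ (pullback.lift_snd _ _ _)
  exact ⟨inv (pullback.snd m f) ≫ pullback.fst m f, by simp [pullback.condition]⟩

instance isSurj_comp {x y z : A} (f : x ⟶ y) (g : y ⟶ z) [hf : IsSurj f] [hg : IsSurj g] :
    IsSurj (f ≫ g) :=
  isSurj_of_forall fun k m _ hk => by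
    obtain ⟨l, hl⟩ := hf.lift g m k hk
    exact isIso_of_isSurj_comp hg l m hl

instance hasPullback_of_surj_left {x y z : A} (f : x ⟶ z) (g : y ⟶ z) [IsSurj f] :
    HasPullback f g :=
  IsRegular.hasPullback_of_surj f g inferInstance

instance hasPullback_of_surj_right {x y z : A} (f : x ⟶ z) (g : y ⟶ z) [IsSurj g] :
    HasPullback f g :=
  hasPullback_symmetry g f

theorem IsSurj.of_isPullback {p x y z : A} {a : p ⟶ x} {b : p ⟶ y} {f : x ⟶ z} {g : y ⟶ z}
    (h : IsPullback a b f g) (hf : IsSurj f) : IsSurj b := by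
  have := h.hasPullback
  have h2 : IsSurj (pullback.snd f g) := IsRegular.surj_snd f g hf
  rw [← h.isoPullback_hom_snd]
  infer_instance

instance isSurj_pullback_snd {x y z : A} (f : x ⟶ z) (g : y ⟶ z) [HasPullback f g]
    [hf : IsSurj f] : IsSurj (pullback.snd f g) :=
  IsRegular.surj_snd f g hf

instance isSurj_pullback_fst {x y z : A} (f : x ⟶ z) (g : y ⟶ z) [HasPullback f g]
    [hg : IsSurj g] : IsSurj (pullback.fst f g) :=
  IsSurj.of_isPullback (IsPullback.of_hasPullback f g).flip hg

theorem isPullback_of_exists {A : Type u} [Category.{v} A] {p x y z : A} {a : p ⟶ x} {b : p ⟶ y}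
    {f : x ⟶ z} {g : y ⟶ z} (w : a ≫ f = b ≫ g)
    (hl : ∀ {t : A} (k : t ⟶ x) (l : t ⟶ y), k ≫ f = l ≫ g → ∃ m : t ⟶ p, m ≫ a = k ∧ m ≫ b = l)
    (hm : ∀ {t : A} (k l : t ⟶ p), k ≫ a = l ≫ a → k ≫ b = l ≫ b → k = l) :
    IsPullback a b f g where
  w := w
  isLimit' := ⟨PullbackCone.IsLimit.mk w (fun s => (hl s.fst s.snd s.condition).choose)
    (fun s => (hl s.fst s.snd s.condition).choose_spec.1)
    (fun s => (hl s.fst s.snd s.condition).choose_spec.2)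
    (fun s m h₁ h₂ => hm _ _ (h₁.trans (hl s.fst s.snd s.condition).choose_spec.1.symm)
      (h₂.trans (hl s.fst s.snd s.condition).choose_spec.2.symm))⟩

theorem isPullback_whiskerRight {A : Type u} [Category.{v} A] [CartesianMonoidalCategory A]
    {x y : A} (f : x ⟶ y) (z : A) : IsPullback (fst x z) (f ▷ z) f (fst y z) :=
  isPullback_of_exists (by simp)
    (fun k l h => ⟨lift k (l ≫ snd _ _), by simp, by ext <;> simp [h]⟩)
    (fun k l h₁ h₂ => by
      ext
      · exact h₁
      · simpa using h₂ =≫ snd _ _)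

theorem isPullback_whiskerLeft {A : Type u} [Category.{v} A] [CartesianMonoidalCategory A]
    {x y : A} (f : x ⟶ y) (z : A) : IsPullback (snd z x) (z ◁ f) f (snd z y) :=
  isPullback_of_exists (by simp)
    (fun k l h => ⟨lift (l ≫ fst _ _) k, by simp, by ext <;> simp [h]⟩)
    (fun k l h₁ h₂ => by
      ext
      · simpa using h₂ =≫ fst _ _
      · exact h₁)

instance isSurj_whiskerRight {x y : A} (f : x ⟶ y) (z : A) [hf : IsSurj f] : IsSurj (f ▷ z) :=
  IsSurj.of_isPullback (isPullback_whiskerRight f z) hf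

instance isSurj_whiskerLeft {x y : A} (f : x ⟶ y) (z : A) [hf : IsSurj f] : IsSurj (z ◁ f) :=
  IsSurj.of_isPullback (isPullback_whiskerLeft f z) hf

instance isSurj_tensorHom {x y x' y' : A} (f : x ⟶ y) (g : x' ⟶ y') [IsSurj f] [IsSurj g] :
    IsSurj (f ⊗ₘ g) := by
  rw [MonoidalCategory.tensorHom_def]
  infer_instance

/-- The image of a morphism: the smallest subobject through which it factors. -/
noncomputable def im {x y : A} (f : x ⟶ y) : Subobject y := (IsRegular.exists_image f).choose

theorem im_isLeast {x y : A} (f : x ⟶ y) : IsLeast {m | Subobject.Factors m f} (im f) :=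
  (IsRegular.exists_image f).choose_spec

/-- The surjective part `x ⟶ im f` of a morphism `f`. -/
noncomputable def toIm {x y : A} (f : x ⟶ y) : x ⟶ (im f : A) :=
  (im f).factorThru f (im_isLeast f).1

@[simp]
theorem toIm_arrow {x y : A} (f : x ⟶ y) : toIm f ≫ (im f).arrow = f :=
  (im f).factorThru_arrow f _

@[simp]
theorem toIm_arrow_assoc {x y z : A} (f : x ⟶ y) (g : y ⟶ z) :
    toIm f ≫ (im f).arrow ≫ g = f ≫ g := by
  rw [← Category.assoc, toIm_arrow]

instance isSurj_toIm {x y : A} (f : x ⟶ y) : IsSurj (toIm f) :=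
  isSurj_of_forall fun {t} g m _ h => by
    have hle : im f ≤ Subobject.mk (m ≫ (im f).arrow) :=
      (im_isLeast f).2 ((Subobject.mk_factors_iff _ f).2
        ⟨g, by change g ≫ m ≫ _ = f; rw [← Category.assoc, h, toIm_arrow]⟩)
    obtain ⟨k, hk⟩ : ∃ k : (im f : A) ⟶ t, k ≫ m ≫ (im f).arrow = (im f).arrow :=
      ⟨Subobject.ofLE _ _ hle ≫ (Subobject.underlyingIso _).hom, by simp⟩
    have : IsSplitEpi m := ⟨⟨⟨k, by rw [← cancel_mono (im f).arrow]; simpa using hk⟩⟩⟩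
    exact isIso_of_mono_of_isSplitEpi m

theorem im_eq {x t y : A} {f : x ⟶ y} (e : x ⟶ t) (he : IsSurj e) (m : t ⟶ y) [Mono m]
    (h : e ≫ m = f) : im f = Subobject.mk m := by
  apply le_antisymm
  · exact (im_isLeast f).2 ((Subobject.mk_factors_iff _ f).2 ⟨e, h⟩)
  · obtain ⟨k, hk⟩ := he.lift m (im f).arrow (toIm f) (by simp [h])
    exact Subobject.mk_le_of_comm k hk

end Regular

/-! ### Degree functions -/

section Degree

variable (A : Type u) [Category.{v} A] (K : Type w) [CommRing K]

/-- A degree function on `A` with values in `K`. -/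
structure DegreeFunction where
  /-- the degree of a surjective morphism -/
  deg : ∀ {x y : A} (e : x ⟶ y) [IsSurj e], K
  deg_id : ∀ x : A, deg (𝟙 x) = 1
  deg_pullback : ∀ {p x y z : A} {a : p ⟶ x} {e' : p ⟶ y} {e : x ⟶ z} {g : y ⟶ z}
    [IsSurj e] [IsSurj e'], IsPullback a e' e g → deg e' = deg e
  deg_comp : ∀ {x y z : A} (e : x ⟶ y) (f : y ⟶ z) [IsSurj e] [IsSurj f] [IsSurj (e ≫ f)],
    deg (e ≫ f) = deg e * deg f

end Degree

section DegreeLemmas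

variable {A : Type u} [Category.{v} A] {K : Type w} [CommRing K] (δ : DegreeFunction A K)

theorem DegreeFunction.deg_iso {x y : A} (e : x ⟶ y) [IsIso e] : δ.deg e = 1 := by
  rw [← δ.deg_id y]
  exact δ.deg_pullback (IsPullback.of_vert_isIso ⟨by simp⟩ : IsPullback (𝟙 x ≫ e) e (𝟙 y) (𝟙 y))

variable [CartesianMonoidalCategory A]

variable [IsRegular A]

theorem DegreeFunction.deg_tensorHom {x y x' y' : A} (e : x ⟶ y) (f : x' ⟶ y') [IsSurj e]
    [IsSurj f] : δ.deg (e ⊗ₘ f) = δ.deg e * δ.deg f := by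
  have h : e ⊗ₘ f = e ▷ x' ≫ y ◁ f := MonoidalCategory.tensorHom_def e f
  have h2 : ∀ (g : x ⊗ x' ⟶ y ⊗ y') [IsSurj g], g = e ▷ x' ≫ y ◁ f →
      δ.deg g = δ.deg e * δ.deg f := by
    rintro g hg rfl
    rw [δ.deg_comp, δ.deg_pullback (isPullback_whiskerRight e x'),
      δ.deg_pullback (isPullback_whiskerLeft f y)]
  exact h2 _ h

theorem DegreeFunction.deg_toIm {x t y : A} {f : x ⟶ y} (e : x ⟶ t) [he : IsSurj e] (m : t ⟶ y)
    [Mono m] (h : e ≫ m = f) : δ.deg (toIm f) = δ.deg e := by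
  obtain ⟨k, hk⟩ := he.lift m (im f).arrow (toIm f) (by simp [h])
  have h1 : toIm f = e ≫ k := by rw [← cancel_mono (im f).arrow]; simp [hk, h]
  have hs : IsSurj (e ≫ k) := h1 ▸ isSurj_toIm f
  have hk' : Mono k := mono_of_mono_fac hk
  have : IsIso k := isIso_of_isSurj_of_mono (IsSurj.of_comp e k hs)
  have h2 : ∀ (g : x ⟶ (im f : A)) [IsSurj g], g = e ≫ k → δ.deg g = δ.deg e := by
    rintro g hg rfl
    rw [δ.deg_comp, δ.deg_iso k, mul_one]
  exact h2 _ h1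

end DegreeLemmas

/-! ### The category `T⁰(A, δ)` -/

section TZero

variable {A : Type u} [Category.{v} A] [CartesianMonoidalCategory A] [IsRegular A]
  {K : Type w} [CommRing K]

/-- The objects `[x]` of `T⁰(A, δ)` are those of `A`. -/
structure TZero (δ : DegreeFunction A K) where
  /-- the underlying object of `A` -/
  obj : A

theorem exists_isPullback_cover {t r t' s y P : A} (e : t ⟶ r) (e' : t' ⟶ s) [IsSurj e] [IsSurj e']
    {b : r ⟶ y} {c : s ⟶ y} {p₁ : P ⟶ r} {p₂ : P ⟶ s} (H : IsPullback p₁ p₂ b c) :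
    ∃ (q : A) (f : q ⟶ t) (g : q ⟶ t') (k : q ⟶ P) (_ : IsSurj k),
      IsPullback f g (e ≫ b) (e' ≫ c) ∧ k ≫ p₁ = f ≫ e ∧ k ≫ p₂ = g ≫ e' ∧
      ∀ δ : DegreeFunction A K, δ.deg k = δ.deg e * δ.deg e' := by
  have H1 := IsPullback.of_hasPullback e p₁
  have H2 := IsPullback.of_hasPullback (pullback.snd e p₁ ≫ p₂) e'
  refine ⟨_, _, _, pullback.fst (pullback.snd e p₁ ≫ p₂) e' ≫ pullback.snd e p₁, inferInstance,
    H2.paste_horiz (H1.paste_vert H), ?_, ?_, ?_⟩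
  · simp [H1.w]
  · simpa using H2.w
  · intro δ
    rw [δ.deg_comp, δ.deg_pullback H1, δ.deg_pullback H2.flip, mul_comm]

variable (δ : DegreeFunction A K)

namespace TZero

/-- For a pair of morphisms `a : t ⟶ x`, `b : t ⟶ y`, the multiple `δ(t ↠ r) ⟨r⟩`, where `r` is the
image of `t` in `x × y`. -/
noncomputable def span {t x y : A} (a : t ⟶ x) (b : t ⟶ y) : Subobject (x ⊗ y) →₀ K :=
  Finsupp.single (im (lift a b)) (δ.deg (toIm (lift a b)))

open scoped Classical in
/-- The product `⟨s⟩⟨r⟩`: it is `δ(r ×_y s ↠ s ∘ r) ⟨s ∘ r⟩` if `r ×_y s` exists,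
and zero otherwise. -/
noncomputable def compRel {x y z : A} (r : Subobject (x ⊗ y)) (s : Subobject (y ⊗ z)) :
    Subobject (x ⊗ z) →₀ K :=
  if _h : HasPullback (r.arrow ≫ snd x y) (s.arrow ≫ fst y z) then
    span δ (pullback.fst (r.arrow ≫ snd x y) (s.arrow ≫ fst y z) ≫ r.arrow ≫ fst x y)
      (pullback.snd (r.arrow ≫ snd x y) (s.arrow ≫ fst y z) ≫ s.arrow ≫ snd y z)
  else 0

/-- Composition in `T⁰`: the bilinear extension of `compRel` (in diagrammatic order). -/
noncomputable def comp {x y z : A} :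
    (Subobject (x ⊗ y) →₀ K) →ₗ[K] (Subobject (y ⊗ z) →₀ K) →ₗ[K] (Subobject (x ⊗ z) →₀ K) :=
  Finsupp.linearCombination K fun r => Finsupp.linearCombination K fun s => compRel δ r s

theorem span_eq_of_fac {t t' x y : A} {a : t ⟶ x} {b : t ⟶ y} (e : t ⟶ t') [IsSurj e]
    (m : t' ⟶ x ⊗ y) [Mono m] (h : e ≫ m = lift a b) :
    span δ a b = Finsupp.single (Subobject.mk m) (δ.deg e) := by
  rw [span, δ.deg_toIm e m h, im_eq e inferInstance m h]

theorem span_comp_surj {t t' x y : A} (e : t ⟶ t') [IsSurj e] (a : t' ⟶ x) (b : t' ⟶ y) :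
    span δ (e ≫ a) (e ≫ b) = δ.deg e • span δ a b := by
  have h : (e ≫ toIm (lift a b)) ≫ (im (lift a b)).arrow = lift (e ≫ a) (e ≫ b) := by simp
  rw [span_eq_of_fac δ _ _ h, δ.deg_comp, Subobject.mk_arrow, span,
    Finsupp.smul_single, smul_eq_mul]

theorem span_comp_iso {t t' x y : A} (e : t ⟶ t') [IsIso e] (a : t' ⟶ x) (b : t' ⟶ y) :
    span δ (e ≫ a) (e ≫ b) = span δ a b := by
  rw [span_comp_surj, δ.deg_iso, one_smul]

theorem span_of_mono {t x y : A} (a : t ⟶ x) (b : t ⟶ y) [Mono (lift a b)] :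
    span δ a b = Finsupp.single (Subobject.mk (lift a b)) 1 := by
  have h : 𝟙 t ≫ lift a b = lift a b := by simp
  rw [span_eq_of_fac δ _ _ h, δ.deg_id]

theorem single_eq_span {x y : A} (r : Subobject (x ⊗ y)) :
    Finsupp.single r 1 = span δ (r.arrow ≫ fst x y) (r.arrow ≫ snd x y) := by
  have h : 𝟙 _ ≫ r.arrow = lift (r.arrow ≫ fst x y) (r.arrow ≫ snd x y) := by simp
  rw [span_eq_of_fac δ _ _ h, δ.deg_id, Subobject.mk_arrow]

theorem span_eq {t x y : A} (a : t ⟶ x) (b : t ⟶ y) :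
    span δ a b = δ.deg (toIm (lift a b)) • Finsupp.single (im (lift a b)) 1 := by
  rw [span, Finsupp.smul_single, smul_eq_mul, mul_one]

theorem comp_single {x y z : A} (r : Subobject (x ⊗ y)) (s : Subobject (y ⊗ z)) :
    comp δ (Finsupp.single r 1) (Finsupp.single s 1) = compRel δ r s := by
  simp [comp]

theorem toIm_fst {t x y : A} (a : t ⟶ x) (b : t ⟶ y) :
    toIm (lift a b) ≫ (im (lift a b)).arrow ≫ fst x y = a := by simp

theorem toIm_snd {t x y : A} (a : t ⟶ x) (b : t ⟶ y) :
    toIm (lift a b) ≫ (im (lift a b)).arrow ≫ snd x y = b := by simp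

/-- Composition of spans by pullback. -/
theorem comp_span {t t' p x y z : A} (a : t ⟶ x) (b : t ⟶ y) (c : t' ⟶ y) (d : t' ⟶ z)
    (f : p ⟶ t) (g : p ⟶ t') (h : IsPullback f g b c) :
    comp δ (span δ a b) (span δ c d) = span δ (f ≫ a) (g ≫ d) := by
  have hP : HasPullback ((im (lift a b)).arrow ≫ snd x y) ((im (lift c d)).arrow ≫ fst y z) :=
    IsRegular.hasPullback_of_comm (f ≫ toIm (lift a b)) (g ≫ toIm (lift c d)) _ _ (by simp [h.w])
  obtain ⟨q, f', g', k, hk, h', h₁, h₂, hd⟩ := exists_isPullback_cover (K := K) (toIm (lift a b))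
    (toIm (lift c d)) (IsPullback.of_hasPullback ((im (lift a b)).arrow ≫ snd x y)
      ((im (lift c d)).arrow ≫ fst y z))
  rw [toIm_snd, toIm_fst] at h'
  obtain ⟨j, hj₁, hj₂⟩ : ∃ j : p ≅ q, j.hom ≫ f' = f ∧ j.hom ≫ g' = g :=
    ⟨h.isoIsPullback _ _ h', by simp, by simp⟩
  rw [← hj₁, ← hj₂, Category.assoc, Category.assoc, span_comp_iso, span_eq δ a b, span_eq δ c d,
    map_smul, map_smul, LinearMap.smul_apply, comp_single, compRel, dif_pos hP, smul_smul]
  have h₃ : f' ≫ a = k ≫ pullback.fst _ _ ≫ (im (lift a b)).arrow ≫ fst x y := by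
    rw [reassoc_of% h₁, toIm_fst]
  have h₄ : g' ≫ d = k ≫ pullback.snd _ _ ≫ (im (lift c d)).arrow ≫ snd y z := by
    rw [reassoc_of% h₂, toIm_snd]
  rw [h₃, h₄, span_comp_surj, hd, mul_comm]

theorem comp_span_zero {t t' x y z : A} (a : t ⟶ x) (b : t ⟶ y) (c : t' ⟶ y) (d : t' ⟶ z)
    (h : ∀ {p : A} (f : p ⟶ t) (g : p ⟶ t'), f ≫ b ≠ g ≫ c) :
    comp δ (span δ a b) (span δ c d) = 0 := by
  rw [span_eq, span_eq, map_smul, map_smul, LinearMap.smul_apply, comp_single, compRel, dif_neg,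
    smul_zero, smul_zero]
  intro hP
  obtain ⟨q, f, g, k, hk, h', -⟩ := exists_isPullback_cover (K := K) (toIm (lift a b))
    (toIm (lift c d)) (IsPullback.of_hasPullback ((im (lift a b)).arrow ≫ snd x y)
      ((im (lift c d)).arrow ≫ fst y z))
  rw [toIm_snd, toIm_fst] at h'
  exact h f g h'.w

theorem comp_assoc_span {x y z t r s q : A} (a : r ⟶ x) (b : r ⟶ y) (c : s ⟶ y) (d : s ⟶ z)
    (e : q ⟶ z) (f : q ⟶ t) :
    comp δ (comp δ (span δ a b) (span δ c d)) (span δ e f) =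
      comp δ (span δ a b) (comp δ (span δ c d) (span δ e f)) := by
  by_cases h₁ : ∃ (p : A) (k : p ⟶ r) (l : p ⟶ s), k ≫ b = l ≫ c
  · obtain ⟨p, k, l, hkl⟩ := h₁
    have := IsRegular.hasPullback_of_comm k l b c hkl
    have H := IsPullback.of_hasPullback b c
    rw [comp_span δ _ _ _ _ _ _ H]
    by_cases h₂ : ∃ (p : A) (k : p ⟶ s) (l : p ⟶ q), k ≫ d = l ≫ e
    · obtain ⟨p', k', l', hkl'⟩ := h₂
      have := IsRegular.hasPullback_of_comm k' l' d e hkl'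
      have H' := IsPullback.of_hasPullback d e
      rw [comp_span δ _ _ _ _ _ _ H']
      by_cases h₃ : ∃ (p : A) (k : p ⟶ pullback b c) (l : p ⟶ pullback d e),
          k ≫ pullback.snd b c = l ≫ pullback.fst d e
      · obtain ⟨p, k, l, hkl⟩ := h₃
        have := IsRegular.hasPullback_of_comm k l _ _ hkl
        have H'' := IsPullback.of_hasPullback (pullback.snd b c) (pullback.fst d e)
        rw [comp_span δ _ _ _ _ _ _ (H''.paste_vert H'), comp_span δ _ _ _ _ _ _
          (H''.paste_horiz H)]
        simp only [Category.assoc]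
      · rw [comp_span_zero, comp_span_zero]
        · intro p k l hkl
          exact h₃ ⟨p, H.lift k (l ≫ pullback.fst d e) (by simpa using hkl), l, by simp⟩
        · intro p k l hkl
          exact h₃ ⟨p, k, H'.lift (k ≫ pullback.snd b c) l (by simpa using hkl), by simp⟩
    · rw [comp_span_zero δ c d, map_zero, comp_span_zero]
      · intro p k l hkl
        exact h₂ ⟨p, k ≫ pullback.snd b c, l, by simpa using hkl⟩
      · exact fun k l hkl => h₂ ⟨_, k, l, hkl⟩
  · rw [comp_span_zero δ a b c d fun k l hkl => h₁ ⟨_, k, l, hkl⟩, map_zero, LinearMap.zero_apply]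
    by_cases h₂ : ∃ (p : A) (k : p ⟶ s) (l : p ⟶ q), k ≫ d = l ≫ e
    · obtain ⟨p', k', l', hkl'⟩ := h₂
      have := IsRegular.hasPullback_of_comm k' l' d e hkl'
      rw [comp_span δ _ _ _ _ _ _ (IsPullback.of_hasPullback d e), comp_span_zero]
      intro p k l hkl
      exact h₁ ⟨p, k, l ≫ pullback.fst d e, by simpa using hkl⟩
    · rw [comp_span_zero δ c d, map_zero]
      exact fun k l hkl => h₂ ⟨_, k, l, hkl⟩

theorem hom_induction {x y : A} {P : (Subobject (x ⊗ y) →₀ K) → Prop} (f : Subobject (x ⊗ y) →₀ K)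
    (h0 : P 0) (hadd : ∀ f g, P f → P g → P (f + g)) (hsmul : ∀ (c : K) f, P f → P (c • f))
    (hspan : ∀ {t : A} (a : t ⟶ x) (b : t ⟶ y), P (span δ a b)) : P f := by
  induction f using Finsupp.induction_linear with
  | zero => exact h0
  | add f g hf hg => exact hadd f g hf hg
  | single r c =>
    have : Finsupp.single r c = c • Finsupp.single r (1 : K) := by simp
    rw [this, single_eq_span]
    exact hsmul _ _ (hspan _ _)

theorem comp_assoc {x y z t : A} (f : Subobject (x ⊗ y) →₀ K) (g : Subobject (y ⊗ z) →₀ K)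
    (h : Subobject (z ⊗ t) →₀ K) : comp δ (comp δ f g) h = comp δ f (comp δ g h) := by
  induction f using hom_induction δ with
  | h0 => simp
  | hadd f f' hf hf' => simp [hf, hf']
  | hsmul c f hf => simp [hf]
  | hspan a b =>
  induction g using hom_induction δ with
  | h0 => simp
  | hadd f f' hf hf' => simp [hf, hf']
  | hsmul c f hf => simp [hf]
  | hspan c d =>
  induction h using hom_induction δ with
  | h0 => simp
  | hadd f f' hf hf' => simp [hf, hf']
  | hsmul c f hf => simp [hf]
  | hspan e f => exact comp_assoc_span δ a b c d e f

theorem id_comp_span {x y : A} (f : Subobject (x ⊗ y) →₀ K) :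
    comp δ (span δ (𝟙 x) (𝟙 x)) f = f := by
  induction f using hom_induction δ with
  | h0 => simp
  | hadd f f' hf hf' => simp [hf, hf']
  | hsmul c f hf => simp [hf]
  | hspan a b =>
    rw [comp_span δ _ _ _ _ a (𝟙 _) (IsPullback.of_vert_isIso ⟨by simp⟩)]
    simp

theorem comp_span_id {x y : A} (f : Subobject (x ⊗ y) →₀ K) :
    comp δ f (span δ (𝟙 y) (𝟙 y)) = f := by
  induction f using hom_induction δ with
  | h0 => simp
  | hadd f f' hf hf' => simp [hf, hf']
  | hsmul c f hf => simp [hf]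
  | hspan a b =>
    rw [comp_span δ _ _ _ _ (𝟙 _) b (IsPullback.of_horiz_isIso ⟨by simp⟩)]
    simp

theorem add_comp' {x y z : A} (f f' : Subobject (x ⊗ y) →₀ K) (g : Subobject (y ⊗ z) →₀ K) :
    comp δ (f + f') g = comp δ f g + comp δ f' g := by simp

theorem smul_comp' {x y z : A} (c : K) (f : Subobject (x ⊗ y) →₀ K)
    (g : Subobject (y ⊗ z) →₀ K) : comp δ (c • f) g = c • comp δ f g := by simp

variable {δ}

/-- Morphisms `[x] ⟶ [y]` are the formal `K`-linear combinations of relations between `x` and `y`,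
the identity of `[x]` is given by the diagonal. -/
noncomputable instance : Category (TZero δ) where
  Hom X Y := Subobject (X.obj ⊗ Y.obj) →₀ K
  id X := Finsupp.single (Subobject.mk (lift (𝟙 X.obj) (𝟙 X.obj))) 1
  comp f g := comp δ f g
  id_comp f := by rw [← span_of_mono δ, id_comp_span]
  comp_id f := by rw [← span_of_mono δ, comp_span_id]
  assoc f g h := comp_assoc δ f g h

/-- The `K`-module of morphisms as a module of formal linear combinations. -/
noncomputable instance (X Y : TZero δ) : AddCommGroup (X ⟶ Y) :=
  (Finsupp.instAddCommGroup : AddCommGroup (Subobject (X.obj ⊗ Y.obj) →₀ K))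

noncomputable instance (X Y : TZero δ) : Module K (X ⟶ Y) :=
  (Finsupp.module _ _ : Module K (Subobject (X.obj ⊗ Y.obj) →₀ K))

noncomputable instance : Preadditive (TZero δ) where
  homGroup := inferInstance
  add_comp _ _ _ f f' g := add_comp' δ f f' g
  comp_add _ _ _ f g g' := map_add (comp δ f) g g'

noncomputable instance : Linear K (TZero δ) where
  homModule := inferInstance
  smul_comp _ _ _ c f g := smul_comp' δ c f g
  comp_smul _ _ _ f c g := map_smul (comp δ f) c g

variable (δ) in
/-- The morphism `⟨r⟩` given by a relation. -/
noncomputable def rel {x y : A} (r : Subobject (x ⊗ y)) : (⟨x⟩ : TZero δ) ⟶ ⟨y⟩ :=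
  Finsupp.single r 1

variable (δ) in
/-- The morphism `[f] = ⟨Γ_f⟩ : [x] ⟶ [y]`, with `Γ_f` the graph of `f : x ⟶ y`. -/
noncomputable def graph {x y : A} (f : x ⟶ y) : (⟨x⟩ : TZero δ) ⟶ ⟨y⟩ :=
  rel δ (Subobject.mk (lift (𝟙 x) f))

variable (δ) in
/-- The morphism `[f]^∨ = ⟨Γ_f^∨⟩ : [y] ⟶ [x]`. -/
noncomputable def cograph {x y : A} (f : x ⟶ y) : (⟨y⟩ : TZero δ) ⟶ ⟨x⟩ :=
  rel δ (Subobject.mk (lift f (𝟙 x)))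

variable (δ) in
/-- `span` as a morphism of `T⁰`. -/
noncomputable def spanHom {t x y : A} (a : t ⟶ x) (b : t ⟶ y) : (⟨x⟩ : TZero δ) ⟶ ⟨y⟩ :=
  span δ a b

theorem graph_eq {x y : A} (f : x ⟶ y) : graph δ f = spanHom δ (𝟙 x) f :=
  (span_of_mono δ _ _).symm

theorem cograph_eq {x y : A} (f : x ⟶ y) : cograph δ f = spanHom δ f (𝟙 x) :=
  (span_of_mono δ _ _).symm

theorem graph_id (x : A) : graph δ (𝟙 x) = 𝟙 _ := rfl

theorem spanHom_comp {t t' p x y z : A} {a : t ⟶ x} {b : t ⟶ y} {c : t' ⟶ y} {d : t' ⟶ z}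
    {f : p ⟶ t} {g : p ⟶ t'} (h : IsPullback f g b c) :
    spanHom δ a b ≫ spanHom δ c d = spanHom δ (f ≫ a) (g ≫ d) :=
  comp_span δ a b c d f g h

theorem spanHom_comp_graph {t x y z : A} (a : t ⟶ x) (b : t ⟶ y) (f : y ⟶ z) :
    spanHom δ a b ≫ graph δ f = spanHom δ a (b ≫ f) := by
  rw [graph_eq, spanHom_comp (IsPullback.of_horiz_isIso ⟨by simp⟩ : IsPullback (𝟙 _) b b (𝟙 _))]
  simp

theorem cograph_comp_spanHom {t x y z : A} (a : t ⟶ x) (b : t ⟶ y) (f : x ⟶ z) :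
    cograph δ f ≫ spanHom δ a b = spanHom δ (a ≫ f) b := by
  rw [cograph_eq, spanHom_comp (IsPullback.of_vert_isIso ⟨by simp⟩ : IsPullback a (𝟙 _) (𝟙 _) a)]
  simp

theorem graph_comp {x y z : A} (f : x ⟶ y) (g : y ⟶ z) :
    graph δ (f ≫ g) = graph δ f ≫ graph δ g := by
  rw [graph_eq f, spanHom_comp_graph, graph_eq]

theorem spanHom_comp_iso {t t' x y : A} (e : t ⟶ t') [IsIso e] (a : t' ⟶ x) (b : t' ⟶ y) :
    spanHom δ (e ≫ a) (e ≫ b) = spanHom δ a b :=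
  span_comp_iso δ e a b

theorem cograph_iso {x y : A} (e : x ≅ y) : cograph δ e.hom = graph δ e.inv := by
  rw [cograph_eq, graph_eq, ← spanHom_comp_iso e.inv e.hom]
  simp

theorem graph_iso_comp_spanHom {t x y z : A} (e : z ≅ x) (a : t ⟶ x) (b : t ⟶ y) :
    graph δ e.hom ≫ spanHom δ a b = spanHom δ (a ≫ e.inv) b := by
  have := cograph_iso (δ := δ) e.symm
  simp only [Iso.symm_hom, Iso.symm_inv] at this
  rw [← this, cograph_comp_spanHom]

variable (δ) in
/-- The isomorphism `[x] ≅ [y]` induced by an isomorphism `x ≅ y` of `A`. -/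
noncomputable def graphIso {x y : A} (e : x ≅ y) : (⟨x⟩ : TZero δ) ≅ ⟨y⟩ where
  hom := graph δ e.hom
  inv := graph δ e.inv
  hom_inv_id := by rw [← graph_comp, e.hom_inv_id, graph_id]
  inv_hom_id := by rw [← graph_comp, e.inv_hom_id, graph_id]

instance mono_lift_tensorHom {t x y t' x' y' : A} (a : t ⟶ x) (b : t ⟶ y) (a' : t' ⟶ x')
    (b' : t' ⟶ y') [Mono (lift a b)] [Mono (lift a' b')] :
    Mono (lift (a ⊗ₘ a') (b ⊗ₘ b')) where
  right_cancellation k l h := by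
    have h₁ := h =≫ fst _ _
    have h₂ := h =≫ snd _ _
    simp only [Category.assoc, lift_fst, lift_snd] at h₁ h₂
    apply CartesianMonoidalCategory.hom_ext
    · rw [← cancel_mono (lift a b)]
      ext
      · simpa using h₁ =≫ fst _ _
      · simpa using h₂ =≫ fst _ _
    · rw [← cancel_mono (lift a' b')]
      ext
      · simpa using h₁ =≫ snd _ _
      · simpa using h₂ =≫ snd _ _

instance mono_lift_arrow {x y : A} (r : Subobject (x ⊗ y)) :
    Mono (lift (r.arrow ≫ fst x y) (r.arrow ≫ snd x y)) := by
  rw [lift_comp_fst_snd]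
  infer_instance

/-- The relation `r × s` between `x × x'` and `y × y'`. -/
noncomputable def tensorRel {x y x' y' : A} (r : Subobject (x ⊗ y)) (s : Subobject (x' ⊗ y')) :
    Subobject ((x ⊗ x') ⊗ (y ⊗ y')) :=
  Subobject.mk (lift ((r.arrow ≫ fst x y) ⊗ₘ (s.arrow ≫ fst x' y'))
    ((r.arrow ≫ snd x y) ⊗ₘ (s.arrow ≫ snd x' y')))

variable (K) in
/-- The tensor product of morphisms of `T⁰`: the bilinear extension of `⟨r⟩ ⊗ ⟨s⟩ = ⟨r × s⟩`. -/
noncomputable def tensor {x y x' y' : A} :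
    (Subobject (x ⊗ y) →₀ K) →ₗ[K] (Subobject (x' ⊗ y') →₀ K) →ₗ[K]
      (Subobject ((x ⊗ x') ⊗ (y ⊗ y')) →₀ K) :=
  Finsupp.linearCombination K fun r => Finsupp.linearCombination K fun s =>
    Finsupp.single (tensorRel r s) 1

theorem tensor_span {t x y t' x' y' : A} (a : t ⟶ x) (b : t ⟶ y) (a' : t' ⟶ x')
    (b' : t' ⟶ y') : tensor K (span δ a b) (span δ a' b') = span δ (a ⊗ₘ a') (b ⊗ₘ b') := by
  rw [span_eq, span_eq, map_smul, map_smul, LinearMap.smul_apply, smul_smul]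
  have h₁ : a ⊗ₘ a' = (toIm (lift a b) ⊗ₘ toIm (lift a' b')) ≫
      (((im (lift a b)).arrow ≫ fst x y) ⊗ₘ ((im (lift a' b')).arrow ≫ fst x' y')) := by
    rw [tensorHom_comp_tensorHom, toIm_fst, toIm_fst]
  have h₂ : b ⊗ₘ b' = (toIm (lift a b) ⊗ₘ toIm (lift a' b')) ≫
      (((im (lift a b)).arrow ≫ snd x y) ⊗ₘ ((im (lift a' b')).arrow ≫ snd x' y')) := by
    rw [tensorHom_comp_tensorHom, toIm_snd, toIm_snd]
  rw [h₁, h₂, span_comp_surj, DegreeFunction.deg_tensorHom, span_of_mono, mul_comm]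
  simp [tensor, tensorRel]

theorem tensor_comp_span {t x y t' x' y' s z s' z' : A} (a : t ⟶ x) (b : t ⟶ y) (a' : t' ⟶ x')
    (b' : t' ⟶ y') (c : s ⟶ y) (d : s ⟶ z) (c' : s' ⟶ y') (d' : s' ⟶ z') :
    comp δ (tensor K (span δ a b) (span δ a' b')) (tensor K (span δ c d) (span δ c' d')) =
      tensor K (comp δ (span δ a b) (span δ c d)) (comp δ (span δ a' b') (span δ c' d')) := by
  rw [tensor_span, tensor_span]
  by_cases h₁ : ∃ (p : A) (k : p ⟶ t) (l : p ⟶ s), k ≫ b = l ≫ c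
  · obtain ⟨p, k, l, hkl⟩ := h₁
    have := IsRegular.hasPullback_of_comm k l b c hkl
    have H := IsPullback.of_hasPullback b c
    rw [comp_span δ _ _ _ _ _ _ H]
    by_cases h₂ : ∃ (p : A) (k : p ⟶ t') (l : p ⟶ s'), k ≫ b' = l ≫ c'
    · obtain ⟨p', k', l', hkl'⟩ := h₂
      have := IsRegular.hasPullback_of_comm k' l' b' c' hkl'
      have H' := IsPullback.of_hasPullback b' c'
      rw [comp_span δ _ _ _ _ _ _ H', tensor_span,
        comp_span δ _ _ _ _ (pullback.fst b c ⊗ₘ pullback.fst b' c')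
          (pullback.snd b c ⊗ₘ pullback.snd b' c')]
      · simp
      · refine isPullback_of_exists (by simp [H.w, H'.w]) (fun {q} f g hfg => ?_)
          (fun {q} f g h₁ h₂ => ?_)
        · have e₁ := hfg =≫ fst _ _
          have e₂ := hfg =≫ snd _ _
          simp only [Category.assoc, tensorHom_fst, tensorHom_snd] at e₁ e₂
          refine ⟨lift (H.lift (f ≫ fst _ _) (g ≫ fst _ _) (by simpa using e₁))
            (H'.lift (f ≫ snd _ _) (g ≫ snd _ _) (by simpa using e₂)), ?_, ?_⟩
          · ext <;> simp
          · ext <;> simp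
        · apply CartesianMonoidalCategory.hom_ext
          · apply H.hom_ext
            · simpa using h₁ =≫ fst _ _
            · simpa using h₂ =≫ fst _ _
          · apply H'.hom_ext
            · simpa using h₁ =≫ snd _ _
            · simpa using h₂ =≫ snd _ _
    · rw [comp_span_zero δ a' b' c' d', map_zero, comp_span_zero]
      · intro p k l hkl
        exact h₂ ⟨p, k ≫ snd _ _, l ≫ snd _ _, by simpa using hkl =≫ snd _ _⟩
      · exact fun k l hkl => h₂ ⟨_, k, l, hkl⟩
  · rw [comp_span_zero δ a b c d, map_zero, LinearMap.zero_apply, comp_span_zero]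
    · intro p k l hkl
      exact h₁ ⟨p, k ≫ fst _ _, l ≫ fst _ _, by simpa using hkl =≫ fst _ _⟩
    · exact fun k l hkl => h₁ ⟨_, k, l, hkl⟩

variable (δ) in
theorem tensor_comp {x y z x' y' z' : A} (f : Subobject (x ⊗ y) →₀ K)
    (f' : Subobject (x' ⊗ y') →₀ K) (g : Subobject (y ⊗ z) →₀ K) (g' : Subobject (y' ⊗ z') →₀ K) :
    comp δ (tensor K f f') (tensor K g g') = tensor K (comp δ f g) (comp δ f' g') := by
  induction f using hom_induction δ with
  | h0 => simp
  | hadd f g hf hg => simp [hf, hg]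
  | hsmul c f hf => simp [hf]
  | hspan a b =>
  induction f' using hom_induction δ with
  | h0 => simp
  | hadd f g hf hg => simp [hf, hg]
  | hsmul c f hf => simp [hf]
  | hspan a' b' =>
  induction g using hom_induction δ with
  | h0 => simp
  | hadd f g hf hg => simp [hf, hg]
  | hsmul c f hf => simp [hf]
  | hspan c d =>
  induction g' using hom_induction δ with
  | h0 => simp
  | hadd f g hf hg => simp [hf, hg]
  | hsmul c f hf => simp [hf]
  | hspan c' d' => exact tensor_comp_span a b a' b' c d c' d'

theorem tensor_graph {x y x' y' : A} (f : x ⟶ y) (g : x' ⟶ y') :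
    tensor K (graph δ f) (graph δ g) = graph δ (f ⊗ₘ g) := by
  rw [graph_eq, graph_eq, graph_eq]
  exact (tensor_span _ _ _ _).trans (by rw [id_tensorHom_id]; rfl)

noncomputable instance : MonoidalCategoryStruct (TZero δ) where
  tensorObj X Y := ⟨X.obj ⊗ Y.obj⟩
  tensorUnit := ⟨𝟙_ A⟩
  tensorHom f g := tensor K f g
  whiskerLeft X _ _ f := tensor K (𝟙 X : X ⟶ X) f
  whiskerRight f Y := tensor K f (𝟙 Y : Y ⟶ Y)
  associator X Y Z := graphIso δ (α_ X.obj Y.obj Z.obj)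
  leftUnitor X := graphIso δ (λ_ X.obj)
  rightUnitor X := graphIso δ (ρ_ X.obj)

theorem tensorHom_graph {x y x' y' : A} (f : x ⟶ y) (g : x' ⟶ y') :
    graph δ f ⊗ₘ graph δ g = graph δ (f ⊗ₘ g) :=
  tensor_graph f g

theorem tensorHom_spanHom {t x y t' x' y' : A} (a : t ⟶ x) (b : t ⟶ y) (a' : t' ⟶ x')
    (b' : t' ⟶ y') : spanHom δ a b ⊗ₘ spanHom δ a' b' = spanHom δ (a ⊗ₘ a') (b ⊗ₘ b') :=
  tensor_span a b a' b'

theorem add_tensorHom {X Y X' Y' : TZero δ} (f g : X ⟶ Y) (h : X' ⟶ Y') :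
    (f + g) ⊗ₘ h = f ⊗ₘ h + g ⊗ₘ h :=
  LinearMap.map_add₂ (tensor K) f g h

theorem tensorHom_add {X Y X' Y' : TZero δ} (h : X ⟶ Y) (f g : X' ⟶ Y') :
    h ⊗ₘ (f + g) = h ⊗ₘ f + h ⊗ₘ g :=
  map_add (tensor K h) f g

theorem smul_tensorHom {X Y X' Y' : TZero δ} (c : K) (f : X ⟶ Y) (h : X' ⟶ Y') :
    (c • f) ⊗ₘ h = c • (f ⊗ₘ h) :=
  LinearMap.map_smul₂ (tensor K) c f h

theorem tensorHom_smul {X Y X' Y' : TZero δ} (c : K) (h : X ⟶ Y) (f : X' ⟶ Y') :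
    h ⊗ₘ (c • f) = c • (h ⊗ₘ f) :=
  map_smul (tensor K h) c f

theorem zero_tensorHom {X Y X' Y' : TZero δ} (h : X' ⟶ Y') : (0 : X ⟶ Y) ⊗ₘ h = 0 :=
  LinearMap.map_zero₂ (tensor K) h

theorem tensorHom_zero {X Y X' Y' : TZero δ} (h : X ⟶ Y) : h ⊗ₘ (0 : X' ⟶ Y') = 0 :=
  map_zero (tensor K h)

theorem iso_naturality {x y x' y' t : A} (e : x ≅ x') (e' : y ≅ y') (u : t ⟶ x) (v : t ⟶ y)
    {t' : A} (u' : t' ⟶ x') (v' : t' ⟶ y') (j : t ≅ t') (h₁ : u ≫ e.hom = j.hom ≫ u')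
    (h₂ : v ≫ e'.hom = j.hom ≫ v') :
    spanHom δ u v ≫ graph δ e'.hom = graph δ e.hom ≫ spanHom δ u' v' := by
  rw [spanHom_comp_graph, graph_iso_comp_spanHom, h₂, ← spanHom_comp_iso j.hom (u' ≫ e.inv) v',
    ← reassoc_of% h₁, e.hom_inv_id, Category.comp_id]

theorem span_iso_naturality {x y x' y' t : A} (e : x ≅ x') (e' : y ≅ y') (u : t ⟶ x) (v : t ⟶ y)
    {t' : A} (u' : t' ⟶ x') (v' : t' ⟶ y') (j : t ≅ t') (h₁ : u ≫ e.hom = j.hom ≫ u')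
    (h₂ : v ≫ e'.hom = j.hom ≫ v') :
    comp δ (span δ u v) (graph δ e'.hom) = comp δ (graph δ e.hom) (span δ u' v') :=
  iso_naturality e e' u v u' v' j h₁ h₂

variable (δ) in
theorem tensor_assoc {x₁ x₂ x₃ y₁ y₂ y₃ : A} (f₁ : Subobject (x₁ ⊗ y₁) →₀ K)
    (f₂ : Subobject (x₂ ⊗ y₂) →₀ K) (f₃ : Subobject (x₃ ⊗ y₃) →₀ K) :
    comp δ (tensor K (tensor K f₁ f₂) f₃) (graph δ (α_ y₁ y₂ y₃).hom) =
      comp δ (graph δ (α_ x₁ x₂ x₃).hom) (tensor K f₁ (tensor K f₂ f₃)) := by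
  induction f₁ using hom_induction δ with
  | h0 => simp
  | hadd f g hf hg => simp [hf, hg]
  | hsmul c f hf => simp [hf]
  | hspan a₁ b₁ =>
  induction f₂ using hom_induction δ with
  | h0 => simp
  | hadd f g hf hg => simp [hf, hg]
  | hsmul c f hf => simp [hf]
  | hspan a₂ b₂ =>
  induction f₃ using hom_induction δ with
  | h0 => simp
  | hadd f g hf hg => simp [hf, hg]
  | hsmul c f hf => simp [hf]
  | hspan a₃ b₃ =>
  rw [tensor_span, tensor_span, tensor_span, tensor_span]
  exact span_iso_naturality _ _ _ _ _ _ (α_ _ _ _)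
    (MonoidalCategory.associator_naturality _ _ _) (MonoidalCategory.associator_naturality _ _ _)

variable (δ) in
theorem tensor_leftUnitor {x y : A} (f : Subobject (x ⊗ y) →₀ K) :
    comp δ (tensor K (span δ (𝟙 (𝟙_ A)) (𝟙 (𝟙_ A))) f) (graph δ (λ_ y).hom) =
      comp δ (graph δ (λ_ x).hom) f := by
  induction f using hom_induction δ with
  | h0 => simp
  | hadd f g hf hg => simp [hf, hg]
  | hsmul c f hf => simp [hf]
  | hspan a b =>
  rw [tensor_span]
  exact span_iso_naturality _ _ _ _ _ _ (λ_ _) (by simp) (by simp)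

variable (δ) in
theorem tensor_rightUnitor {x y : A} (f : Subobject (x ⊗ y) →₀ K) :
    comp δ (tensor K f (span δ (𝟙 (𝟙_ A)) (𝟙 (𝟙_ A)))) (graph δ (ρ_ y).hom) =
      comp δ (graph δ (ρ_ x).hom) f := by
  induction f using hom_induction δ with
  | h0 => simp
  | hadd f g hf hg => simp [hf, hg]
  | hsmul c f hf => simp [hf]
  | hspan a b =>
  rw [tensor_span]
  exact span_iso_naturality _ _ _ _ _ _ (ρ_ _) (by simp) (by simp)

variable (δ) in
theorem tensor_braiding [BraidedCategory A] {x y x' y' : A} (f : Subobject (x ⊗ y) →₀ K)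
    (g : Subobject (x' ⊗ y') →₀ K) :
    comp δ (tensor K f g) (graph δ (β_ y y').hom) =
      comp δ (graph δ (β_ x x').hom) (tensor K g f) := by
  induction f using hom_induction δ with
  | h0 => simp
  | hadd f g hf hg => simp [hf, hg]
  | hsmul c f hf => simp [hf]
  | hspan a b =>
  induction g using hom_induction δ with
  | h0 => simp
  | hadd f g hf hg => simp [hf, hg]
  | hsmul c f hf => simp [hf]
  | hspan c d =>
  rw [tensor_span, tensor_span]
  exact span_iso_naturality _ _ _ _ _ _ (β_ _ _) (by simp) (by simp)

theorem id_eq_span (X : TZero δ) : 𝟙 X = span δ (𝟙 X.obj) (𝟙 X.obj) :=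
  (span_of_mono δ _ _).symm

theorem comp_graph_graph {x y z : A} (f : x ⟶ y) (g : y ⟶ z) :
    comp δ (graph δ f) (graph δ g) = graph δ (f ≫ g) :=
  (graph_comp f g).symm

theorem tensor_id_id (x y : A) : tensor K (graph δ (𝟙 x)) (graph δ (𝟙 y)) = graph δ (𝟙 (x ⊗ y)) := by
  rw [tensor_graph, id_tensorHom_id]

theorem graph_pentagon (w x y z : A) :
    comp δ (tensor K (graph δ (α_ w x y).hom) (graph δ (𝟙 z))) (comp δ (graph δ (α_ w (x ⊗ y) z).hom)
      (tensor K (graph δ (𝟙 w)) (graph δ (α_ x y z).hom))) =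
    comp δ (graph δ (α_ (w ⊗ x) y z).hom) (graph δ (α_ w x (y ⊗ z)).hom) := by
  rw [tensor_graph, tensor_graph, comp_graph_graph, comp_graph_graph, comp_graph_graph]
  simp

theorem graph_triangle (x y : A) :
    comp δ (graph δ (α_ x (𝟙_ A) y).hom) (tensor K (graph δ (𝟙 x)) (graph δ (λ_ y).hom)) =
      tensor K (graph δ (ρ_ x).hom) (graph δ (𝟙 y)) := by
  rw [tensor_graph, tensor_graph, comp_graph_graph]
  simp

theorem graph_hexagon_forward [BraidedCategory A] (x y z : A) :
    comp δ (graph δ (α_ x y z).hom) (comp δ (graph δ (β_ x (y ⊗ z)).hom)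
      (graph δ (α_ y z x).hom)) =
    comp δ (tensor K (graph δ (β_ x y).hom) (graph δ (𝟙 z))) (comp δ (graph δ (α_ y x z).hom)
      (tensor K (graph δ (𝟙 y)) (graph δ (β_ x z).hom))) := by
  rw [tensor_graph, tensor_graph, comp_graph_graph, comp_graph_graph, comp_graph_graph,
    comp_graph_graph]
  simp

theorem graph_hexagon_reverse [BraidedCategory A] (x y z : A) :
    comp δ (graph δ (α_ x y z).inv) (comp δ (graph δ (β_ (x ⊗ y) z).hom)
      (graph δ (α_ z x y).inv)) =
    comp δ (tensor K (graph δ (𝟙 x)) (graph δ (β_ y z).hom)) (comp δ (graph δ (α_ x z y).inv)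
      (tensor K (graph δ (β_ x z).hom) (graph δ (𝟙 y)))) := by
  rw [tensor_graph, tensor_graph, comp_graph_graph, comp_graph_graph, comp_graph_graph,
    comp_graph_graph]
  simp

noncomputable instance : MonoidalCategory (TZero δ) :=
  MonoidalCategory.ofTensorHom
    (id_tensorHom_id := fun X Y => tensor_id_id X.obj Y.obj)
    (id_tensorHom := fun _ _ _ _ => rfl)
    (tensorHom_id := fun _ _ => rfl)
    (tensorHom_comp_tensorHom := fun f₁ f₂ g₁ g₂ => tensor_comp δ f₁ f₂ g₁ g₂)
    (associator_naturality := fun f₁ f₂ f₃ => tensor_assoc δ f₁ f₂ f₃)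
    (leftUnitor_naturality := fun {X Y} f => by
      rw [id_eq_span]
      exact tensor_leftUnitor δ f)
    (rightUnitor_naturality := fun {X Y} f => by
      rw [id_eq_span]
      exact tensor_rightUnitor δ f)
    (pentagon := fun W X Y Z => graph_pentagon W.obj X.obj Y.obj Z.obj)
    (triangle := fun X Y => graph_triangle X.obj Y.obj)

instance : MonoidalPreadditive (TZero δ) where
  whiskerLeft_zero := tensorHom_zero _
  zero_whiskerRight := zero_tensorHom _
  whiskerLeft_add _ _ := tensorHom_add _ _ _
  add_whiskerRight _ _ := add_tensorHom _ _ _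

instance : MonoidalLinear K (TZero δ) where
  whiskerLeft_smul _ _ _ c f := tensorHom_smul c _ f
  smul_whiskerRight c _ _ f _ := smul_tensorHom c f _

noncomputable instance [BraidedCategory A] : SymmetricCategory (TZero δ) where
  braiding X Y := graphIso δ (β_ X.obj Y.obj)
  braiding_naturality_right X {Y Z} f := tensor_braiding δ (𝟙 X : X ⟶ X) f
  braiding_naturality_left {X Y} f Z := tensor_braiding δ f (𝟙 Z : Z ⟶ Z)
  hexagon_forward X Y Z := graph_hexagon_forward X.obj Y.obj Z.obj
  hexagon_reverse X Y Z := graph_hexagon_reverse X.obj Y.obj Z.obj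
  symmetry X Y := (comp_graph_graph _ _).trans (by rw [SymmetricCategory.symmetry]; rfl)

end TZero

end TZero

/-! ### Linear and monoidal structure on the additive hull -/

section MatLinear

variable {C : Type u} [Category.{v} C] [Preadditive C] {K : Type w} [Semiring K] [Linear K C]

instance matModule (M N : Mat_ C) : Module K (M ⟶ N) :=
  (Pi.module _ _ _ : Module K (∀ (i : M.ι) (j : N.ι), M.X i ⟶ N.X j))

theorem mat_smul_apply {M N : Mat_ C} (c : K) (f : M ⟶ N) (i : M.ι) (j : N.ι) :
    (c • f) i j = c • f i j := rfl

instance matLinear : Linear K (Mat_ C) where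
  homModule := inferInstance
  smul_comp _ _ _ c f g := by
    ext i k
    simp [mat_smul_apply, Finset.smul_sum]
  comp_smul _ _ _ f c g := by
    ext i k
    simp [mat_smul_apply, Finset.smul_sum]

end MatLinear

section MatMonoidal

variable {C : Type u} [Category.{v} C] [Preadditive C]

open scoped Classical in
/-- The matrix with entries `φ i : M.X i ⟶ N.X (e i)` and zeros elsewhere. -/
noncomputable def monomial {M N : Mat_ C} (e : M.ι → N.ι) (φ : ∀ i, M.X i ⟶ N.X (e i)) : M ⟶ N :=
  fun i j => if h : e i = j then φ i ≫ eqToHom (congrArg N.X h) else 0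

@[simp]
theorem monomial_apply {M N : Mat_ C} (e : M.ι → N.ι) (φ : ∀ i, M.X i ⟶ N.X (e i)) (i : M.ι) :
    monomial e φ i (e i) = φ i := by
  simp [monomial]

theorem monomial_apply_ne {M N : Mat_ C} (e : M.ι → N.ι) (φ : ∀ i, M.X i ⟶ N.X (e i)) {i : M.ι}
    {j : N.ι} (h : e i ≠ j) : monomial e φ i j = 0 := by
  simp [monomial, h]

theorem monomial_ext {M N : Mat_ C} {e : M.ι → N.ι} {φ : ∀ i, M.X i ⟶ N.X (e i)} {f : M ⟶ N}
    (h₁ : ∀ i, f i (e i) = φ i) (h₂ : ∀ i j, e i ≠ j → f i j = 0) : f = monomial e φ := by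
  ext i j
  by_cases h : e i = j
  · subst h
    rw [h₁, monomial_apply]
  · rw [h₂ i j h, monomial_apply_ne e φ h]

theorem monomial_comp_apply {M N L : Mat_ C} (e : M.ι → N.ι) (φ : ∀ i, M.X i ⟶ N.X (e i))
    (g : N ⟶ L) (i : M.ι) (k : L.ι) : (monomial e φ ≫ g) i k = φ i ≫ g (e i) k := by
  rw [Mat_.comp_apply, Finset.sum_eq_single (e i)]
  · rw [monomial_apply]
  · intro j _ hj
    rw [monomial_apply_ne e φ hj.symm, zero_comp]
  · simp

theorem comp_monomial_apply {M N L : Mat_ C} (f : L ⟶ M) (e : M.ι → N.ι)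
    (φ : ∀ i, M.X i ⟶ N.X (e i)) (he : Function.Injective e) (k : L.ι) (i : M.ι) :
    (f ≫ monomial e φ) k (e i) = f k i ≫ φ i := by
  rw [Mat_.comp_apply, Finset.sum_eq_single i]
  · rw [monomial_apply]
  · intro j _ hj
    rw [monomial_apply_ne e φ (fun h => hj (he h)), comp_zero]
  · simp

theorem mat_id_eq (M : Mat_ C) : 𝟙 M = monomial (fun i => i) (fun i => 𝟙 (M.X i)) :=
  monomial_ext (fun i => Mat_.id_apply_self M i) (fun i j h => Mat_.id_apply_of_ne M i j h)

theorem monomial_comp_monomial {M N L : Mat_ C} (e : M.ι → N.ι) (φ : ∀ i, M.X i ⟶ N.X (e i))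
    (e' : N.ι → L.ι) (φ' : ∀ i, N.X i ⟶ L.X (e' i)) :
    monomial e φ ≫ monomial e' φ' = monomial (fun i => e' (e i)) (fun i => φ i ≫ φ' (e i)) :=
  monomial_ext (fun i => by rw [monomial_comp_apply, monomial_apply])
    (fun i j h => by rw [monomial_comp_apply, monomial_apply_ne e' φ' h, comp_zero])

/-- The isomorphism given by a bijection of the index sets and isomorphisms of the entries. -/
noncomputable def monomialIso {M N : Mat_ C} (e : M.ι → N.ι) (e' : N.ι → M.ι)
    (h : ∀ i, e' (e i) = i) (h' : ∀ i, e (e' i) = i) (φ : ∀ i, M.X i ⟶ N.X (e i))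
    (φ' : ∀ i, N.X i ⟶ M.X (e' i))
    (hφ : ∀ i, φ i ≫ φ' (e i) = eqToHom (congrArg M.X (h i).symm))
    (hφ' : ∀ i, φ' i ≫ φ (e' i) = eqToHom (congrArg N.X (h' i).symm)) : M ≅ N where
  hom := monomial e φ
  inv := monomial e' φ'
  hom_inv_id := by
    rw [monomial_comp_monomial]
    symm
    refine monomial_ext (fun i => ?_) (fun i j hij => ?_)
    · rw [hφ, Mat_.id_apply, dif_pos (h i).symm]
    · rw [Mat_.id_apply_of_ne]
      rwa [h] at hij
  inv_hom_id := by
    rw [monomial_comp_monomial]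
    symm
    refine monomial_ext (fun i => ?_) (fun i j hij => ?_)
    · rw [hφ', Mat_.id_apply, dif_pos (h' i).symm]
    · rw [Mat_.id_apply_of_ne]
      rwa [h'] at hij

theorem monomial_naturality {M N M' N' : Mat_ C} (f : M ⟶ M') (g : N ⟶ N') (e : M.ι → N.ι)
    (φ : ∀ i, M.X i ⟶ N.X (e i)) (e' : M'.ι → N'.ι) (φ' : ∀ i, M'.X i ⟶ N'.X (e' i))
    (he : Function.Bijective e') (h : ∀ i j, f i j ≫ φ' j = φ i ≫ g (e i) (e' j)) :
    f ≫ monomial e' φ' = monomial e φ ≫ g := by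
  ext i k
  obtain ⟨j, rfl⟩ := he.2 k
  rw [comp_monomial_apply _ _ _ he.1, monomial_comp_apply, h]

theorem eq_of_eq_monomial {M N : Mat_ C} {f g : M ⟶ N} {e : M.ι → N.ι}
    {φ φ' : ∀ i, M.X i ⟶ N.X (e i)} (hf : f = monomial e φ) (hg : g = monomial e φ')
    (h : ∀ i, φ i = φ' i) : f = g := by
  rw [hf, hg, funext h]

theorem comp_eq_monomial {M N L : Mat_ C} {f : M ⟶ N} {g : N ⟶ L} {e : M.ι → N.ι}
    {φ : ∀ i, M.X i ⟶ N.X (e i)} {e' : N.ι → L.ι} {φ' : ∀ i, N.X i ⟶ L.X (e' i)}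
    (hf : f = monomial e φ) (hg : g = monomial e' φ') :
    f ≫ g = monomial (fun i => e' (e i)) (fun i => φ i ≫ φ' (e i)) := by
  rw [hf, hg, monomial_comp_monomial]

variable [MonoidalCategory C]

/-- `(⨁ᵢ xᵢ) ⊗ (⨁ⱼ yⱼ) = ⨁ᵢⱼ xᵢ ⊗ yⱼ` -/
abbrev matTensorObj (M N : Mat_ C) : Mat_ C := ⟨M.ι × N.ι, fun p => M.X p.1 ⊗ N.X p.2⟩

/-- The tensor product of matrices. -/
def matTensorHom {M N M' N' : Mat_ C} (f : M ⟶ N) (g : M' ⟶ N') :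
    matTensorObj M M' ⟶ matTensorObj N N' :=
  fun p q => f p.1 q.1 ⊗ₘ g p.2 q.2

variable [MonoidalPreadditive C]

theorem matTensorHom_monomial {M N M' N' : Mat_ C} (e : M.ι → N.ι) (φ : ∀ i, M.X i ⟶ N.X (e i))
    (e' : M'.ι → N'.ι) (φ' : ∀ i, M'.X i ⟶ N'.X (e' i)) :
    matTensorHom (monomial e φ) (monomial e' φ') =
      monomial (M := matTensorObj M M') (N := matTensorObj N N')
        (fun p => (e p.1, e' p.2)) (fun p => φ p.1 ⊗ₘ φ' p.2) := by
  refine monomial_ext (fun i => ?_) (fun i j h => ?_)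
  · exact congrArg₂ (· ⊗ₘ ·) (monomial_apply e φ i.1) (monomial_apply e' φ' i.2)
  · change monomial e φ i.1 j.1 ⊗ₘ monomial e' φ' i.2 j.2 = 0
    by_cases h₁ : e i.1 = j.1
    · have h₂ : e' i.2 ≠ j.2 := fun h₂ => h (Prod.ext h₁ h₂)
      rw [monomial_apply_ne e' φ' h₂, MonoidalPreadditive.tensor_zero]
    · rw [monomial_apply_ne e φ h₁, MonoidalPreadditive.zero_tensor]

theorem matTensorHom_id (M N : Mat_ C) : matTensorHom (𝟙 M) (𝟙 N) = 𝟙 (matTensorObj M N) := by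
  rw [mat_id_eq M, mat_id_eq N, matTensorHom_monomial, mat_id_eq]
  congr 1
  funext p
  exact id_tensorHom_id _ _

theorem sum_tensorHom_sum {ι κ : Type*} [Fintype ι] [Fintype κ] {a b a' b' : C} (f : ι → (a ⟶ b))
    (g : κ → (a' ⟶ b')) : (∑ i, f i) ⊗ₘ (∑ j, g j) = ∑ p : ι × κ, f p.1 ⊗ₘ g p.2 := by
  rw [Fintype.sum_prod_type, sum_tensor]
  exact Finset.sum_congr rfl fun i _ => tensor_sum _ _ _

theorem matTensorHom_comp {M N L M' N' L' : Mat_ C} (f : M ⟶ N) (f' : M' ⟶ N') (g : N ⟶ L)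
    (g' : N' ⟶ L') :
    matTensorHom f f' ≫ matTensorHom g g' = matTensorHom (f ≫ g) (f' ≫ g') := by
  ext p q
  have h := sum_tensorHom_sum (fun j => f p.1 j ≫ g j q.1) (fun j => f' p.2 j ≫ g' j q.2)
  refine Eq.trans ?_ h.symm
  rw [Mat_.comp_apply]
  refine Finset.sum_congr rfl fun j _ => ?_
  exact tensorHom_comp_tensorHom _ _ _ _

noncomputable instance matMonoidalStruct : MonoidalCategoryStruct (Mat_ C) where
  tensorObj := matTensorObj
  tensorUnit := (Mat_.embedding C).obj (𝟙_ C)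
  tensorHom := matTensorHom
  whiskerLeft M _ _ f := matTensorHom (𝟙 M) f
  whiskerRight f N := matTensorHom f (𝟙 N)
  associator M N L := monomialIso (M := matTensorObj (matTensorObj M N) L)
    (N := matTensorObj M (matTensorObj N L))
    (fun p => (p.1.1, p.1.2, p.2)) (fun p => ((p.1, p.2.1), p.2.2)) (fun _ => rfl) (fun _ => rfl)
    (fun _ => (α_ _ _ _).hom) (fun _ => (α_ _ _ _).inv)
    (fun _ => (α_ _ _ _).hom_inv_id) (fun _ => (α_ _ _ _).inv_hom_id)
  leftUnitor M := monomialIso (M := matTensorObj ((Mat_.embedding C).obj (𝟙_ C)) M) (N := M)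
    (fun p => p.2) (fun i => (PUnit.unit, i)) (fun _ => rfl) (fun _ => rfl)
    (fun _ => (λ_ _).hom) (fun _ => (λ_ _).inv)
    (fun _ => (λ_ _).hom_inv_id) (fun _ => (λ_ _).inv_hom_id)
  rightUnitor M := monomialIso (M := matTensorObj M ((Mat_.embedding C).obj (𝟙_ C))) (N := M)
    (fun p => p.1) (fun i => (i, PUnit.unit)) (fun _ => rfl) (fun _ => rfl)
    (fun _ => (ρ_ _).hom) (fun _ => (ρ_ _).inv)
    (fun _ => (ρ_ _).hom_inv_id) (fun _ => (ρ_ _).inv_hom_id)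

theorem tensor_eq_monomial {M N M' N' : Mat_ C} {f : M ⟶ N} {g : M' ⟶ N'} {e : M.ι → N.ι}
    {φ : ∀ i, M.X i ⟶ N.X (e i)} {e' : M'.ι → N'.ι} {φ' : ∀ i, M'.X i ⟶ N'.X (e' i)}
    (hf : f = monomial e φ) (hg : g = monomial e' φ') :
    matTensorHom f g = monomial (M := matTensorObj M M') (N := matTensorObj N N')
        (fun p => (e p.1, e' p.2)) (fun p => φ p.1 ⊗ₘ φ' p.2) := by
  rw [hf, hg, matTensorHom_monomial]

theorem mat_id_unit : (𝟙 (𝟙_ (Mat_ C)) : 𝟙_ (Mat_ C) ⟶ 𝟙_ (Mat_ C)) = fun _ _ => 𝟙 (𝟙_ C) := by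
  funext i j
  exact Mat_.id_apply_self _ _

noncomputable instance matMonoidal : MonoidalCategory (Mat_ C) :=
  MonoidalCategory.ofTensorHom
    (id_tensorHom_id := matTensorHom_id)
    (id_tensorHom := fun _ _ _ _ => rfl)
    (tensorHom_id := fun _ _ => rfl)
    (tensorHom_comp_tensorHom := matTensorHom_comp)
    (associator_naturality := fun f₁ f₂ f₃ => by
      refine monomial_naturality _ _ _ _ _ _ (Equiv.prodAssoc _ _ _).bijective ?_
      intro i j
      exact MonoidalCategory.associator_naturality _ _ _)
    (leftUnitor_naturality := fun {X Y} f => by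
      refine monomial_naturality _ _ _ _ _ _ (Equiv.punitProd _).bijective ?_
      rw [mat_id_unit]
      intro i j
      have := MonoidalCategory.leftUnitor_naturality (f i.2 j.2)
      rw [← id_tensorHom] at this
      exact this)
    (rightUnitor_naturality := fun {X Y} f => by
      refine monomial_naturality _ _ _ _ _ _ (Equiv.prodPUnit _).bijective ?_
      rw [mat_id_unit]
      intro i j
      have := MonoidalCategory.rightUnitor_naturality (f i.1 j.1)
      rw [← tensorHom_id] at this
      exact this)
    (pentagon := fun W X Y Z => eq_of_eq_monomial
      (comp_eq_monomial (tensor_eq_monomial rfl (mat_id_eq Z))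
        (comp_eq_monomial rfl (tensor_eq_monomial (mat_id_eq W) rfl)))
      (comp_eq_monomial rfl rfl)
      (fun i => by
        have := MonoidalCategory.pentagon (W.X i.1.1.1) (X.X i.1.1.2) (Y.X i.1.2) (Z.X i.2)
        rw [← tensorHom_id, ← id_tensorHom] at this
        exact this))
    (triangle := fun X Y => eq_of_eq_monomial
      (comp_eq_monomial rfl (tensor_eq_monomial (mat_id_eq X) rfl))
      (tensor_eq_monomial rfl (mat_id_eq Y))
      (fun i => by
        have := MonoidalCategory.triangle (X.X i.1.1) (Y.X i.2)
        rw [← tensorHom_id, ← id_tensorHom] at this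
        exact this))

instance matMonoidalPreadditive : MonoidalPreadditive (Mat_ C) where
  whiskerLeft_zero := by
    intros
    funext p q
    exact MonoidalPreadditive.tensor_zero _
  zero_whiskerRight := by
    intros
    funext p q
    exact MonoidalPreadditive.zero_tensor _
  whiskerLeft_add _ _ := by
    funext p q
    exact MonoidalPreadditive.tensor_add _ _ _
  add_whiskerRight _ _ := by
    funext p q
    exact MonoidalPreadditive.add_tensor _ _ _

theorem smul_tensorHom_left {K : Type w} [Semiring K] [Linear K C] [MonoidalLinear K C]
    {a b a' b' : C} (c : K) (f : a ⟶ b) (g : a' ⟶ b') : (c • f) ⊗ₘ g = c • (f ⊗ₘ g) := by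
  rw [MonoidalCategory.tensorHom_def, MonoidalLinear.smul_whiskerRight, Linear.smul_comp,
    MonoidalCategory.tensorHom_def]

theorem smul_tensorHom_right {K : Type w} [Semiring K] [Linear K C] [MonoidalLinear K C]
    {a b a' b' : C} (c : K) (f : a ⟶ b) (g : a' ⟶ b') : f ⊗ₘ (c • g) = c • (f ⊗ₘ g) := by
  rw [MonoidalCategory.tensorHom_def, MonoidalLinear.whiskerLeft_smul, Linear.comp_smul,
    MonoidalCategory.tensorHom_def]

instance matMonoidalLinear {K : Type w} [Semiring K] [Linear K C] [MonoidalLinear K C] :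
    MonoidalLinear K (Mat_ C) where
  whiskerLeft_smul _ _ _ c f := by
    funext p q
    exact smul_tensorHom_right _ _ _
  smul_whiskerRight c _ _ f _ := by
    funext p q
    exact smul_tensorHom_left _ _ _

noncomputable instance matSymmetric [SymmetricCategory C] : SymmetricCategory (Mat_ C) where
  braiding M N := monomialIso (M := matTensorObj M N) (N := matTensorObj N M)
    (fun p => (p.2, p.1)) (fun p => (p.2, p.1)) (fun _ => rfl) (fun _ => rfl)
    (fun _ => (β_ _ _).hom) (fun _ => (β_ _ _).inv)
    (fun _ => (β_ _ _).hom_inv_id) (fun _ => (β_ _ _).inv_hom_id)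
  braiding_naturality_right X {Y Z} f := by
    refine monomial_naturality _ _ _ _ _ _ (Equiv.prodComm _ _).bijective ?_
    intro i j
    exact BraidedCategory.braiding_naturality _ _
  braiding_naturality_left f Z := by
    refine monomial_naturality _ _ _ _ _ _ (Equiv.prodComm _ _).bijective ?_
    intro i j
    exact BraidedCategory.braiding_naturality _ _
  hexagon_forward X Y Z := eq_of_eq_monomial
    (comp_eq_monomial rfl (comp_eq_monomial rfl rfl))
    (comp_eq_monomial (tensor_eq_monomial rfl (mat_id_eq Z))
      (comp_eq_monomial rfl (tensor_eq_monomial (mat_id_eq Y) rfl)))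
    (fun i => by
      have := BraidedCategory.hexagon_forward (X.X i.1.1) (Y.X i.1.2) (Z.X i.2)
      rw [← tensorHom_id, ← id_tensorHom] at this
      exact this)
  hexagon_reverse X Y Z := eq_of_eq_monomial
    (comp_eq_monomial rfl (comp_eq_monomial rfl rfl))
    (comp_eq_monomial (tensor_eq_monomial (mat_id_eq X) rfl)
      (comp_eq_monomial rfl (tensor_eq_monomial rfl (mat_id_eq Y))))
    (fun i => by
      have := BraidedCategory.hexagon_reverse (X.X i.1) (Y.X i.2.1) (Z.X i.2.2)
      rw [← tensorHom_id, ← id_tensorHom] at this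
      exact this)
  symmetry X Y := eq_of_eq_monomial (comp_eq_monomial rfl rfl) (mat_id_eq _)
    (fun i => SymmetricCategory.symmetry _ _)

end MatMonoidal

/-! ### Linear and monoidal structure on the Karoubi envelope -/

section KaroubiLinear

variable {C : Type u} [Category.{v} C] [Preadditive C] {K : Type w} [Semiring K] [Linear K C]

instance karoubiSMul (P Q : Karoubi C) : SMul K (P ⟶ Q) where
  smul c f := ⟨c • f.f, by rw [Linear.smul_comp, Linear.comp_smul, f.comm]⟩

theorem karoubi_smul_f {P Q : Karoubi C} (c : K) (f : P ⟶ Q) : (c • f).f = c • f.f := rfl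

instance karoubiModule (P Q : Karoubi C) : Module K (P ⟶ Q) :=
  Function.Injective.module K (Karoubi.inclusionHom P Q) (fun _ _ h => Karoubi.hom_ext _ _ h)
    (fun _ _ => rfl)

instance karoubiLinear : Linear K (Karoubi C) where
  homModule := inferInstance
  smul_comp _ _ _ c f g := by
    ext
    exact Linear.smul_comp _ _ _ c f.f g.f
  comp_smul _ _ _ f c g := by
    ext
    exact Linear.comp_smul _ _ _ f.f c g.f

end KaroubiLinear

section KaroubiLift

variable {C : Type u} [Category.{v} C]

/-- The morphism of the Karoubi envelope induced by a morphism of the underlying objects that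
commutes with the idempotents. -/
def karoubiLift {P Q : Karoubi C} (e : P.X ⟶ Q.X) (h : P.p ≫ e = e ≫ Q.p) : P ⟶ Q :=
  ⟨P.p ≫ e, by rw [Category.assoc, ← h, P.idem_assoc, P.idem_assoc]⟩

theorem karoubi_naturality {P Q P' Q' : Karoubi C} {e : P.X ⟶ P'.X} {e' : Q.X ⟶ Q'.X}
    {a : P ⟶ P'} {b : Q ⟶ Q'} {f : P ⟶ Q} {g : P' ⟶ Q'} (ha : a.f = P.p ≫ e)
    (hb : b.f = Q.p ≫ e') (h : P.p ≫ e = e ≫ P'.p) (w : f.f ≫ e' = e ≫ g.f) :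
    f ≫ b = a ≫ g := by
  ext
  rw [Karoubi.comp_f, Karoubi.comp_f, ha, hb, Karoubi.comp_p_assoc, w, h, Category.assoc,
    Karoubi.p_comp]

theorem karoubi_id (P : Karoubi C) : (𝟙 P : P ⟶ P).f = P.p ≫ 𝟙 P.X := by
  rw [Category.comp_id]
  rfl

theorem karoubi_comp {P Q R : Karoubi C} {f : P ⟶ Q} {g : Q ⟶ R} {e : P.X ⟶ Q.X}
    {e' : Q.X ⟶ R.X} (hf : f.f = P.p ≫ e) (hg : g.f = Q.p ≫ e') :
    (f ≫ g).f = P.p ≫ e ≫ e' := by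
  rw [Karoubi.comp_f, hg, Karoubi.comp_p_assoc, hf, Category.assoc]

theorem karoubi_eq {P Q : Karoubi C} {f g : P ⟶ Q} {e e' : P.X ⟶ Q.X} (hf : f.f = P.p ≫ e)
    (hg : g.f = P.p ≫ e') (h : e = e') : f = g := by
  ext
  rw [hf, hg, h]

/-- An isomorphism of the underlying objects that is compatible with the idempotents. -/
def karoubiIso {P Q : Karoubi C} (e : P.X ≅ Q.X) (h : P.p ≫ e.hom = e.hom ≫ Q.p) : P ≅ Q where
  hom := karoubiLift e.hom h
  inv := karoubiLift e.inv (by rw [Iso.eq_inv_comp, ← reassoc_of% h, e.hom_inv_id,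
    Category.comp_id])
  hom_inv_id := by
    ext
    rw [karoubi_comp rfl rfl, e.hom_inv_id, ← karoubi_id]
  inv_hom_id := by
    ext
    rw [karoubi_comp rfl rfl, e.inv_hom_id, ← karoubi_id]

end KaroubiLift

section KaroubiMonoidal

variable {C : Type u} [Category.{v} C] [MonoidalCategory C]

/-- `pX ⊗ qY = (p ⊗ q)(X ⊗ Y)` -/
abbrev karoubiTensorObj (P Q : Karoubi C) : Karoubi C :=
  ⟨P.X ⊗ Q.X, P.p ⊗ₘ Q.p, by rw [tensorHom_comp_tensorHom, P.idem, Q.idem]⟩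

/-- The tensor product of morphisms of the Karoubi envelope. -/
def karoubiTensorHom {P Q P' Q' : Karoubi C} (f : P ⟶ Q) (g : P' ⟶ Q') :
    karoubiTensorObj P P' ⟶ karoubiTensorObj Q Q' :=
  ⟨f.f ⊗ₘ g.f, by
    simp only [tensorHom_comp_tensorHom, Karoubi.comp_p, Karoubi.p_comp]⟩

theorem karoubi_tensor {P Q P' Q' : Karoubi C} {f : P ⟶ Q} {g : P' ⟶ Q'} {e : P.X ⟶ Q.X}
    {e' : P'.X ⟶ Q'.X} (hf : f.f = P.p ≫ e) (hg : g.f = P'.p ≫ e') :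
    (karoubiTensorHom f g).f = (P.p ⊗ₘ P'.p) ≫ (e ⊗ₘ e') := by
  rw [tensorHom_comp_tensorHom, ← hf, ← hg]
  rfl

theorem id_tensorHom_leftUnitor {X Y : C} (f : X ⟶ Y) :
    (𝟙 (𝟙_ C) ⊗ₘ f) ≫ (λ_ Y).hom = (λ_ X).hom ≫ f := by simp

theorem tensorHom_id_rightUnitor {X Y : C} (f : X ⟶ Y) :
    (f ⊗ₘ 𝟙 (𝟙_ C)) ≫ (ρ_ Y).hom = (ρ_ X).hom ≫ f := by simp

noncomputable instance karoubiMonoidalStruct : MonoidalCategoryStruct (Karoubi C) where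
  tensorObj := karoubiTensorObj
  tensorUnit := (toKaroubi C).obj (𝟙_ C)
  tensorHom := karoubiTensorHom
  whiskerLeft P _ _ f := karoubiTensorHom (𝟙 P) f
  whiskerRight f Q := karoubiTensorHom f (𝟙 Q)
  associator P Q R := karoubiIso (P := karoubiTensorObj (karoubiTensorObj P Q) R)
    (Q := karoubiTensorObj P (karoubiTensorObj Q R)) (α_ P.X Q.X R.X)
    (MonoidalCategory.associator_naturality _ _ _)
  leftUnitor P := karoubiIso (P := karoubiTensorObj ((toKaroubi C).obj (𝟙_ C)) P) (Q := P)
    (λ_ P.X) (id_tensorHom_leftUnitor P.p)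
  rightUnitor P := karoubiIso (P := karoubiTensorObj P ((toKaroubi C).obj (𝟙_ C))) (Q := P)
    (ρ_ P.X) (tensorHom_id_rightUnitor P.p)

noncomputable instance karoubiMonoidal : MonoidalCategory (Karoubi C) :=
  MonoidalCategory.ofTensorHom
    (id_tensorHom_id := fun _ _ => rfl)
    (id_tensorHom := fun _ _ _ _ => rfl)
    (tensorHom_id := fun _ _ => rfl)
    (tensorHom_comp_tensorHom := fun f₁ f₂ g₁ g₂ => by
      ext
      exact tensorHom_comp_tensorHom f₁.f f₂.f g₁.f g₂.f)
    (associator_naturality := fun f₁ f₂ f₃ =>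
      karoubi_naturality rfl rfl (MonoidalCategory.associator_naturality _ _ _)
        (MonoidalCategory.associator_naturality f₁.f f₂.f f₃.f))
    (leftUnitor_naturality := fun {P _} f => karoubi_naturality rfl rfl
      (id_tensorHom_leftUnitor P.p) (id_tensorHom_leftUnitor f.f))
    (rightUnitor_naturality := fun {P _} f => karoubi_naturality rfl rfl
      (tensorHom_id_rightUnitor P.p) (tensorHom_id_rightUnitor f.f))
    (pentagon := fun P Q R S => by
      have := MonoidalCategory.pentagon P.X Q.X R.X S.X
      rw [← tensorHom_id, ← id_tensorHom] at this
      exact karoubi_eq (karoubi_comp (karoubi_tensor rfl (karoubi_id S))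
        (karoubi_comp rfl (karoubi_tensor (karoubi_id P) rfl))) (karoubi_comp rfl rfl) this)
    (triangle := fun P Q => by
      have := MonoidalCategory.triangle P.X Q.X
      rw [← tensorHom_id, ← id_tensorHom] at this
      exact karoubi_eq (karoubi_comp rfl (karoubi_tensor (karoubi_id P) rfl))
        (karoubi_tensor rfl (karoubi_id Q)) this)

noncomputable instance karoubiSymmetric [SymmetricCategory C] : SymmetricCategory (Karoubi C) where
  braiding P Q := karoubiIso (P := karoubiTensorObj P Q) (Q := karoubiTensorObj Q P)
    (β_ P.X Q.X) (BraidedCategory.braiding_naturality _ _)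
  braiding_naturality_right X {Y Z} f :=
    karoubi_naturality rfl rfl (BraidedCategory.braiding_naturality _ _)
      (BraidedCategory.braiding_naturality X.p f.f)
  braiding_naturality_left f Z :=
    karoubi_naturality rfl rfl (BraidedCategory.braiding_naturality _ _)
      (BraidedCategory.braiding_naturality f.f Z.p)
  hexagon_forward P Q R := by
    have := BraidedCategory.hexagon_forward P.X Q.X R.X
    rw [← tensorHom_id, ← id_tensorHom] at this
    exact karoubi_eq (karoubi_comp rfl (karoubi_comp rfl rfl))
      (karoubi_comp (karoubi_tensor rfl (karoubi_id R))
        (karoubi_comp rfl (karoubi_tensor (karoubi_id Q) rfl))) this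
  hexagon_reverse P Q R := by
    have := BraidedCategory.hexagon_reverse P.X Q.X R.X
    rw [← tensorHom_id, ← id_tensorHom] at this
    exact karoubi_eq (karoubi_comp rfl (karoubi_comp rfl rfl))
      (karoubi_comp (karoubi_tensor (karoubi_id P) rfl)
        (karoubi_comp rfl (karoubi_tensor rfl (karoubi_id Q)))) this
  symmetry P Q := karoubi_eq (karoubi_comp rfl rfl) (karoubi_id (karoubiTensorObj P Q))
    (SymmetricCategory.symmetry P.X Q.X)

variable [Preadditive C] [MonoidalPreadditive C]

instance karoubiMonoidalPreadditive : MonoidalPreadditive (Karoubi C) where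
  whiskerLeft_zero := Karoubi.hom_ext _ _ (MonoidalPreadditive.tensor_zero _)
  zero_whiskerRight := Karoubi.hom_ext _ _ (MonoidalPreadditive.zero_tensor _)
  whiskerLeft_add _ _ := Karoubi.hom_ext _ _ (MonoidalPreadditive.tensor_add _ _ _)
  add_whiskerRight _ _ := Karoubi.hom_ext _ _ (MonoidalPreadditive.add_tensor _ _ _)

instance karoubiMonoidalLinear {K : Type w} [Semiring K] [Linear K C] [MonoidalLinear K C] :
    MonoidalLinear K (Karoubi C) where
  whiskerLeft_smul _ _ _ _ _ := Karoubi.hom_ext _ _ (smul_tensorHom_right _ _ _)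
  smul_whiskerRight _ _ _ _ _ := Karoubi.hom_ext _ _ (smul_tensorHom_left _ _ _)

end KaroubiMonoidal

/-! ### The category `T(A, δ)` and its objects `[x]` and `[x]^*` -/

section Envelope

variable {A : Type u} [Category.{v} A] [CartesianMonoidalCategory A] [IsRegular A]
  {K : Type w} [CommRing K] (δ : DegreeFunction A K)

/-- `T(A, δ)` is the pseudo-abelian closure of `T⁰(A, δ)`: its objects are the pairs of a formal
finite direct sum of objects of `T⁰(A, δ)` and an idempotent endomorphism of it. -/
abbrev Envelope : Type _ := Karoubi (Mat_ (TZero δ))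

/-- The canonical functor from `T⁰(A, δ)` to `T(A, δ)`. -/
noncomputable abbrev toEnvelope : TZero δ ⥤ Envelope δ := Mat_.embedding (TZero δ) ⋙ toKaroubi (Mat_ (TZero δ))

/-- The generator `[x]` of `T(A, δ)`. -/
noncomputable abbrev gen (x : A) : Envelope δ := (toEnvelope δ).obj ⟨x⟩

/-- The identification `[x] ⊗ [y] = [x × y]` in `T(A, δ)`. -/
noncomputable def genTensor (x y : A) : gen δ x ⊗ gen δ y ≅ gen δ (x ⊗ y) :=
  karoubiIso (P := karoubiTensorObj (gen δ x) (gen δ y)) (Q := gen δ (x ⊗ y))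
    (monomialIso
      (M := matTensorObj ((Mat_.embedding (TZero δ)).obj ⟨x⟩) ((Mat_.embedding (TZero δ)).obj ⟨y⟩))
      (N := (Mat_.embedding (TZero δ)).obj ⟨x ⊗ y⟩)
      (fun _ => PUnit.unit) (fun _ => (PUnit.unit, PUnit.unit)) (fun _ => rfl) (fun _ => rfl)
      (fun _ => 𝟙 (⟨x ⊗ y⟩ : TZero δ)) (fun _ => 𝟙 (⟨x ⊗ y⟩ : TZero δ))
      (fun _ => Category.comp_id _) (fun _ => Category.comp_id _))
    ((congrArg (· ≫ _) (id_tensorHom_id _ _)).trans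
      ((Category.id_comp _).trans (Category.comp_id _).symm))

/-- The identification of `[*]` with the unit object of `T(A, δ)`. -/
noncomputable def genUnit : gen δ (𝟙_ A) ≅ 𝟙_ (Envelope δ) := Iso.refl _

/-- The idempotent `p_u = [i][i]^∨` of `[x]` for a subobject `i : u ⟶ x`. -/
noncomputable def pSub {x : A} (u : Subobject x) : (⟨x⟩ : TZero δ) ⟶ ⟨x⟩ :=
  TZero.cograph δ u.arrow ≫ TZero.graph δ u.arrow

theorem pSub_eq {x : A} (u : Subobject x) : pSub δ u = TZero.spanHom δ u.arrow u.arrow := by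
  rw [pSub, TZero.graph_eq, TZero.cograph_comp_spanHom, Category.id_comp]

theorem pSub_comp {x : A} (u v : Subobject x) :
    (∃ w : Subobject x, (∀ t, t ≤ w ↔ t ≤ u ∧ t ≤ v) ∧ pSub δ u ≫ pSub δ v = pSub δ w) ∨
    ((∀ t, ¬ (t ≤ u ∧ t ≤ v)) ∧ pSub δ u ≫ pSub δ v = 0) := by
  by_cases h : ∃ (t : A) (a : t ⟶ (u : A)) (b : t ⟶ (v : A)), a ≫ u.arrow = b ≫ v.arrow
  · obtain ⟨t, a, b, hab⟩ := h
    have := IsRegular.hasPullback_of_comm a b _ _ hab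
    have H := IsPullback.of_hasPullback u.arrow v.arrow
    left
    refine ⟨Subobject.mk (pullback.fst u.arrow v.arrow ≫ u.arrow), fun t => ⟨fun ht => ⟨?_, ?_⟩,
      fun ht => ?_⟩, ?_⟩
    · exact ht.trans (Subobject.mk_le_of_comm (pullback.fst u.arrow v.arrow) rfl)
    · exact ht.trans (Subobject.mk_le_of_comm (pullback.snd u.arrow v.arrow) H.w.symm)
    · exact Subobject.le_mk_of_comm (H.lift (Subobject.ofLE _ _ ht.1) (Subobject.ofLE _ _ ht.2)
        (by simp)) (by simp)
    · rw [pSub_eq, pSub_eq, pSub_eq, TZero.spanHom_comp H, ← H.w,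
        ← TZero.spanHom_comp_iso (Subobject.underlyingIso
          (pullback.fst u.arrow v.arrow ≫ u.arrow)).inv
          (Subobject.mk (pullback.fst u.arrow v.arrow ≫ u.arrow)).arrow]
      simp
  · right
    refine ⟨fun t ht => h ⟨_, Subobject.ofLE _ _ ht.1, Subobject.ofLE _ _ ht.2, by simp⟩, ?_⟩
    rw [pSub_eq, pSub_eq]
    exact TZero.comp_span_zero δ _ _ _ _ (fun a b hab => h ⟨_, a, b, hab⟩)

variable [SubobjectFinite A]

open scoped Classical in
/-- The idempotent `p_v^* = ∑_{u ⊆ v} μ(u, v) p_u` of `[x]`. -/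
noncomputable def pStar {x : A} (v : Subobject x) : (⟨x⟩ : TZero δ) ⟶ ⟨x⟩ :=
  ∑ u : Subobject x with u ≤ v, mu u v • pSub δ u

open scoped Classical in
theorem sum_pStar {x : A} (v : Subobject x) :
    ∑ u : Subobject x with u ≤ v, pStar δ u = pSub δ v := by
  simp only [pStar]
  rw [Finset.sum_comm' (t' := Finset.univ.filter (· ≤ v)) (s' := fun t => Finset.Icc t v)]
  · simp_rw [← Finset.sum_smul]
    have h : ∀ t : Subobject x, ∑ u ∈ Finset.Icc t v, mu t u = if t = v then 1 else 0 :=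
      fun t => IncidenceAlgebra.sum_Icc_mu_right t v
    simp_rw [h, ite_smul, one_smul, zero_smul]
    simp
  · intro u t
    simp only [Finset.mem_filter, Finset.mem_univ, true_and, Finset.mem_Icc]
    exact ⟨fun h => ⟨⟨h.2, h.1⟩, h.2.trans h.1⟩, fun h => ⟨h.1.2, h.1.1⟩⟩

open scoped Classical in
theorem pSub_comp_pStar {x : A} (w v : Subobject x) :
    pSub δ w ≫ pStar δ v = if v ≤ w then pStar δ v else 0 := by
  induction v using WellFoundedLT.induction with
  | ind v ih =>
  by_cases hvw : v ≤ w
  · rw [if_pos hvw, pStar, Preadditive.comp_sum]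
    refine Finset.sum_congr rfl fun u hu => ?_
    rw [Finset.mem_filter] at hu
    rw [Preadditive.comp_zsmul]
    congr 1
    obtain ⟨t, ht, h⟩ | ⟨h, -⟩ := pSub_comp δ w u
    · have : t = u := le_antisymm ((ht t).1 le_rfl).2 ((ht u).2 ⟨hu.2.trans hvw, le_rfl⟩)
      rw [h, this]
    · exact absurd ⟨hu.2.trans hvw, le_rfl⟩ (h u)
  · rw [if_neg hvw]
    have h₁ : pSub δ w ≫ pSub δ v = ∑ u : Subobject x with u ≤ w ∧ u ≤ v, pStar δ u := by
      obtain ⟨t, ht, h⟩ | ⟨h, h'⟩ := pSub_comp δ w v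
      · rw [h, ← sum_pStar]
        simp_rw [ht]
      · rw [h', Finset.sum_eq_zero]
        intro u hu
        exact absurd (Finset.mem_filter.1 hu).2 (h u)
    have h₂ : pSub δ w ≫ pSub δ v =
        pSub δ w ≫ pStar δ v + ∑ u : Subobject x with u ≤ w ∧ u ≤ v, pStar δ u := by
      rw [← sum_pStar δ v, Preadditive.comp_sum, ← Finset.add_sum_erase
        (Finset.univ.filter (· ≤ v)) (fun u => pSub δ w ≫ pStar δ u)
        (Finset.mem_filter.2 ⟨Finset.mem_univ v, le_rfl⟩)]
      congr 1
      have h₃ : ∀ u ∈ (Finset.univ.filter (· ≤ v)).erase v,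
          pSub δ w ≫ pStar δ u = if u ≤ w then pStar δ u else 0 := by
        intro u hu
        rw [Finset.mem_erase, Finset.mem_filter] at hu
        exact ih u (lt_of_le_of_ne hu.2.2 hu.1)
      rw [Finset.sum_congr rfl h₃, ← Finset.sum_filter]
      refine Finset.sum_congr ?_ fun _ _ => rfl
      ext u
      simp only [Finset.mem_filter, Finset.mem_erase, Finset.mem_univ, true_and]
      exact ⟨fun h => ⟨h.2, h.1.2⟩, fun h => ⟨⟨fun e => hvw (e ▸ h.1), h.2⟩, h.1⟩⟩
    rw [h₁] at h₂
    exact left_eq_add.1 (h₂.trans (add_comm _ _))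

theorem pStar_idem {x : A} (v : Subobject x) : pStar δ v ≫ pStar δ v = pStar δ v := by
  classical
  conv_lhs => lhs; rw [pStar]
  rw [Preadditive.sum_comp, Finset.sum_eq_single v]
  · rw [Preadditive.zsmul_comp, pSub_comp_pStar, if_pos le_rfl]
    have : mu v v = 1 := IncidenceAlgebra.mu_self v
    rw [this, one_smul]
  · intro u hu huv
    rw [Finset.mem_filter] at hu
    rw [Preadditive.zsmul_comp, pSub_comp_pStar, if_neg, smul_zero]
    exact fun h => huv (le_antisymm hu.2 h)
  · simp

/-- The direct summand `[x]^* = p_x^*[x]` of `[x]`. -/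
noncomputable def star (x : A) : Envelope δ where
  X := (Mat_.embedding (TZero δ)).obj ⟨x⟩
  p := (Mat_.embedding (TZero δ)).map (pStar δ (⊤ : Subobject x))
  idem := by rw [← Functor.map_comp, pStar_idem]

/-- The inclusion `[x]^* ⟶ [x]`. -/
noncomputable def starIncl (x : A) : star δ x ⟶ gen δ x := Karoubi.decompId_i (star δ x)

/-- The projection `[x] ⟶ [x]^*`. -/
noncomputable def starProj (x : A) : gen δ x ⟶ star δ x := Karoubi.decompId_p (star δ x)

theorem starIncl_starProj (x : A) : starIncl δ x ≫ starProj δ x = 𝟙 (star δ x) :=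
  (Karoubi.decompId (star δ x)).symm

theorem starProj_starIncl (x : A) :
    starProj δ x ≫ starIncl δ x = (toEnvelope δ).map (pStar δ (⊤ : Subobject x)) :=
  (Karoubi.decomp_p (star δ x)).symm

end Envelope

/-! ### Relations that surject onto both factors -/

section Relations

variable {A : Type u} [Category.{v} A] [CartesianMonoidalCategory A]

/-- `R(x, y)`: the subobjects `r` of `x × y` such that both projections `r ⟶ x` and `r ⟶ y` are
surjective. -/
def R (x y : A) : Type (max u v) :=
  {r : Subobject (x ⊗ y) // IsSurj (r.arrow ≫ fst x y) ∧ IsSurj (r.arrow ≫ snd x y)}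

namespace R

instance [SubobjectFinite A] (x y : A) : Finite (R x y) := Subtype.finite

noncomputable instance [SubobjectFinite A] (x y : A) : Fintype (R x y) := Fintype.ofFinite _

variable {x y : A} (r : R x y)

/-- The object underlying the relation `r`. -/
noncomputable def obj : A := (r.1 : A)

/-- The projection `r ⟶ x`. -/
noncomputable def left : r.obj ⟶ x := r.1.arrow ≫ fst x y

/-- The projection `r ⟶ y`. -/
noncomputable def right : r.obj ⟶ y := r.1.arrow ≫ snd x y

instance : IsSurj r.left := r.2.1

instance : IsSurj r.right := r.2.2

theorem lift_left_right : lift r.left r.right = r.1.arrow := by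
  ext <;> simp [left, right]

instance : Mono (lift r.left r.right) :=
  (lift_left_right r).symm ▸ (inferInstance : Mono r.1.arrow)

variable [IsRegular A]

/-- The relation given by two surjective morphisms `a : t ⟶ x` and `b : t ⟶ y`, i.e. the image of
`t` in `x × y`.  If `t ⟶ x × y` is injective this is `t` itself. -/
noncomputable def ofSpan {t x y : A} (a : t ⟶ x) (b : t ⟶ y) [ha : IsSurj a] [hb : IsSurj b] :
    R x y :=
  ⟨im (lift a b), IsSurj.of_comp (toIm (lift a b)) _ (by simpa using ha),
    IsSurj.of_comp (toIm (lift a b)) _ (by simpa using hb)⟩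

/-- The surjective morphism from `t` to its image in `x × y`. -/
noncomputable def toSpan {t x y : A} (a : t ⟶ x) (b : t ⟶ y) [IsSurj a] [IsSurj b] :
    t ⟶ (ofSpan a b).obj :=
  toIm (lift a b)

instance {t x y : A} (a : t ⟶ x) (b : t ⟶ y) [IsSurj a] [IsSurj b] : IsSurj (toSpan a b) :=
  isSurj_toIm _

theorem toSpan_left {t x y : A} (a : t ⟶ x) (b : t ⟶ y) [IsSurj a] [IsSurj b] :
    toSpan a b ≫ (ofSpan a b).left = a := by
  change toIm (lift a b) ≫ (im (lift a b)).arrow ≫ fst x y = a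
  simp

theorem toSpan_right {t x y : A} (a : t ⟶ x) (b : t ⟶ y) [IsSurj a] [IsSurj b] :
    toSpan a b ≫ (ofSpan a b).right = b := by
  change toIm (lift a b) ≫ (im (lift a b)).arrow ≫ snd x y = b
  simp

theorem ofSpan_left_right : ofSpan r.left r.right = r := by
  apply Subtype.ext
  change im (lift r.left r.right) = r.1
  rw [lift_left_right]
  exact (im_eq (𝟙 _) inferInstance r.1.arrow (Category.id_comp _)).trans (Subobject.mk_arrow _)

end R

instance mono_lift_of_mono_left {t x y : A} (a : t ⟶ x) (b : t ⟶ y) [Mono a] :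
    Mono (lift a b) :=
  mono_of_mono_fac (lift_fst a b)

instance mono_lift_of_mono_right {t x y : A} (a : t ⟶ x) (b : t ⟶ y) [Mono b] :
    Mono (lift a b) :=
  mono_of_mono_fac (lift_snd a b)

instance mono_toUnit (u : Subobject (𝟙_ A)) : Mono (toUnit (u : A)) :=
  toUnit_unique u.arrow (toUnit (u : A)) ▸ (inferInstance : Mono u.arrow)

open scoped Classical in
/-- `ω_e = ∑ μ(u, x) δ(u ⟶ y)`, where `u` runs through the subobjects of `x` which map surjectively
onto `y`. -/
noncomputable def omega [SubobjectFinite A] {K : Type w} [CommRing K] (δ : DegreeFunction A K)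
    {x y : A} (e : x ⟶ y) : K :=
  ∑ u : Subobject x,
    if _h : IsSurj (u.arrow ≫ e) then (mu u ⊤ : K) * δ.deg (u.arrow ≫ e) else 0

end Relations

/-! ### Objects, morphisms and tensor decompositions indexed by `A` -/

section Data

variable (A : Type u) [Category.{v} A] [CartesianMonoidalCategory A]
  (D : Type u₁) [Category.{v₁} D] [MonoidalCategory D]

/-- A family of objects `x^*` of a monoidal category `D` indexed by the objects of `A`, together
with morphisms `x^* ⟶ y^*` indexed by `R(x, y)`, and with morphisms which compare `x^* ⊗ y^*` with
the objects `t^*`, where `t ⟶ x × y` is a relation in `R(x, y)`, and the unit object with the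
objects `u^*`, where `u` is a subobject of the terminal object. -/
structure SubobjectData where
  /-- the object `x^*` -/
  obj : A → D
  /-- the morphism attached to a relation -/
  mor : ∀ {x y : A}, R x y → (obj x ⟶ obj y)
  /-- the inclusion `t^* ⟶ x^* ⊗ y^*` -/
  incl : ∀ {t x y : A} (a : t ⟶ x) (b : t ⟶ y) [IsSurj a] [IsSurj b] [Mono (lift a b)],
    obj t ⟶ obj x ⊗ obj y
  /-- the projection `x^* ⊗ y^* ⟶ t^*` -/
  proj : ∀ {t x y : A} (a : t ⟶ x) (b : t ⟶ y) [IsSurj a] [IsSurj b] [Mono (lift a b)],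
    obj x ⊗ obj y ⟶ obj t
  /-- the inclusion `u^* ⟶ 𝟙` -/
  unitIncl : ∀ (u : A) [Mono (toUnit u)], obj u ⟶ 𝟙_ D
  /-- the projection `𝟙 ⟶ u^*` -/
  unitProj : ∀ (u : A) [Mono (toUnit u)], 𝟙_ D ⟶ obj u

end Data

namespace SubobjectData

variable {A : Type u} [Category.{v} A] [CartesianMonoidalCategory A] [IsRegular A]

section

variable {D : Type u₁} [Category.{v₁} D] [MonoidalCategory D] (M : SubobjectData A D)

/-- The morphism `x^* ⟶ y^*` given by the graph of an isomorphism `f : x ≅ y`. -/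
noncomputable def isoMor {x y : A} (f : x ≅ y) : M.obj x ⟶ M.obj y := M.mor (R.ofSpan (𝟙 x) f.hom)

open scoped Classical in
/-- The morphism `x^* ⟶ y^*` given by a pair of morphisms `t ⟶ x` and `t ⟶ y`, with the convention
that it is zero if these are not both surjective. -/
noncomputable def extMor [HasZeroMorphisms D] {t x y : A} (a : t ⟶ x) (b : t ⟶ y) :
    M.obj x ⟶ M.obj y :=
  if h : IsSurj a ∧ IsSurj b then
    have := h.1
    have := h.2
    M.mor (R.ofSpan a b)
  else 0

end

variable [SubobjectFinite A] {K : Type w} [CommRing K]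

section

variable {D : Type u₁} [Category.{v₁} D] [Preadditive D] [Linear K D] [HasFiniteBiproducts D]
  [MonoidalCategory D] [SymmetricCategory D]

variable (K) in
/-- The properties which do not depend on the choice between the two kinds of bases. -/
structure IsSystem (M : SubobjectData A D) : Prop where
  /-- the objects `x^*` generate `D` as a pseudo-abelian category -/
  generate : ∀ X : D, ∃ (n : ℕ) (x : Fin n → A), Nonempty (Retract X (⨁ fun i => M.obj (x i)))
  /-- the morphisms attached to the elements of `R(x, y)` form a basis -/
  basis : ∀ x y : A, ∃ b : Module.Basis (R x y) K (M.obj x ⟶ M.obj y), ∀ r, b r = M.mor r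
  /-- the objects `x^*` are natural with respect to isomorphisms -/
  isoMor_refl : ∀ x : A, M.isoMor (Iso.refl x) = 𝟙 (M.obj x)
  isoMor_trans : ∀ {x y z : A} (f : x ≅ y) (g : y ≅ z),
    M.isoMor (f ≪≫ g) = M.isoMor f ≫ M.isoMor g
  /-- the bases are natural with respect to isomorphisms -/
  mor_natural : ∀ {x y x' y' : A} (f : x ≅ x') (g : y ≅ y') (r : R x y),
    M.isoMor f ≫ M.mor (R.ofSpan (r.left ≫ f.hom) (r.right ≫ g.hom)) = M.mor r ≫ M.isoMor g
  /-- `x^* ⊗ y^*` is the direct sum of the `r^*` with `r ∈ R(x, y)` -/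
  incl_proj : ∀ {x y : A} (r : R x y),
    M.incl r.left r.right ≫ M.proj r.left r.right = 𝟙 (M.obj r.obj)
  incl_proj_of_ne : ∀ {x y : A} (r s : R x y), r ≠ s →
    M.incl r.left r.right ≫ M.proj s.left s.right = 0
  sum_proj_incl : ∀ x y : A,
    ∑ r : R x y, M.proj r.left r.right ≫ M.incl r.left r.right = 𝟙 (M.obj x ⊗ M.obj y)
  /-- the inclusion and the projection depend on a relation only up to isomorphism -/
  incl_source : ∀ {t t' x y : A} (e : t ≅ t') (a : t' ⟶ x) (b : t' ⟶ y) [IsSurj a] [IsSurj b]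
    [Mono (lift a b)] [Mono (lift (e.hom ≫ a) (e.hom ≫ b))],
    M.incl (e.hom ≫ a) (e.hom ≫ b) = M.isoMor e ≫ M.incl a b
  proj_source : ∀ {t t' x y : A} (e : t ≅ t') (a : t' ⟶ x) (b : t' ⟶ y) [IsSurj a] [IsSurj b]
    [Mono (lift a b)] [Mono (lift (e.hom ≫ a) (e.hom ≫ b))],
    M.proj (e.hom ≫ a) (e.hom ≫ b) ≫ M.isoMor e = M.proj a b
  /-- the decomposition of `x^* ⊗ y^*` is natural with respect to isomorphisms of `x` and `y` -/
  incl_natural : ∀ {t x y x' y' : A} (a : t ⟶ x) (b : t ⟶ y) [IsSurj a] [IsSurj b]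
    [Mono (lift a b)] (f : x ≅ x') (g : y ≅ y') [Mono (lift (a ≫ f.hom) (b ≫ g.hom))],
    M.incl (a ≫ f.hom) (b ≫ g.hom) = M.incl a b ≫ (M.isoMor f ⊗ₘ M.isoMor g)
  proj_natural : ∀ {t x y x' y' : A} (a : t ⟶ x) (b : t ⟶ y) [IsSurj a] [IsSurj b]
    [Mono (lift a b)] (f : x ≅ x') (g : y ≅ y') [Mono (lift (a ≫ f.hom) (b ≫ g.hom))],
    (M.isoMor f ⊗ₘ M.isoMor g) ≫ M.proj (a ≫ f.hom) (b ≫ g.hom) = M.proj a b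
  /-- the unit object is the direct sum of the `u^*` with `u` a subobject of the terminal object,
  and this decomposition is natural with respect to isomorphisms -/
  unitIncl_unitProj : ∀ u : Subobject (𝟙_ A),
    M.unitIncl (u : A) ≫ M.unitProj (u : A) = 𝟙 (M.obj (u : A))
  unitIncl_unitProj_of_ne : ∀ u v : Subobject (𝟙_ A), u ≠ v →
    M.unitIncl (u : A) ≫ M.unitProj (v : A) = 0
  sum_unitProj_unitIncl :
    ∑ u : Subobject (𝟙_ A), M.unitProj (u : A) ≫ M.unitIncl (u : A) = 𝟙 (𝟙_ D)
  unitIncl_source : ∀ {u u' : A} (e : u ≅ u') [Mono (toUnit u)] [Mono (toUnit u')],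
    M.unitIncl u = M.isoMor e ≫ M.unitIncl u'
  unitProj_source : ∀ {u u' : A} (e : u ≅ u') [Mono (toUnit u)] [Mono (toUnit u')],
    M.unitProj u ≫ M.isoMor e = M.unitProj u'
  /-- the associativity constraint is induced by that of the direct product: if `w` is a subobject
  of `x × y × z` with image `r` in `x × y` and image `s` in `y × z`, then it identifies the summands
  `w^* ⊆ r^* ⊗ z^* ⊆ (x^* ⊗ y^*) ⊗ z^*` and `w^* ⊆ x^* ⊗ s^* ⊆ x^* ⊗ (y^* ⊗ z^*)` -/
  associator : ∀ {w r s x y z : A} (p : w ⟶ r) (q : w ⟶ s) (a : r ⟶ x) (b : r ⟶ y) (c : s ⟶ y)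
    (d : s ⟶ z) [IsSurj p] [IsSurj q] [IsSurj a] [IsSurj b] [IsSurj c] [IsSurj d]
    [Mono (lift a b)] [Mono (lift c d)] [Mono (lift p (q ≫ d))] [Mono (lift (p ≫ a) q)],
    p ≫ b = q ≫ c →
    M.incl p (q ≫ d) ≫ (M.incl a b ▷ M.obj z) ≫ (α_ (M.obj x) (M.obj y) (M.obj z)).hom =
      M.incl (p ≫ a) q ≫ (M.obj x ◁ M.incl c d)
  /-- the symmetry constraint is induced by that of the direct product -/
  braiding : ∀ {t x y : A} (a : t ⟶ x) (b : t ⟶ y) [IsSurj a] [IsSurj b] [Mono (lift a b)]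
    [Mono (lift b a)], M.incl a b ≫ (β_ (M.obj x) (M.obj y)).hom = M.incl b a
  /-- the unital constraints are induced by those of the direct product: if `u` is the image of `x`
  in the terminal object, then they identify the summand `x^*` of `u^* ⊗ x^* ⊆ 𝟙 ⊗ x^*` or
  `x^* ⊗ u^* ⊆ x^* ⊗ 𝟙` with `x^*` -/
  leftUnitor : ∀ {u x : A} (e : x ⟶ u) [IsSurj e] [Mono (toUnit u)],
    M.incl e (𝟙 x) ≫ (M.unitIncl u ▷ M.obj x) ≫ (λ_ (M.obj x)).hom = 𝟙 (M.obj x)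
  rightUnitor : ∀ {u x : A} (e : x ⟶ u) [IsSurj e] [Mono (toUnit u)],
    M.incl (𝟙 x) e ≫ (M.obj x ◁ M.unitIncl u) ≫ (ρ_ (M.obj x)).hom = 𝟙 (M.obj x)

end

section

variable {D : Type u₁} [Category.{v₁} D] [Preadditive D] [Linear K D] [MonoidalCategory D]

open scoped Classical in
/-- The formulas for the `(r)`-basis. -/
structure RoundLaws (δ : DegreeFunction A K) (M : SubobjectData A D) : Prop where
  /-- `(s)(r) = ∑ ω_{u ⟶ ū} (ū)`, where `u` runs through the elements of `R(r, s)` which are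
  contained in `r ×_y s`, and where `ū` is the image of `u` in `x × z` -/
  comp : ∀ {x y z : A} (r : R x y) (s : R y z),
    M.mor r ≫ M.mor s = ∑ u : R r.obj s.obj with u.left ≫ r.right = u.right ≫ s.left,
      omega δ (R.toSpan (u.left ≫ r.left) (u.right ≫ s.right)) •
        M.mor (R.ofSpan (u.left ≫ r.left) (u.right ≫ s.right))
  /-- `(r) ⊗ (r') = ∑ τ_w`, where `w` runs through `R(r, r')` and where `τ_w` is the composition
  `x^* ⊗ x'^* ⟶ r_w^* ⟶ r'_w^* ⟶ y^* ⊗ y'^*`; here `r_w` and `r'_w` are the images of `w` in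
  `x × x'` and `y × y'`, respectively -/
  tensor : ∀ {x y x' y' : A} (r : R x y) (r' : R x' y'),
    M.mor r ⊗ₘ M.mor r' = ∑ w : R r.obj r'.obj,
      M.proj (R.ofSpan (w.left ≫ r.left) (w.right ≫ r'.left)).left
          (R.ofSpan (w.left ≫ r.left) (w.right ≫ r'.left)).right ≫
        M.mor (R.ofSpan (R.toSpan (w.left ≫ r.left) (w.right ≫ r'.left))
          (R.toSpan (w.left ≫ r.right) (w.right ≫ r'.right))) ≫
        M.incl (R.ofSpan (w.left ≫ r.right) (w.right ≫ r'.right)).left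
          (R.ofSpan (w.left ≫ r.right) (w.right ≫ r'.right)).right

section Triple

variable {x y z : A} (r : R x y) (s : R y z) (y' : Subobject y)

/-- `r ×_{y'} s = r ×_y y' ×_y s` -/
noncomputable abbrev triple : A :=
  pullback (pullback.snd r.right y'.arrow) (pullback.fst y'.arrow s.left)

/-- The morphism `r ×_{y'} s ⟶ r ×_y y' ⟶ x`. -/
noncomputable def tripleLeft : triple r s y' ⟶ x :=
  pullback.fst (pullback.snd r.right y'.arrow) (pullback.fst y'.arrow s.left) ≫
    pullback.fst r.right y'.arrow ≫ r.left

/-- The morphism `r ×_{y'} s ⟶ y' ×_y s ⟶ z`. -/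
noncomputable def tripleRight : triple r s y' ⟶ z :=
  pullback.snd (pullback.snd r.right y'.arrow) (pullback.fst y'.arrow s.left) ≫
    pullback.snd y'.arrow s.left ≫ s.right

instance [IsSurj (pullback.fst r.right y'.arrow ≫ r.left)] : IsSurj (tripleLeft r s y') := by
  unfold tripleLeft
  infer_instance

instance [IsSurj (pullback.snd y'.arrow s.left ≫ s.right)] : IsSurj (tripleRight r s y') := by
  unfold tripleRight
  infer_instance

end Triple

open scoped Classical in
/-- The formulas for the `{r}`-basis. -/
structure CurlyLaws (δ : DegreeFunction A K) (M : SubobjectData A D) : Prop where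
  /-- `{s}{r} = ∑ μ(y', y) δ(r ×_{y'} s ⟶ r ∘_{y'} s) {r ∘_{y'} s}`, where `y'` runs through the
  subobjects of `y` such that `r ×_y y' ⟶ x` and `y' ×_y s ⟶ z` are surjective, and where
  `r ∘_{y'} s` is the image of `r ×_{y'} s` in `x × z` -/
  comp : ∀ {x y z : A} (r : R x y) (s : R y z),
    M.mor r ≫ M.mor s = ∑ y' : Subobject y,
      if h : IsSurj (pullback.fst r.right y'.arrow ≫ r.left) ∧
          IsSurj (pullback.snd y'.arrow s.left ≫ s.right) then
        have := h.1
        have := h.2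
        ((mu y' ⊤ : K) * δ.deg (R.toSpan (tripleLeft r s y') (tripleRight r s y'))) •
          M.mor (R.ofSpan (tripleLeft r s y') (tripleRight r s y'))
      else 0
  /-- `{r} ⊗ {r'} = ∑ σ_{u,v}`, where `u` and `v` run through `R(x, x')` and `R(y, y')`, and where
  `σ_{u,v}` is the composition `x^* ⊗ x'^* ⟶ u^* ⟶ v^* ⟶ y^* ⊗ y'^*` whose middle arrow is attached
  to `w_{u,v} = u ×_{x × x'} (r × r') ×_{y × y'} v` if this pullback exists and is in `R(u, v)`, and
  is zero otherwise -/
  tensor : ∀ {x y x' y' : A} (r : R x y) (r' : R x' y'),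
    M.mor r ⊗ₘ M.mor r' = ∑ u : R x x', ∑ v : R y y',
      if _h : HasPullback u.1.arrow (r.left ⊗ₘ r'.left) then
        if _h' : HasPullback (pullback.snd u.1.arrow (r.left ⊗ₘ r'.left) ≫ (r.right ⊗ₘ r'.right))
            v.1.arrow then
          M.proj u.left u.right ≫
            M.extMor (t := pullback (pullback.snd u.1.arrow (r.left ⊗ₘ r'.left) ≫
                (r.right ⊗ₘ r'.right)) v.1.arrow) (x := u.obj) (y := v.obj)
              (pullback.fst _ _ ≫ pullback.fst _ _) (pullback.snd _ _) ≫
            M.incl v.left v.right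
        else 0
      else 0

end

section

variable {D : Type u₁} [Category.{v₁} D] [Preadditive D] [Linear K D] [MonoidalCategory D]
  [SymmetricCategory D]
  {D' : Type u₂} [Category.{v₂} D'] [Preadditive D'] [Linear K D'] [MonoidalCategory D']
  [SymmetricCategory D']

variable (K) in
/-- There is a `K`-linear equivalence of symmetric monoidal categories which is compatible with
the given data (it is then automatically compatible with the projections `proj` and `unitProj`). -/
def Equivalent (M : SubobjectData A D) (N : SubobjectData A D') : Prop :=
  ∃ (F : D ⥤ D') (_ : F.Braided), F.IsEquivalence ∧ F.Additive ∧ F.Linear K ∧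
    ∃ φ : ∀ x : A, F.obj (M.obj x) ≅ N.obj x,
      (∀ {x y : A} (r : R x y), F.map (M.mor r) ≫ (φ y).hom = (φ x).hom ≫ N.mor r) ∧
      (∀ {t x y : A} (a : t ⟶ x) (b : t ⟶ y) [IsSurj a] [IsSurj b] [Mono (lift a b)],
        F.map (M.incl a b) = (φ t).hom ≫ N.incl a b ≫ ((φ x).inv ⊗ₘ (φ y).inv) ≫
          Functor.LaxMonoidal.μ F (M.obj x) (M.obj y)) ∧
      (∀ (u : A) [Mono (toUnit u)],
        F.map (M.unitIncl u) = (φ u).hom ≫ N.unitIncl u ≫ Functor.LaxMonoidal.ε F)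

end

end SubobjectData

/-! ### The data of `T(A, δ)` -/

section EnvelopeData

variable {A : Type u} [Category.{v} A] [CartesianMonoidalCategory A] [IsRegular A]
  [SubobjectFinite A] {K : Type w} [CommRing K] (δ : DegreeFunction A K)

/-- The morphism `(r) = p_y^* [b] p_r^* [a]^∨ p_x^*` from `[x]^*` to `[y]^*`, where `a : r ⟶ x` and
`b : r ⟶ y` are the projections. -/
noncomputable def round {x y : A} (r : R x y) : star δ x ⟶ star δ y :=
  starIncl δ x ≫ (toEnvelope δ).map (TZero.cograph δ r.left) ≫ (starProj δ r.obj ≫ starIncl δ r.obj) ≫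
    (toEnvelope δ).map (TZero.graph δ r.right) ≫ starProj δ y

/-- The morphism `{r} = p_y^* ⟨r⟩ p_x^*` from `[x]^*` to `[y]^*`. -/
noncomputable def curly {x y : A} (r : R x y) : star δ x ⟶ star δ y :=
  starIncl δ x ≫ (toEnvelope δ).map (TZero.rel δ r.1) ≫ starProj δ y

/-- The objects `[x]^*` with the given morphisms attached to relations.  The inclusion
`[t]^* ⟶ [x]^* ⊗ [y]^*` is the restriction of `[t] ⟶ [x × y] = [x] ⊗ [y]`. -/
noncomputable def envelopeData
    (mor : ∀ {x y : A}, R x y → (star δ x ⟶ star δ y)) : SubobjectData A (Envelope δ) where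
  obj := star δ
  mor := mor
  incl {t x y} a b _ _ _ := starIncl δ t ≫ (toEnvelope δ).map (TZero.graph δ (lift a b)) ≫
    (genTensor δ x y).inv ≫ (starProj δ x ⊗ₘ starProj δ y)
  proj {t x y} a b _ _ _ := (starIncl δ x ⊗ₘ starIncl δ y) ≫ (genTensor δ x y).hom ≫
    (toEnvelope δ).map (TZero.cograph δ (lift a b)) ≫ starProj δ t
  unitIncl u _ := starIncl δ u ≫ (toEnvelope δ).map (TZero.graph δ (toUnit u)) ≫ (genUnit δ).hom
  unitProj u _ := (genUnit δ).inv ≫ (toEnvelope δ).map (TZero.cograph δ (toUnit u)) ≫ starProj δ u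

/-- The objects `[x]^*` with the morphisms `(r)`. -/
noncomputable def roundData : SubobjectData A (Envelope δ) := envelopeData δ (round δ)

/-- The objects `[x]^*` with the morphisms `{r}`. -/
noncomputable def curlyData : SubobjectData A (Envelope δ) := envelopeData δ (curly δ)

end EnvelopeData

end TensorEnvelope

namespace TensorEnvelope

/-! ### Calculus of graphs and transposed graphs -/

namespace TZero

variable {A : Type u} [Category.{v} A] [CartesianMonoidalCategory A] [IsRegular A]
  {K : Type w} [CommRing K] (δ : DegreeFunction A K)

/-! Every morphism of `T⁰` is a combination of spans [b][a]^∨, and spans compose by pullback. Two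
rules govern the calculus. Base change: [c]^∨[b] = [g][f]^∨ for a pullback square, and zero if the
cospan admits no commutative square (`graph_comp_cograph`, `graph_comp_cograph_eq_zero`). Degree:
[e][e]^∨ = δ(e) for surjective e (`cograph_comp_graph_self`). The idempotents p_u commute and
multiply like intersections, so Möbius inversion turns them into orthogonal idempotents p_u^* with
sum 1.

The engine is a vanishing statement (`pTop_graph_cograph` and its transpose `graph_cograph_pTop`):
if m is a monomorphism and f : t → z does not factor through m, then [m]^∨[f]p_t^* = 0. Indeed, by
base change the product passes through the pullback of m to t, which is a proper subobject or does
not exist, and p_t^* annihilates p_u for proper u. Since p_x^* is the identity plus a combination of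
p_u with u proper, it follows that p_x^*[e]p_t^* = [e]p_t^* if e : t → x is surjective, whereas
p_x^*[a] = 0 if a is not surjective. This has three consequences. The summand p_u^*[x] is a copy of
[u]^*, which decomposes [x] (`pStar_eq`, `sum_pTop`). Applied to [x × y], the idempotent p_x^* ⊗
p_y^* removes exactly the summands of subobjects outside R(x, y), which decomposes [x]^* ⊗ [y]^*
(`pTop_tensor_pTop`). Finally [e]p_t^*[e]^∨ = ω_e p_x^* (`cograph_pTop_graph_self`).

The {r} span because relations with a non-surjective projection restrict to zero. They are
independent because multiplying by p_x^* and p_y^* does not change the coefficients at elements of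
R(x, y) (`coeff_pTop_comp_pTop`). The (r) form a basis because {r} is the sum of the (u) with u ≤ r.
The formulas for composition and tensor product arise by expanding the middle idempotent, or by
inserting the decompositions of tensor products, and applying the rules above. For the constraints,
[x]^* ⊗ [y]^* is embedded into [x × y]; all maps become graphs, and the assertions become identities
between morphisms of `A`.

Uniqueness: the composition law determines the full subcategory on the generators, so two systems
are related by a linear isomorphism `Comparison` of these subcategories, which by the tensor law
respects the components of tensor products. An arbitrary object is a retract of a finite sum of
generators; a `Matching` presents objects of both categories by the same idempotent matrix of
morphisms between generators. Morphisms are transported component by component, and the tensor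
product of two matchings is again a matching. Hence every coherence condition for the resulting
functor is checked on components, where both systems obey the same formulas. -/

theorem cograph_id (x : A) : cograph δ (𝟙 x) = 𝟙 _ := rfl

theorem cograph_comp_graph {t x y : A} (a : t ⟶ x) (b : t ⟶ y) :
    cograph δ a ≫ graph δ b = spanHom δ a b := by
  rw [graph_eq, cograph_comp_spanHom, Category.id_comp]

theorem cograph_comp {x y z : A} (f : x ⟶ y) (g : y ⟶ z) :
    cograph δ (f ≫ g) = cograph δ g ≫ cograph δ f := by
  rw [cograph_eq f, cograph_comp_spanHom, cograph_eq]

/-- Base change. Together with the vanishing when there is no commutative square, this moves every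
transposed graph to the front of a composition. -/
theorem graph_comp_cograph {p t s y : A} {b : t ⟶ y} {c : s ⟶ y} {f : p ⟶ t} {g : p ⟶ s}
    (h : IsPullback f g b c) : graph δ b ≫ cograph δ c = cograph δ f ≫ graph δ g := by
  rw [graph_eq, cograph_eq, spanHom_comp h, cograph_comp_graph, Category.comp_id,
    Category.comp_id]

theorem graph_comp_cograph_eq_zero {t s y : A} (b : t ⟶ y) (c : s ⟶ y)
    (h : ∀ {p : A} (f : p ⟶ t) (g : p ⟶ s), f ≫ b ≠ g ≫ c) :
    graph δ b ≫ cograph δ c = 0 := by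
  rw [graph_eq, cograph_eq]
  exact comp_span_zero δ _ _ _ _ h

/-- Base change along the kernel pair of a monomorphism, which is trivial. -/
theorem graph_comp_cograph_self {x y : A} (i : x ⟶ y) [Mono i] :
    graph δ i ≫ cograph δ i = 𝟙 _ := by
  rw [graph_comp_cograph δ (IsKernelPair.id_of_mono i), graph_id, cograph_id, Category.comp_id]

theorem graph_comp_cograph_self_assoc {x y : A} (i : x ⟶ y) [Mono i]
    {Z : TZero δ} (h : (⟨x⟩ : TZero δ) ⟶ Z) :
    graph δ i ≫ cograph δ i ≫ h = h :=
  (reassoc_of% (graph_comp_cograph_self δ i)) h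

theorem spanHom_surj {t t' x y : A} (e : t ⟶ t') [IsSurj e] (a : t' ⟶ x) (b : t' ⟶ y) :
    spanHom δ (e ≫ a) (e ≫ b) = δ.deg e • spanHom δ a b :=
  span_comp_surj δ e a b

/-- The span (e, e) maps onto the diagonal of y by e itself. This is how degrees enter the calculus.
-/
theorem cograph_comp_graph_self {x y : A} (e : x ⟶ y) [IsSurj e] :
    cograph δ e ≫ graph δ e = δ.deg e • 𝟙 _ := by
  have := spanHom_surj δ e (𝟙 y) (𝟙 y)
  rw [Category.comp_id] at this
  rw [cograph_comp_graph, this, ← graph_eq, graph_id]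

theorem spanHom_eq {t x y : A} (a : t ⟶ x) (b : t ⟶ y) :
    spanHom δ a b = δ.deg (toIm (lift a b)) • rel δ (im (lift a b)) :=
  span_eq δ a b

theorem rel_eq_spanHom {x y : A} (r : Subobject (x ⊗ y)) :
    rel δ r = spanHom δ (r.arrow ≫ fst x y) (r.arrow ≫ snd x y) :=
  single_eq_span δ r

theorem rel_eq {x y : A} (r : Subobject (x ⊗ y)) :
    rel δ r = cograph δ (r.arrow ≫ fst x y) ≫ graph δ (r.arrow ≫ snd x y) := by
  rw [rel_eq_spanHom, cograph_comp_graph]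

theorem spanHom_of_mono {t x y : A} (a : t ⟶ x) (b : t ⟶ y) [Mono (lift a b)] :
    spanHom δ a b = rel δ (Subobject.mk (lift a b)) :=
  span_of_mono δ a b

theorem hom_eq_sum {x y : A} (g : (⟨x⟩ : TZero δ) ⟶ ⟨y⟩) [Fintype (Subobject (x ⊗ y))] :
    ∃ c : Subobject (x ⊗ y) → K, g = ∑ r, c r • rel δ r := by
  let g' : Subobject (x ⊗ y) →₀ K := g
  refine ⟨g', ?_⟩
  have h : g' = ∑ r, g' r • (Finsupp.single r 1 : Subobject (x ⊗ y) →₀ K) := by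
    conv_lhs => rw [← Finsupp.sum_single g']
    rw [Finsupp.sum_fintype _ _ (by simp)]
    simp
  exact h

end TZero

/-! ### The idempotents p_v^* and the vanishing lemmas -/

section Star

open TZero

variable {A : Type u} [Category.{v} A] [CartesianMonoidalCategory A] [IsRegular A]
  {K : Type w} [CommRing K] (δ : DegreeFunction A K)

/-- Both products are given by the intersection of u and v, or are zero if there is none; this
description is symmetric in u and v. -/
theorem pSub_comm {x : A} (u v : Subobject x) : pSub δ u ≫ pSub δ v = pSub δ v ≫ pSub δ u := by
  obtain ⟨t, ht, h⟩ | ⟨h, h0⟩ := pSub_comp δ u v <;>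
    obtain ⟨t', ht', h'⟩ | ⟨h', h0'⟩ := pSub_comp δ v u
  · rw [h, h', le_antisymm ((ht' t).2 ((ht t).1 le_rfl).symm) ((ht t').2 ((ht' t').1 le_rfl).symm)]
  · exact (h' t ((ht t).1 le_rfl).symm).elim
  · exact (h t' ((ht' t').1 le_rfl).symm).elim
  · rw [h0, h0']

theorem pSub_top (x : A) : pSub δ (⊤ : Subobject x) = 𝟙 _ := by
  rw [pSub_eq, ← graph_id (δ := δ), graph_eq]
  have := spanHom_comp_iso (δ := δ) (⊤ : Subobject x).arrow (𝟙 x) (𝟙 x)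
  rwa [Category.comp_id] at this

theorem pSub_mk {t x : A} (i : t ⟶ x) [Mono i] :
    pSub δ (Subobject.mk i) = cograph δ i ≫ graph δ i := by
  rw [pSub_eq, cograph_comp_graph, ← spanHom_comp_iso (Subobject.underlyingIso i).hom i i]
  simp

variable [SubobjectFinite A]

theorem pStar_comp_pSub {x : A} (w v : Subobject x) :
    pStar δ v ≫ pSub δ w = pSub δ w ≫ pStar δ v := by
  simp only [pStar, Preadditive.sum_comp, Preadditive.comp_sum, Preadditive.zsmul_comp,
    Preadditive.comp_zsmul, pSub_comm δ w]

/-- The idempotent `p_x^*` of `[x]`. -/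
noncomputable abbrev pTop (x : A) : (⟨x⟩ : TZero δ) ⟶ ⟨x⟩ := pStar δ (⊤ : Subobject x)

theorem pTop_idem (x : A) : pTop δ x ≫ pTop δ x = pTop δ x := pStar_idem δ _

theorem pTop_idem_assoc (x : A)
    {Z : TZero δ} (h : (⟨x⟩ : TZero δ) ⟶ Z) :
    pTop δ x ≫ pTop δ x ≫ h = pTop δ x ≫ h :=
  (reassoc_of% (pTop_idem δ x)) h

theorem mu_self {x : A} (u : Subobject x) : mu u u = 1 := by
  classical
  exact IncidenceAlgebra.mu_self u

open scoped Classical in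
theorem pTop_eq_sum (x : A) :
    pTop δ x = ∑ u : Subobject x, mu u ⊤ • pSub δ u := by
  rw [pTop, pStar]
  exact Finset.sum_congr (by simp) fun _ _ => rfl

open scoped Classical in
-- The identity is split off so that, in later expansions of p_x^*, it only remains to see that
-- proper subobjects contribute nothing.
theorem pTop_eq (x : A) :
    pTop δ x = 𝟙 _ + ∑ u : Subobject x with u ≠ ⊤, mu u ⊤ • pSub δ u := by
  rw [pTop_eq_sum, ← Finset.add_sum_erase _ _ (Finset.mem_univ (⊤ : Subobject x)), mu_self,
    pSub_top, one_smul]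
  congr 1
  exact Finset.sum_congr (by ext; simp) fun _ _ => rfl

/-- The part `[m] [f]^∨` vanishes on `[t]^*` if `f : t ⟶ z` does not factor through `m`. -/
theorem graph_cograph_pTop {s t z : A} (m : s ⟶ z) [Mono m] (f : t ⟶ z)
    (h : ∀ k : t ⟶ s, k ≫ m ≠ f) : graph δ m ≫ cograph δ f ≫ pTop δ t = 0 := by
  by_cases hP : ∃ (p : A) (k : p ⟶ s) (l : p ⟶ t), k ≫ m = l ≫ f
  · obtain ⟨p, k, l, hkl⟩ := hP
    have := IsRegular.hasPullback_of_comm k l m f hkl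
    have H := IsPullback.of_hasPullback m f
    -- If the pullback of m were all of t, inverting its projection would factor f through m.
    have h1 : ¬ (⊤ : Subobject t) ≤ Subobject.mk (pullback.snd m f) := by
      intro h1
      have : IsIso (pullback.snd m f) := by
        rw [Subobject.isIso_iff_mk_eq_top]
        exact top_le_iff.1 h1
      exact h (inv (pullback.snd m f) ≫ pullback.fst m f) (by simp [H.w])
    have h2 := pSub_comp_pStar δ (Subobject.mk (pullback.snd m f)) ⊤
    rw [if_neg h1, pSub_mk, Category.assoc] at h2
    -- The monomorphism `pullback.snd m f` is split by its transposed graph. This creates the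
    -- idempotent of a proper subobject in front of p_t^*, which annihilates it.
    rw [← Category.assoc, graph_comp_cograph δ H, Category.assoc,
      ← Category.id_comp (graph δ (pullback.snd m f) ≫ _),
      ← graph_comp_cograph_self δ (pullback.snd m f), Category.assoc, h2, comp_zero, comp_zero]
  · rw [← Category.assoc, graph_comp_cograph_eq_zero, zero_comp]
    exact fun f g hfg => hP ⟨_, f, g, hfg⟩

/-- Transpose of `graph_cograph_pTop`: p_t^* commutes with every p_u, hence annihilates the proper
ones from both sides. -/
theorem pTop_graph_cograph {s t z : A} (m : s ⟶ z) [Mono m] (f : t ⟶ z)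
    (h : ∀ k : t ⟶ s, k ≫ m ≠ f) : pTop δ t ≫ graph δ f ≫ cograph δ m = 0 := by
  by_cases hP : ∃ (p : A) (k : p ⟶ s) (l : p ⟶ t), k ≫ m = l ≫ f
  · obtain ⟨p, k, l, hkl⟩ := hP
    have := IsRegular.hasPullback_of_comm k l m f hkl
    have H := IsPullback.of_hasPullback m f
    have h1 : ¬ (⊤ : Subobject t) ≤ Subobject.mk (pullback.snd m f) := by
      intro h1
      have : IsIso (pullback.snd m f) := by
        rw [Subobject.isIso_iff_mk_eq_top]
        exact top_le_iff.1 h1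
      exact h (inv (pullback.snd m f) ≫ pullback.fst m f) (by simp [H.w])
    have h2 := pSub_comp_pStar δ (Subobject.mk (pullback.snd m f)) ⊤
    rw [if_neg h1, ← pStar_comp_pSub, pSub_mk] at h2
    rw [graph_comp_cograph δ H.flip, ← Category.comp_id (cograph δ (pullback.snd m f)),
      ← graph_comp_cograph_self δ (pullback.snd m f)]
    simp only [Category.assoc] at h2 ⊢
    rw [reassoc_of% h2, zero_comp]
  · rw [graph_comp_cograph_eq_zero, comp_zero]
    exact fun f g hfg => hP ⟨_, g, f, hfg.symm⟩

theorem not_factor_of_ne_top {t z : A} (f : t ⟶ z) [hf : IsSurj f] {u : Subobject z} (hu : u ≠ ⊤)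
    (k : t ⟶ (u : A)) : k ≫ u.arrow ≠ f := fun h =>
  hu (hf.eq_top u ((Subobject.factors_iff _ _).2 ⟨k, h⟩))

theorem exists_ne_top_of_not_isSurj {t z : A} (f : t ⟶ z) (hf : ¬ IsSurj f) :
    im f ≠ ⊤ := fun h => hf <| by
  have : IsIso (im f).arrow := Subobject.isIso_arrow_iff_eq_top _ |>.2 h
  rw [← toIm_arrow f]
  infer_instance

theorem pTop_comp_cograph_arrow {x : A} {u : Subobject x} (hu : u ≠ ⊤) :
    pTop δ x ≫ cograph δ u.arrow = 0 := by
  have := pTop_graph_cograph δ u.arrow (𝟙 x) (not_factor_of_ne_top _ hu)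
  rwa [graph_id, Category.id_comp] at this

theorem graph_arrow_comp_pTop {x : A} {u : Subobject x} (hu : u ≠ ⊤) :
    graph δ u.arrow ≫ pTop δ x = 0 := by
  have := graph_cograph_pTop δ u.arrow (𝟙 x) (not_factor_of_ne_top _ hu)
  rwa [cograph_id, Category.id_comp] at this

/-- A non-surjective morphism factors through its image, a proper subobject, and p_x^* kills
everything that passes through one. -/
theorem pTop_comp_cograph_eq_zero {t x : A} (a : t ⟶ x) (ha : ¬ IsSurj a) :
    pTop δ x ≫ cograph δ a = 0 := by
  rw [← toIm_arrow a, cograph_comp, ← Category.assoc,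
    pTop_comp_cograph_arrow δ (exists_ne_top_of_not_isSurj a ha), zero_comp]

theorem graph_comp_pTop_eq_zero {t x : A} (a : t ⟶ x) (ha : ¬ IsSurj a) :
    graph δ a ≫ pTop δ x = 0 := by
  rw [← toIm_arrow a, graph_comp, Category.assoc,
    graph_arrow_comp_pTop δ (exists_ne_top_of_not_isSurj a ha), comp_zero]

/-- In the expansion of p_x^* only the identity survives, since a surjective morphism factors
through no proper subobject. Hence [e] carries [t]^* into [x]^*. -/
theorem pTop_graph_pTop {t x : A} (e : t ⟶ x) [IsSurj e] :
    pTop δ t ≫ graph δ e ≫ pTop δ x = pTop δ t ≫ graph δ e := by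
  classical
  rw [pTop_eq δ x, Preadditive.comp_add, Category.comp_id, Preadditive.comp_add,
    Preadditive.comp_sum, Preadditive.comp_sum, Finset.sum_eq_zero, add_zero]
  intro u hu
  have := pTop_graph_cograph δ u.arrow e (not_factor_of_ne_top e (Finset.mem_filter.1 hu).2)
  rw [Preadditive.comp_zsmul, Preadditive.comp_zsmul, pSub, reassoc_of% this, zero_comp, smul_zero]

theorem pTop_graph_pTop_assoc {t x : A} (e : t ⟶ x) [IsSurj e]
    {Z : TZero δ} (h : (⟨x⟩ : TZero δ) ⟶ Z) :
    pTop δ t ≫ graph δ e ≫ pTop δ x ≫ h = pTop δ t ≫ graph δ e ≫ h :=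
  (reassoc_of% (pTop_graph_pTop δ e)) h

/-- Transpose of `pTop_graph_pTop`: on the side of [t]^* the idempotent p_x^* is absorbed by [e]^∨.
-/
theorem pTop_cograph_pTop {t x : A} (e : t ⟶ x) [IsSurj e] :
    pTop δ x ≫ cograph δ e ≫ pTop δ t = cograph δ e ≫ pTop δ t := by
  classical
  rw [pTop_eq δ x, Preadditive.add_comp, Category.id_comp, Preadditive.sum_comp,
    Finset.sum_eq_zero, add_zero]
  intro u hu
  have := graph_cograph_pTop δ u.arrow e (not_factor_of_ne_top e (Finset.mem_filter.1 hu).2)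
  rw [Preadditive.zsmul_comp, pSub, Category.assoc, this, comp_zero, smul_zero]

theorem pTop_cograph_pTop_assoc {t x : A} (e : t ⟶ x) [IsSurj e]
    {Z : TZero δ} (h : (⟨t⟩ : TZero δ) ⟶ Z) :
    pTop δ x ≫ cograph δ e ≫ pTop δ t ≫ h = cograph δ e ≫ pTop δ t ≫ h :=
  (reassoc_of% (pTop_cograph_pTop δ e)) h

/-- Identifies the summand of [x] cut out by p_v^* with [v]^*. Let q be the right-hand side. By the
vanishing lemma p_u ≫ q = 0 unless v ≤ u, so p_u^* ≫ q = 0 for u < v. The sum of the p_u^* with u ≤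
v is p_v, which fixes q; hence p_v^* ≫ q = q. Expanding q in this product yields p_v^*. -/
theorem pStar_eq {x : A} (v : Subobject x) :
    pStar δ v = cograph δ v.arrow ≫ pTop δ (v : A) ≫ graph δ v.arrow := by
  classical
  have key : ∀ u : Subobject x, ¬ v ≤ u →
      pSub δ u ≫ cograph δ v.arrow ≫ pTop δ (v : A) ≫ graph δ v.arrow = 0 := by
    intro u hu
    have h := graph_cograph_pTop δ u.arrow v.arrow (fun k hk => hu (Subobject.le_of_comm k hk))
    rw [pSub, Category.assoc, reassoc_of% h, zero_comp, comp_zero]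
  have h₀ : ∀ u : Subobject x, u ≠ v → u ≤ v →
      pStar δ u ≫ cograph δ v.arrow ≫ pTop δ (v : A) ≫ graph δ v.arrow = 0 := by
    intro u hu huv
    rw [pStar, Preadditive.sum_comp]
    refine Finset.sum_eq_zero fun w hw => ?_
    rw [Preadditive.zsmul_comp, key, smul_zero]
    exact fun h => hu (le_antisymm huv (h.trans (Finset.mem_filter.1 hw).2))
  have h₁ : pStar δ v ≫ cograph δ v.arrow ≫ pTop δ (v : A) ≫ graph δ v.arrow =
      cograph δ v.arrow ≫ pTop δ (v : A) ≫ graph δ v.arrow := by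
    have h := congrArg (· ≫ cograph δ v.arrow ≫ pTop δ (v : A) ≫ graph δ v.arrow) (sum_pStar δ v)
    simp only [Preadditive.sum_comp] at h
    rw [Finset.sum_eq_single_of_mem v (by simp)
      (fun u hu huv => h₀ u huv (Finset.mem_filter.1 hu).2), pSub, Category.assoc,
      graph_comp_cograph_self_assoc] at h
    exact h
  -- The identity in the expansion of the inner idempotent contributes p_v^* p_v = p_v^*; a proper
  -- subobject u of v contributes a multiple of p_v^* p_w with w < v, which is zero.
  rw [← h₁, pTop_eq, Preadditive.add_comp, Category.id_comp, Preadditive.comp_add,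
    Preadditive.comp_add, ← pSub, pStar_comp_pSub, pSub_comp_pStar, if_pos le_rfl,
    Preadditive.sum_comp, Preadditive.comp_sum, Preadditive.comp_sum, Finset.sum_eq_zero, add_zero]
  intro u hu
  have h : cograph δ v.arrow ≫ pSub δ u ≫ graph δ v.arrow =
      pSub δ (Subobject.mk (u.arrow ≫ v.arrow)) := by
    rw [pSub_mk, cograph_comp, graph_comp, pSub, Category.assoc, Category.assoc]
  rw [Preadditive.zsmul_comp, Preadditive.comp_zsmul, Preadditive.comp_zsmul, h, pStar_comp_pSub,
    pSub_comp_pStar, if_neg, smul_zero]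
  intro hle
  refine (Finset.mem_filter.1 hu).2 (top_le_iff.1 ?_)
  rw [← Subobject.mk_arrow u, ← Subobject.mk_arrow (⊤ : Subobject (v : A))]
  refine Subobject.mk_le_mk_of_comm ((⊤ : Subobject (v : A)).arrow ≫ Subobject.ofLE _ _ hle ≫
    (Subobject.underlyingIso _).hom) ?_
  rw [← cancel_mono v.arrow]
  simp

/-- Möbius inversion for the full subobject, with `pStar_eq` inserted: the identity of [x] as a sum
of passages through the [u]^*. -/
theorem sum_pTop (x : A) :
    ∑ u : Subobject x, cograph δ u.arrow ≫ pTop δ (u : A) ≫ graph δ u.arrow = 𝟙 _ := by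
  classical
  rw [← pSub_top, ← sum_pStar]
  exact Finset.sum_congr (by simp) fun u _ => (pStar_eq δ u).symm

/-- At least one of u ≤ v and v ≤ u fails, so one of the inclusions does not factor through the
other, and the vanishing lemma applies on that side. -/
theorem pTop_graph_cograph_pTop_of_ne {x : A} {u v : Subobject x} (h : u ≠ v) :
    pTop δ (u : A) ≫ graph δ u.arrow ≫ cograph δ v.arrow ≫ pTop δ (v : A) = 0 := by
  by_cases h₁ : u ≤ v
  · have h₂ : ¬ v ≤ u := fun h₂ => h (le_antisymm h₁ h₂)
    rw [graph_cograph_pTop δ _ _ (fun k hk => h₂ (Subobject.le_of_comm k hk)), comp_zero]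
  · have := pTop_graph_cograph δ v.arrow u.arrow (fun k hk => h₁ (Subobject.le_of_comm k hk))
    rw [reassoc_of% this, zero_comp]

open scoped Classical in
-- As e is surjective, p_x^* may be added on both sides. After expanding p_t^*, the term of u is a
-- multiple of [u → x][u → x]^∨: this is δ(u → x) if u maps onto x, and is killed by p_x^*
-- otherwise. The sum of the coefficients is ω_e.
theorem cograph_pTop_graph_self {t x : A} (e : t ⟶ x) [IsSurj e] :
    cograph δ e ≫ pTop δ t ≫ graph δ e = omega δ e • pTop δ x := by
  have h : cograph δ e ≫ pTop δ t ≫ graph δ e =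
      pTop δ x ≫ (cograph δ e ≫ pTop δ t ≫ graph δ e) ≫ pTop δ x := by
    simp only [Category.assoc]
    rw [pTop_graph_pTop, pTop_cograph_pTop_assoc]
  rw [h, pTop_eq_sum δ t]
  simp only [Preadditive.sum_comp, Preadditive.comp_sum]
  rw [omega, Finset.sum_smul]
  refine Finset.sum_congr rfl fun u _ => ?_
  simp only [Preadditive.zsmul_comp, Preadditive.comp_zsmul]
  have h1 : cograph δ e ≫ pSub δ u ≫ graph δ e =
      cograph δ (u.arrow ≫ e) ≫ graph δ (u.arrow ≫ e) := by
    rw [pSub, cograph_comp, graph_comp, Category.assoc, Category.assoc]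
  have h2 : ∀ (n : ℤ) (f : (⟨x⟩ : TZero δ) ⟶ ⟨x⟩), n • f = (n : K) • f :=
    fun n f => (Int.cast_smul_eq_zsmul K n f).symm
  split_ifs with hs
  · rw [h1, cograph_comp_graph_self, Linear.smul_comp, Linear.comp_smul, Category.id_comp,
      pTop_idem, h2, smul_smul]
  · rw [h1, Category.assoc, graph_comp_pTop_eq_zero δ _ hs, comp_zero, comp_zero, smul_zero,
      zero_smul]

end Star

/-! ### Tensor products of the idempotents and expansion of relations -/

section StarTensor

open TZero

variable {A : Type u} [Category.{v} A] [CartesianMonoidalCategory A] [IsRegular A]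
  {K : Type w} [CommRing K] (δ : DegreeFunction A K)

namespace TZero

theorem tensorHom_cograph {x y x' y' : A} (f : x ⟶ y) (g : x' ⟶ y') :
    cograph δ f ⊗ₘ cograph δ g = cograph δ (f ⊗ₘ g) := by
  rw [cograph_eq, cograph_eq, cograph_eq, tensorHom_spanHom, id_tensorHom_id]

theorem graph_whiskerRight {x y : A} (f : x ⟶ y) (z : A) :
    graph δ f ▷ (⟨z⟩ : TZero δ) = graph δ (f ▷ z) := by
  rw [← tensorHom_id, ← graph_id, tensorHom_graph, tensorHom_id]

theorem graph_whiskerLeft {x y : A} (f : x ⟶ y) (z : A) :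
    (⟨z⟩ : TZero δ) ◁ graph δ f = graph δ (z ◁ f) := by
  rw [← id_tensorHom, ← graph_id, tensorHom_graph, id_tensorHom]

theorem cograph_whiskerRight {x y : A} (f : x ⟶ y) (z : A) :
    cograph δ f ▷ (⟨z⟩ : TZero δ) = cograph δ (f ▷ z) := by
  rw [← tensorHom_id, ← cograph_id, tensorHom_cograph, tensorHom_id]

theorem cograph_whiskerLeft {x y : A} (f : x ⟶ y) (z : A) :
    (⟨z⟩ : TZero δ) ◁ cograph δ f = cograph δ (z ◁ f) := by
  rw [← id_tensorHom, ← cograph_id, tensorHom_cograph, id_tensorHom]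

end TZero

theorem mono_whiskerRight {x y : A} (f : x ⟶ y) [Mono f] (z : A) : Mono (f ▷ z) :=
  ⟨fun k l h => CartesianMonoidalCategory.hom_ext _ _
    (by rw [← cancel_mono f]; simpa using h =≫ fst _ _) (by simpa using h =≫ snd _ _)⟩

theorem mono_whiskerLeft {x y : A} (f : x ⟶ y) [Mono f] (z : A) : Mono (z ◁ f) :=
  ⟨fun k l h => CartesianMonoidalCategory.hom_ext _ _
    (by simpa using h =≫ fst _ _) (by rw [← cancel_mono f]; simpa using h =≫ snd _ _)⟩

variable [SubobjectFinite A]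

/-- Reduces sums over all subobjects of x × y to R(x, y) once the terms with a non-surjective
projection are known to vanish. -/
theorem sum_relations {M : Type*} [AddCommMonoid M] {x y : A} (f : Subobject (x ⊗ y) → M)
    (h₁ : ∀ u, ¬ IsSurj (u.arrow ≫ fst x y) → f u = 0)
    (h₂ : ∀ u, ¬ IsSurj (u.arrow ≫ snd x y) → f u = 0) :
    ∑ u, f u = ∑ r : R x y, f r.1 := by
  symm
  refine Fintype.sum_of_injective (fun r : R x y => r.1) Subtype.val_injective _ _ ?_
    (fun _ => rfl)
  intro u hu
  by_contra h
  exact hu ⟨⟨u, by_contra fun h' => h (h₁ u h'), by_contra fun h' => h (h₂ u h')⟩, rfl⟩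

open scoped Classical in
-- Rewrites p_x^* ⊗ 1 through the subobjects u × y of x × y, so that the vanishing lemmas apply to
-- the object x × y.
theorem pTop_whiskerRight_eq_sum (x y : A) : pTop δ x ▷ (⟨y⟩ : TZero δ) =
    𝟙 _ + ∑ u : Subobject x with u ≠ ⊤,
      mu u ⊤ • cograph δ (u.arrow ▷ y) ≫ graph δ (u.arrow ▷ y) := by
  have hz : ∀ (n : ℤ) (f : (⟨x⟩ : TZero δ) ⟶ ⟨x⟩),
      (n • f) ▷ (⟨y⟩ : TZero δ) = n • (f ▷ (⟨y⟩ : TZero δ)) := fun n f =>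
    map_zsmul (AddMonoidHom.mk' (fun f : (⟨x⟩ : TZero δ) ⟶ ⟨x⟩ => f ▷ (⟨y⟩ : TZero δ))
      (fun _ _ => MonoidalPreadditive.add_whiskerRight _ _)) n f
  rw [pTop_eq, MonoidalPreadditive.add_whiskerRight, id_whiskerRight, sum_whiskerRight]
  simp only [hz, pSub, comp_whiskerRight, graph_whiskerRight, cograph_whiskerRight]
  rfl

open scoped Classical in
theorem pTop_whiskerLeft_eq_sum (x y : A) : (⟨y⟩ : TZero δ) ◁ pTop δ x =
    𝟙 _ + ∑ u : Subobject x with u ≠ ⊤,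
      mu u ⊤ • cograph δ (y ◁ u.arrow) ≫ graph δ (y ◁ u.arrow) := by
  have hz : ∀ (n : ℤ) (f : (⟨x⟩ : TZero δ) ⟶ ⟨x⟩),
      (⟨y⟩ : TZero δ) ◁ (n • f) = n • ((⟨y⟩ : TZero δ) ◁ f) := fun n f =>
    map_zsmul (AddMonoidHom.mk' (fun f : (⟨x⟩ : TZero δ) ⟶ ⟨x⟩ => (⟨y⟩ : TZero δ) ◁ f)
      (fun _ _ => MonoidalPreadditive.whiskerLeft_add _ _)) n f
  rw [pTop_eq, MonoidalPreadditive.whiskerLeft_add, whiskerLeft_id, whiskerLeft_sum]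
  simp only [hz, pSub, MonoidalCategory.whiskerLeft_comp, graph_whiskerLeft, cograph_whiskerLeft]
  rfl

/-- If t maps onto x, then l factors through no u × y with u proper, so only the identity in p_x^* ⊗
1 contributes. The next three lemmas are the variants for the other factor and for transposes. -/
theorem pTop_graph_whiskerRight {t x y : A} (l : t ⟶ x ⊗ y) [IsSurj (l ≫ fst x y)] :
    pTop δ t ≫ graph δ l ≫ pTop δ x ▷ (⟨y⟩ : TZero δ) = pTop δ t ≫ graph δ l := by
  classical
  rw [pTop_whiskerRight_eq_sum]
  -- The objects `⟨x⟩ ⊗ ⟨y⟩` and `⟨x ⊗ y⟩` agree only after unfolding the tensor product of `T⁰`,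
  -- hence `erw`.
  erw [Preadditive.comp_add, Preadditive.comp_add, Category.comp_id]
  rw [Preadditive.comp_sum, Preadditive.comp_sum, Finset.sum_eq_zero, add_zero]
  intro u hu
  have := mono_whiskerRight u.arrow y
  have h := pTop_graph_cograph δ (u.arrow ▷ y) l (fun k hk =>
    not_factor_of_ne_top (l ≫ fst x y) (Finset.mem_filter.1 hu).2 (k ≫ fst _ _) (by rw [← hk]; simp))
  rw [Preadditive.comp_zsmul, Preadditive.comp_zsmul, reassoc_of% h, zero_comp, smul_zero]

theorem pTop_graph_whiskerLeft {t x y : A} (l : t ⟶ x ⊗ y) [IsSurj (l ≫ snd x y)] :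
    pTop δ t ≫ graph δ l ≫ (⟨x⟩ : TZero δ) ◁ pTop δ y = pTop δ t ≫ graph δ l := by
  classical
  rw [pTop_whiskerLeft_eq_sum]
  erw [Preadditive.comp_add, Preadditive.comp_add, Category.comp_id]
  rw [Preadditive.comp_sum, Preadditive.comp_sum, Finset.sum_eq_zero, add_zero]
  intro u hu
  have := mono_whiskerLeft u.arrow x
  have h := pTop_graph_cograph δ (x ◁ u.arrow) l (fun k hk =>
    not_factor_of_ne_top (l ≫ snd x y) (Finset.mem_filter.1 hu).2 (k ≫ snd _ _) (by rw [← hk]; simp))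
  rw [Preadditive.comp_zsmul, Preadditive.comp_zsmul, reassoc_of% h, zero_comp, smul_zero]

theorem whiskerRight_cograph_pTop {t x y : A} (l : t ⟶ x ⊗ y) [IsSurj (l ≫ fst x y)] :
    pTop δ x ▷ (⟨y⟩ : TZero δ) ≫ cograph δ l ≫ pTop δ t = cograph δ l ≫ pTop δ t := by
  classical
  rw [pTop_whiskerRight_eq_sum]
  erw [Preadditive.add_comp, Category.id_comp]
  rw [Preadditive.sum_comp, Finset.sum_eq_zero, add_zero]
  intro u hu
  have := mono_whiskerRight u.arrow y
  have h := graph_cograph_pTop δ (u.arrow ▷ y) l (fun k hk =>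
    not_factor_of_ne_top (l ≫ fst x y) (Finset.mem_filter.1 hu).2 (k ≫ fst _ _) (by rw [← hk]; simp))
  rw [Preadditive.zsmul_comp, Category.assoc, h, comp_zero, smul_zero]

theorem whiskerLeft_cograph_pTop {t x y : A} (l : t ⟶ x ⊗ y) [IsSurj (l ≫ snd x y)] :
    (⟨x⟩ : TZero δ) ◁ pTop δ y ≫ cograph δ l ≫ pTop δ t = cograph δ l ≫ pTop δ t := by
  classical
  rw [pTop_whiskerLeft_eq_sum]
  erw [Preadditive.add_comp, Category.id_comp]
  rw [Preadditive.sum_comp, Finset.sum_eq_zero, add_zero]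
  intro u hu
  have := mono_whiskerLeft u.arrow x
  have h := graph_cograph_pTop δ (x ◁ u.arrow) l (fun k hk =>
    not_factor_of_ne_top (l ≫ snd x y) (Finset.mem_filter.1 hu).2 (k ≫ snd _ _) (by rw [← hk]; simp))
  rw [Preadditive.zsmul_comp, Category.assoc, h, comp_zero, smul_zero]

theorem pTop_graph_tensor {t x y : A} (l : t ⟶ x ⊗ y) [IsSurj (l ≫ fst x y)]
    [IsSurj (l ≫ snd x y)] :
    pTop δ t ≫ graph δ l ≫ (pTop δ x ⊗ₘ pTop δ y) = pTop δ t ≫ graph δ l := by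
  rw [MonoidalCategory.tensorHom_def]
  have h₁ := pTop_graph_whiskerRight δ l
  have h₂ := pTop_graph_whiskerLeft δ l
  calc _ = (pTop δ t ≫ graph δ l ≫ pTop δ x ▷ (⟨y⟩ : TZero δ)) ≫
      (⟨x⟩ : TZero δ) ◁ pTop δ y := by simp only [Category.assoc]
    _ = _ := by rw [h₁, Category.assoc, h₂]

theorem tensor_cograph_pTop {t x y : A} (l : t ⟶ x ⊗ y) [IsSurj (l ≫ fst x y)]
    [IsSurj (l ≫ snd x y)] :
    (pTop δ x ⊗ₘ pTop δ y) ≫ cograph δ l ≫ pTop δ t = cograph δ l ≫ pTop δ t := by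
  rw [MonoidalCategory.tensorHom_def, Category.assoc]
  have h₁ := whiskerRight_cograph_pTop δ l
  have h₂ := whiskerLeft_cograph_pTop δ l
  erw [h₂, h₁]

theorem tensor_cograph_pTop_assoc {t x y : A} (l : t ⟶ x ⊗ y) [IsSurj (l ≫ fst x y)]
    [IsSurj (l ≫ snd x y)]
    {Z : TZero δ} (h : (⟨t⟩ : TZero δ) ⟶ Z) :
    (pTop δ x ⊗ₘ pTop δ y) ≫ cograph δ l ≫ pTop δ t ≫ h = cograph δ l ≫ pTop δ t ≫ h :=
  (reassoc_of% (tensor_cograph_pTop δ l)) h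

/-- Such an l factors through (im of t in x) × y, and p_x^* kills the transposed inclusion of that
proper image. -/
theorem tensor_cograph_eq_zero_left {t x y : A} (l : t ⟶ x ⊗ y) (h : ¬ IsSurj (l ≫ fst x y)) :
    (pTop δ x ⊗ₘ pTop δ y) ≫ cograph δ l = 0 := by
  have h₁ : l = lift (toIm (l ≫ fst x y)) (l ≫ snd x y) ≫ (im (l ≫ fst x y)).arrow ▷ y := by
    ext <;> simp
  have h₂ := pTop_comp_cograph_arrow δ (exists_ne_top_of_not_isSurj _ h)
  have h₃ : pTop δ x ▷ (⟨y⟩ : TZero δ) ≫ cograph δ ((im (l ≫ fst x y)).arrow ▷ y) = 0 := by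
    rw [← cograph_whiskerRight]
    erw [← comp_whiskerRight]
    rw [h₂, MonoidalPreadditive.zero_whiskerRight]
  rw [MonoidalCategory.tensorHom_def', Category.assoc, h₁, cograph_comp]
  erw [reassoc_of% h₃]
  rw [zero_comp, comp_zero]

theorem tensor_cograph_eq_zero_right {t x y : A} (l : t ⟶ x ⊗ y) (h : ¬ IsSurj (l ≫ snd x y)) :
    (pTop δ x ⊗ₘ pTop δ y) ≫ cograph δ l = 0 := by
  have h₁ : l = lift (l ≫ fst x y) (toIm (l ≫ snd x y)) ≫ x ◁ (im (l ≫ snd x y)).arrow := by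
    ext <;> simp
  have h₂ := pTop_comp_cograph_arrow δ (exists_ne_top_of_not_isSurj _ h)
  have h₃ : (⟨x⟩ : TZero δ) ◁ pTop δ y ≫ cograph δ (x ◁ (im (l ≫ snd x y)).arrow) = 0 := by
    rw [← cograph_whiskerLeft]
    erw [← MonoidalCategory.whiskerLeft_comp]
    rw [h₂, MonoidalPreadditive.whiskerLeft_zero]
  rw [MonoidalCategory.tensorHom_def, Category.assoc, h₁, cograph_comp]
  erw [reassoc_of% h₃]
  rw [zero_comp, comp_zero]

/-- Multiply the resolution of the identity of [x × y] by p_x^* ⊗ p_y^*: summands of subobjects with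
a non-surjective projection are killed, and those in R(x, y) absorb the factor. This is the
decomposition of [x]^* ⊗ [y]^*. -/
theorem pTop_tensor_pTop (x y : A) : pTop δ x ⊗ₘ pTop δ y =
    ∑ r : R x y, cograph δ (lift r.left r.right) ≫ pTop δ r.obj ≫
      graph δ (lift r.left r.right) := by
  have h := congrArg ((pTop δ x ⊗ₘ pTop δ y) ≫ ·) (sum_pTop δ (x ⊗ y))
  erw [Category.comp_id, Preadditive.comp_sum] at h
  rw [← h, sum_relations]
  · refine Finset.sum_congr rfl fun r _ => ?_
    rw [R.lift_left_right]
    have h₁ : IsSurj (r.1.arrow ≫ fst x y) := r.2.1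
    have h₂ : IsSurj (r.1.arrow ≫ snd x y) := r.2.2
    exact tensor_cograph_pTop_assoc δ _ _
  · intro u hu
    have := tensor_cograph_eq_zero_left δ _ hu
    erw [reassoc_of% this, zero_comp]
  · intro u hu
    have := tensor_cograph_eq_zero_right δ _ hu
    erw [reassoc_of% this, zero_comp]

open scoped Classical in
-- The relation is p_r between the two projections of x × y, and p_r is the sum of the p_u^* with u
-- ≤ r.
theorem rel_eq_sum {x y : A} (r : Subobject (x ⊗ y)) :
    rel δ r = ∑ u : Subobject (x ⊗ y) with u ≤ r,
      cograph δ (u.arrow ≫ fst x y) ≫ pTop δ (u : A) ≫ graph δ (u.arrow ≫ snd x y) := by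
  have h : rel δ r = cograph δ (fst x y) ≫ pSub δ r ≫ graph δ (snd x y) := by
    rw [rel_eq, cograph_comp, graph_comp, pSub, Category.assoc, Category.assoc]
  rw [h, ← sum_pStar, Preadditive.sum_comp, Preadditive.comp_sum]
  refine Finset.sum_congr rfl fun u _ => ?_
  rw [pStar_eq, cograph_comp, graph_comp]
  simp only [Category.assoc]

theorem cograph_pTop_graph_pTop {t x y : A} (a : t ⟶ x) (b : t ⟶ y) [IsSurj a] [IsSurj b] :
    pTop δ x ≫ (cograph δ a ≫ pTop δ t ≫ graph δ b) ≫ pTop δ y =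
      cograph δ a ≫ pTop δ t ≫ graph δ b := by
  simp only [Category.assoc]
  rw [pTop_graph_pTop, pTop_cograph_pTop_assoc]

open scoped Classical in
/-- The expansion of `{r}` in terms of the `(u)`. -/
theorem pTop_rel_pTop {x y : A} (r : Subobject (x ⊗ y)) :
    pTop δ x ≫ rel δ r ≫ pTop δ y =
      ∑ u : R x y with u.1 ≤ r, cograph δ u.left ≫ pTop δ u.obj ≫ graph δ u.right := by
  rw [rel_eq_sum, Preadditive.sum_comp, Preadditive.comp_sum, Finset.sum_filter, sum_relations,
    Finset.sum_filter]
  · refine Finset.sum_congr rfl fun u _ => ?_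
    split_ifs
    · exact cograph_pTop_graph_pTop δ u.left u.right
    · rfl
  · intro u hu
    split_ifs
    · rw [Category.assoc, ← Category.assoc (pTop δ x), pTop_comp_cograph_eq_zero δ _ hu, zero_comp]
    · rfl
  · intro u hu
    split_ifs
    · simp only [Category.assoc]
      rw [graph_comp_pTop_eq_zero δ _ hu, comp_zero, comp_zero, comp_zero]
    · rfl

open scoped Classical in
-- By base change the middle is the relation r ×_y s between r and s, to which `pTop_rel_pTop`
-- applies. The filter condition says that u is contained in r ×_y s. This is the core of the
-- product formula for the round basis.
theorem pTop_graph_cograph_pTop {r s y : A} (b : r ⟶ y) (c : s ⟶ y) [IsSurj b] [IsSurj c] :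
    pTop δ r ≫ graph δ b ≫ cograph δ c ≫ pTop δ s =
      ∑ u : R r s with u.left ≫ b = u.right ≫ c,
        cograph δ u.left ≫ pTop δ u.obj ≫ graph δ u.right := by
  have H := IsPullback.of_hasPullback b c
  have hm : Mono (lift (pullback.fst b c) (pullback.snd b c)) :=
    ⟨fun k l h => H.hom_ext (by simpa using h =≫ fst _ _) (by simpa using h =≫ snd _ _)⟩
  have h : graph δ b ≫ cograph δ c = rel δ (Subobject.mk (lift (pullback.fst b c)
      (pullback.snd b c))) := by
    rw [graph_comp_cograph δ H, cograph_comp_graph, spanHom_of_mono]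
  have h' := pTop_rel_pTop δ (Subobject.mk (lift (pullback.fst b c) (pullback.snd b c)))
  rw [← h, Category.assoc] at h'
  rw [h']
  refine Finset.sum_congr ?_ fun _ _ => rfl
  ext u
  simp only [Finset.mem_filter, Finset.mem_univ, true_and]
  constructor
  · intro hu
    have e : Subobject.ofLEMk _ _ hu ≫ lift (pullback.fst b c) (pullback.snd b c) = u.1.arrow :=
      Subobject.ofLEMk_comp _
    change (u.1.arrow ≫ fst r s) ≫ b = (u.1.arrow ≫ snd r s) ≫ c
    rw [← e]
    simp only [Category.assoc, lift_fst, lift_snd, H.w]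
  · intro hu
    refine Subobject.le_mk_of_comm (H.lift u.left u.right hu) ?_
    rw [← R.lift_left_right]
    ext
    · exact (Category.assoc _ _ _).trans ((congrArg _ (lift_fst _ _)).trans
        ((H.lift_fst _ _ hu).trans (lift_fst _ _).symm))
    · exact (Category.assoc _ _ _).trans ((congrArg _ (lift_snd _ _)).trans
        ((H.lift_snd _ _ hu).trans (lift_snd _ _).symm))

end StarTensor

/-! ### Coefficients -/

section Coefficients

open TZero

variable {A : Type u} [Category.{v} A] [CartesianMonoidalCategory A] [IsRegular A]
  {K : Type w} [CommRing K] (δ : DegreeFunction A K)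

/-- The coefficient of `⟨s⟩` in a morphism of `T⁰`. -/
noncomputable def TZero.coeff {x y : A} (s : Subobject (x ⊗ y)) :
    ((⟨x⟩ : TZero δ) ⟶ ⟨y⟩) →ₗ[K] K :=
  (Finsupp.lapply s : (Subobject (x ⊗ y) →₀ K) →ₗ[K] K)

theorem TZero.coeff_rel_self {x y : A} (s : Subobject (x ⊗ y)) : coeff δ s (rel δ s) = 1 :=
  Finsupp.single_eq_same

theorem TZero.coeff_rel_of_ne {x y : A} {r s : Subobject (x ⊗ y)} (h : r ≠ s) :
    coeff δ s (rel δ r) = 0 :=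
  Finsupp.single_eq_of_ne h.symm

variable [SubobjectFinite A]

/-- Relations that occur after p_u have their projection to x inside u, so none of them surjects
onto x if u is proper. -/
theorem coeff_pSub_comp {x y : A} {u : Subobject x} (hu : u ≠ ⊤) (g : (⟨x⟩ : TZero δ) ⟶ ⟨y⟩)
    (s : R x y) : coeff δ s.1 (pSub δ u ≫ g) = 0 := by
  obtain ⟨c, hc⟩ := hom_eq_sum δ (graph δ u.arrow ≫ g)
  rw [pSub, Category.assoc, hc, Preadditive.comp_sum, map_sum]
  refine Finset.sum_eq_zero fun r _ => ?_
  rw [Linear.comp_smul, map_smul, rel_eq_spanHom, cograph_comp_spanHom, spanHom_eq, map_smul,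
    coeff_rel_of_ne, smul_zero, smul_zero]
  intro h
  have h₁ := toIm_fst ((r.arrow ≫ fst _ _) ≫ u.arrow) (r.arrow ≫ snd _ _)
  have h₂ : IsSurj ((im (lift ((r.arrow ≫ fst _ _) ≫ u.arrow) (r.arrow ≫ snd _ _))).arrow ≫
      fst x y) := h ▸ s.2.1
  have h₃ : IsSurj ((r.arrow ≫ fst _ _) ≫ u.arrow) := h₁ ▸ inferInstance
  have := isIso_of_isSurj_of_mono (IsSurj.of_comp _ _ h₃)
  exact hu (Subobject.eq_top_of_isIso_arrow u)

theorem coeff_comp_pSub {x y : A} {u : Subobject y} (hu : u ≠ ⊤) (g : (⟨x⟩ : TZero δ) ⟶ ⟨y⟩)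
    (s : R x y) : coeff δ s.1 (g ≫ pSub δ u) = 0 := by
  obtain ⟨c, hc⟩ := hom_eq_sum δ (g ≫ cograph δ u.arrow)
  rw [pSub, ← Category.assoc, hc, Preadditive.sum_comp, map_sum]
  refine Finset.sum_eq_zero fun r _ => ?_
  rw [Linear.smul_comp, map_smul, rel_eq_spanHom, spanHom_comp_graph, spanHom_eq, map_smul,
    coeff_rel_of_ne, smul_zero, smul_zero]
  intro h
  have h₁ := toIm_snd (r.arrow ≫ fst _ _) ((r.arrow ≫ snd _ _) ≫ u.arrow)
  have h₂ : IsSurj ((im (lift (r.arrow ≫ fst _ _) ((r.arrow ≫ snd _ _) ≫ u.arrow))).arrow ≫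
      snd x y) := h ▸ s.2.2
  have h₃ : IsSurj ((r.arrow ≫ snd _ _) ≫ u.arrow) := h₁ ▸ inferInstance
  have := isIso_of_isSurj_of_mono (IsSurj.of_comp _ _ h₃)
  exact hu (Subobject.eq_top_of_isIso_arrow u)

/-- All correction terms in p_x^* and p_y^* come from proper subobjects and do not reach R(x, y).
Linear independence of the {r} rests on this. -/
theorem coeff_pTop_comp_pTop {x y : A} (g : (⟨x⟩ : TZero δ) ⟶ ⟨y⟩) (s : R x y) :
    coeff δ s.1 (pTop δ x ≫ g ≫ pTop δ y) = coeff δ s.1 g := by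
  classical
  rw [pTop_eq δ x, Preadditive.add_comp, Category.id_comp, map_add, Preadditive.sum_comp, map_sum,
    Finset.sum_eq_zero, add_zero, pTop_eq δ y, Preadditive.comp_add, Category.comp_id, map_add,
    Preadditive.comp_sum, map_sum, Finset.sum_eq_zero, add_zero]
  · intro u hu
    rw [Preadditive.comp_zsmul, map_zsmul, coeff_comp_pSub δ (Finset.mem_filter.1 hu).2, smul_zero]
  · intro u hu
    rw [Preadditive.zsmul_comp, map_zsmul, coeff_pSub_comp δ (Finset.mem_filter.1 hu).2, smul_zero]

end Coefficients

/-! ### The canonical functor to the envelope is monoidal -/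

section EnvelopeTensor

open TZero

theorem embedding_map_eq_monomial {C : Type u} [Category.{v} C] [Preadditive C] {X Y : C}
    (f : X ⟶ Y) :
    (Mat_.embedding C).map f = monomial (M := (Mat_.embedding C).obj X)
      (N := (Mat_.embedding C).obj Y) (fun _ => PUnit.unit) (fun _ => f) :=
  monomial_ext (fun _ => rfl) (fun _ _ h => (h rfl).elim)

variable {A : Type u} [Category.{v} A] [CartesianMonoidalCategory A] [IsRegular A]
  {K : Type w} [CommRing K] (δ : DegreeFunction A K)

/-- The morphism `[x] ⟶ [y]` of the envelope given by a morphism of `T⁰`. -/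
noncomputable def env {x y : A} (f : (⟨x⟩ : TZero δ) ⟶ ⟨y⟩) : gen δ x ⟶ gen δ y :=
  (toEnvelope δ).map f

theorem env_comp {x y z : A} (f : (⟨x⟩ : TZero δ) ⟶ ⟨y⟩) (g : (⟨y⟩ : TZero δ) ⟶ ⟨z⟩) :
    env δ (f ≫ g) = env δ f ≫ env δ g :=
  (toEnvelope δ).map_comp f g

theorem env_comp_assoc {x y z : A} (f : (⟨x⟩ : TZero δ) ⟶ ⟨y⟩) (g : (⟨y⟩ : TZero δ) ⟶ ⟨z⟩)
    {Z : Envelope δ} (h : gen δ z ⟶ Z) :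
    env δ (f ≫ g) ≫ h = env δ f ≫ env δ g ≫ h :=
  (reassoc_of% (env_comp δ f g)) h

theorem env_id (x : A) : env δ (𝟙 (⟨x⟩ : TZero δ)) = 𝟙 _ :=
  (toEnvelope δ).map_id _

theorem env_add {x y : A} (f g : (⟨x⟩ : TZero δ) ⟶ ⟨y⟩) : env δ (f + g) = env δ f + env δ g :=
  rfl

theorem env_smul {x y : A} (c : K) (f : (⟨x⟩ : TZero δ) ⟶ ⟨y⟩) : env δ (c • f) = c • env δ f :=
  rfl

theorem env_sum {x y : A} {ι : Type*} (s : Finset ι) (f : ι → ((⟨x⟩ : TZero δ) ⟶ ⟨y⟩)) :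
    env δ (∑ i ∈ s, f i) = ∑ i ∈ s, env δ (f i) :=
  map_sum (AddMonoidHom.mk' (env δ) (env_add δ)) f s

/-- The tensor product of two morphisms of `T⁰`, as a morphism `[x × x'] ⟶ [y × y']`. -/
noncomputable def ten {δ : DegreeFunction A K} {x y x' y' : A} (f : (⟨x⟩ : TZero δ) ⟶ ⟨y⟩)
    (g : (⟨x'⟩ : TZero δ) ⟶ ⟨y'⟩) : (⟨x ⊗ x'⟩ : TZero δ) ⟶ ⟨y ⊗ y'⟩ :=
  f ⊗ₘ g

theorem ten_graph {x y x' y' : A} (f : x ⟶ y) (g : x' ⟶ y') :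
    ten (graph δ f) (graph δ g) = graph δ (f ⊗ₘ g) :=
  tensorHom_graph f g

theorem ten_cograph {x y x' y' : A} (f : x ⟶ y) (g : x' ⟶ y') :
    ten (cograph δ f) (cograph δ g) = cograph δ (f ⊗ₘ g) :=
  tensorHom_cograph δ f g

theorem ten_comp {x y z x' y' z' : A} (f : (⟨x⟩ : TZero δ) ⟶ ⟨y⟩) (f' : (⟨x'⟩ : TZero δ) ⟶ ⟨y'⟩)
    (g : (⟨y⟩ : TZero δ) ⟶ ⟨z⟩) (g' : (⟨y'⟩ : TZero δ) ⟶ ⟨z'⟩) :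
    ten (f ≫ g) (f' ≫ g') = ten f f' ≫ ten g g' :=
  (tensorHom_comp_tensorHom _ _ _ _).symm

section

variable [SubobjectFinite A]

theorem pTop_graph_ten {t x y : A} (l : t ⟶ x ⊗ y) [IsSurj (l ≫ fst x y)]
    [IsSurj (l ≫ snd x y)] :
    pTop δ t ≫ graph δ l ≫ ten (pTop δ x) (pTop δ y) = pTop δ t ≫ graph δ l :=
  pTop_graph_tensor δ l

theorem ten_cograph_pTop {t x y : A} (l : t ⟶ x ⊗ y) [IsSurj (l ≫ fst x y)]
    [IsSurj (l ≫ snd x y)] :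
    ten (pTop δ x) (pTop δ y) ≫ cograph δ l ≫ pTop δ t = cograph δ l ≫ pTop δ t :=
  tensor_cograph_pTop δ l

theorem pTop_ten_pTop (x y : A) : ten (pTop δ x) (pTop δ y) =
    ∑ r : R x y, cograph δ (lift r.left r.right) ≫ pTop δ r.obj ≫
      graph δ (lift r.left r.right) :=
  pTop_tensor_pTop δ x y

end

/-- The normal form, idempotent followed by a monomial matrix, in which `karoubi_comp` and
`comp_eq_monomial` calculate. -/
theorem env_f {x y : A} (f : (⟨x⟩ : TZero δ) ⟶ ⟨y⟩) : (env δ f).f =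
    (gen δ x).p ≫ monomial (M := (Mat_.embedding (TZero δ)).obj ⟨x⟩)
      (N := (Mat_.embedding (TZero δ)).obj ⟨y⟩) (fun _ => PUnit.unit) (fun _ => f) := by
  rw [← embedding_map_eq_monomial]
  exact (Category.id_comp _).symm

theorem genTensor_naturality {x y x' y' : A} (f : (⟨x⟩ : TZero δ) ⟶ ⟨x'⟩)
    (g : (⟨y⟩ : TZero δ) ⟶ ⟨y'⟩) :
    (env δ f ⊗ₘ env δ g) ≫ (genTensor δ x' y').hom =
      (genTensor δ x y).hom ≫ env δ (ten f g) := by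
  refine karoubi_naturality (P := karoubiTensorObj (gen δ x) (gen δ y))
    (P' := gen δ (x ⊗ y)) (Q := karoubiTensorObj (gen δ x') (gen δ y'))
    (Q' := gen δ (x' ⊗ y')) rfl rfl ?_ ?_
  · exact ((congrArg (· ≫ _) (id_tensorHom_id _ _)).trans
      ((Category.id_comp _).trans (Category.comp_id _).symm))
  · refine monomial_naturality (M' := matTensorObj ((Mat_.embedding (TZero δ)).obj ⟨x'⟩)
      ((Mat_.embedding (TZero δ)).obj ⟨y'⟩)) (N' := (Mat_.embedding (TZero δ)).obj ⟨x' ⊗ y'⟩)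
      _ _ _ _ _ _ ?_ ?_
    · exact ⟨fun ⟨⟨⟩, ⟨⟩⟩ ⟨⟨⟩, ⟨⟩⟩ _ => rfl, fun _ => ⟨(PUnit.unit, PUnit.unit), rfl⟩⟩
    · intro i j
      exact (Category.comp_id _).trans (Category.id_comp _).symm

theorem genTensor_naturality_assoc {x y x' y' : A} (f : (⟨x⟩ : TZero δ) ⟶ ⟨x'⟩)
    (g : (⟨y⟩ : TZero δ) ⟶ ⟨y'⟩)
    {Z : Envelope δ} (h : gen δ (x' ⊗ y') ⟶ Z) :
    (env δ f ⊗ₘ env δ g) ≫ (genTensor δ x' y').hom ≫ h =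
      (genTensor δ x y).hom ≫ env δ (ten f g) ≫ h :=
  (reassoc_of% (genTensor_naturality δ f g)) h

/-- All matrices involved are monomial with a single entry, and the entry of `genTensor` is an
identity. So this coherence square, like those for the symmetry and the units below, reduces to a
trivial one in `T⁰`. -/
theorem genTensor_associator (x y z : A) :
    (genTensor δ x y).hom ▷ gen δ z ≫ (genTensor δ (x ⊗ y) z).hom ≫
      env δ (graph δ (α_ x y z).hom) =
    (α_ (gen δ x) (gen δ y) (gen δ z)).hom ≫ gen δ x ◁ (genTensor δ y z).hom ≫
      (genTensor δ x (y ⊗ z)).hom := by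
  refine karoubi_eq (karoubi_comp (karoubi_tensor rfl (karoubi_id (gen δ z)))
    (karoubi_comp rfl (env_f δ _)))
    (karoubi_comp rfl (karoubi_comp (karoubi_tensor (karoubi_id (gen δ x)) rfl) rfl)) ?_
  refine eq_of_eq_monomial (comp_eq_monomial (tensor_eq_monomial rfl (mat_id_eq _))
    (comp_eq_monomial rfl rfl))
    (comp_eq_monomial rfl (comp_eq_monomial (tensor_eq_monomial (mat_id_eq _) rfl) rfl)) ?_
  intro i
  have h₁ : (𝟙 ((⟨x⟩ : TZero δ) ⊗ ⟨y⟩) ⊗ₘ 𝟙 (⟨z⟩ : TZero δ)) ≫ 𝟙 _ ≫ (α_ _ _ _).hom =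
      (α_ _ _ _).hom ≫ (𝟙 (⟨x⟩ : TZero δ) ⊗ₘ 𝟙 ((⟨y⟩ : TZero δ) ⊗ ⟨z⟩)) ≫ 𝟙 _ := by simp
  exact h₁

theorem genTensor_braiding [BraidedCategory A] (x y : A) :
    (genTensor δ x y).hom ≫ env δ (graph δ (β_ x y).hom) =
      (β_ (gen δ x) (gen δ y)).hom ≫ (genTensor δ y x).hom := by
  refine karoubi_eq (karoubi_comp rfl (env_f δ _)) (karoubi_comp rfl rfl) ?_
  refine eq_of_eq_monomial (comp_eq_monomial rfl rfl) (comp_eq_monomial rfl rfl) ?_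
  intro i
  have h₁ : 𝟙 _ ≫ (β_ (⟨x⟩ : TZero δ) ⟨y⟩).hom = (β_ _ _).hom ≫ 𝟙 _ := by simp
  exact h₁

theorem genTensor_leftUnitor (x : A) :
    (genUnit δ).hom ▷ gen δ x ≫ (λ_ (gen δ x)).hom =
      (genTensor δ (𝟙_ A) x).hom ≫ env δ (graph δ (λ_ x).hom) := by
  refine karoubi_eq (karoubi_comp (karoubi_tensor (karoubi_id _) (karoubi_id (gen δ x))) rfl)
    (karoubi_comp rfl (env_f δ _)) ?_
  refine eq_of_eq_monomial (comp_eq_monomial (tensor_eq_monomial (mat_id_eq _) (mat_id_eq _)) rfl)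
    (comp_eq_monomial rfl rfl) ?_
  intro i
  have h₁ : (𝟙 (𝟙_ (TZero δ)) ⊗ₘ 𝟙 (⟨x⟩ : TZero δ)) ≫ (λ_ _).hom = 𝟙 _ ≫ (λ_ _).hom := by simp
  exact h₁

theorem genTensor_rightUnitor (x : A) :
    gen δ x ◁ (genUnit δ).hom ≫ (ρ_ (gen δ x)).hom =
      (genTensor δ x (𝟙_ A)).hom ≫ env δ (graph δ (ρ_ x).hom) := by
  refine karoubi_eq (karoubi_comp (karoubi_tensor (karoubi_id (gen δ x)) (karoubi_id _)) rfl)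
    (karoubi_comp rfl (env_f δ _)) ?_
  refine eq_of_eq_monomial (comp_eq_monomial (tensor_eq_monomial (mat_id_eq _) (mat_id_eq _)) rfl)
    (comp_eq_monomial rfl rfl) ?_
  intro i
  have h₁ : (𝟙 (⟨x⟩ : TZero δ) ⊗ₘ 𝟙 (𝟙_ (TZero δ))) ≫ (ρ_ _).hom = 𝟙 _ ≫ (ρ_ _).hom := by simp
  exact h₁

end EnvelopeTensor

/-! ### Morphisms between the summands `[x]^*` -/

section Res

open TZero

variable {A : Type u} [Category.{v} A] [CartesianMonoidalCategory A] [IsRegular A]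
  [SubobjectFinite A] {K : Type w} [CommRing K] (δ : DegreeFunction A K)

/-- The morphism `[x]^* ⟶ [y]^*` given by a morphism `[x] ⟶ [y]`. -/
noncomputable def res {x y : A} (g : (⟨x⟩ : TZero δ) ⟶ ⟨y⟩) : star δ x ⟶ star δ y :=
  starIncl δ x ≫ env δ g ≫ starProj δ y

theorem starProj_starIncl_eq (x : A) : starProj δ x ≫ starIncl δ x = env δ (pTop δ x) :=
  starProj_starIncl δ x

theorem starIncl_pTop (x : A) : starIncl δ x ≫ env δ (pTop δ x) = starIncl δ x := by
  rw [← starProj_starIncl_eq, ← Category.assoc, starIncl_starProj, Category.id_comp]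

theorem pTop_starProj (x : A) : env δ (pTop δ x) ≫ starProj δ x = starProj δ x := by
  rw [← starProj_starIncl_eq, Category.assoc, starIncl_starProj, Category.comp_id]

theorem starProj_res_starIncl {x y : A} (g : (⟨x⟩ : TZero δ) ⟶ ⟨y⟩) :
    starProj δ x ≫ res δ g ≫ starIncl δ y =
      env δ (pTop δ x ≫ g ≫ pTop δ y) := by
  rw [env_comp, env_comp, ← starProj_starIncl_eq, ← starProj_starIncl_eq, res]
  simp only [Category.assoc]

/-- A morphism of summands is recovered from its extension by zero to [x] ⟶ [y], which is the
product of g with the two idempotents. The converse, `pTop_eq_of_res_eq`, holds because the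
canonical functor is faithful. -/
theorem res_congr {x y : A} {g h : (⟨x⟩ : TZero δ) ⟶ ⟨y⟩}
    (H : pTop δ x ≫ g ≫ pTop δ y = pTop δ x ≫ h ≫ pTop δ y) : res δ g = res δ h := by
  rw [← Category.id_comp (res δ g), ← Category.comp_id (res δ g), ← starIncl_starProj,
    ← starIncl_starProj, Category.assoc, ← Category.assoc (res δ g), ← Category.assoc (starProj δ x),
    starProj_res_starIncl, H, ← starProj_res_starIncl]
  simp only [Category.assoc, starIncl_starProj]
  rw [← Category.assoc, starIncl_starProj]
  simp

theorem pTop_eq_of_res_eq {x y : A} {g h : (⟨x⟩ : TZero δ) ⟶ ⟨y⟩} (H : res δ g = res δ h) :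
    pTop δ x ≫ g ≫ pTop δ y = pTop δ x ≫ h ≫ pTop δ y :=
  (toEnvelope δ).map_injective ((starProj_res_starIncl δ g).symm.trans
    ((congrArg (fun f => starProj δ x ≫ f ≫ starIncl δ y) H).trans (starProj_res_starIncl δ h)))

theorem res_comp {x y z : A} (g : (⟨x⟩ : TZero δ) ⟶ ⟨y⟩) (h : (⟨y⟩ : TZero δ) ⟶ ⟨z⟩) :
    res δ g ≫ res δ h = res δ (g ≫ pTop δ y ≫ h) := by
  simp only [res, env_comp, ← starProj_starIncl_eq, Category.assoc]

theorem res_surjective {x y : A} (f : star δ x ⟶ star δ y) :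
    ∃ g : (⟨x⟩ : TZero δ) ⟶ ⟨y⟩, res δ g = f := by
  obtain ⟨g, hg⟩ := (toEnvelope δ).map_surjective (starProj δ x ≫ f ≫ starIncl δ y)
  change env δ g = _ at hg
  refine ⟨g, ?_⟩
  rw [res, hg, Category.assoc, Category.assoc, starIncl_starProj, Category.comp_id,
    ← Category.assoc, starIncl_starProj, Category.id_comp]

/-- `res` as a linear map. -/
noncomputable def resLinear (x y : A) :
    ((⟨x⟩ : TZero δ) ⟶ ⟨y⟩) →ₗ[K] (star δ x ⟶ star δ y) where
  toFun := res δ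
  map_add' f g := by
    rw [res, env_add, Preadditive.add_comp, Preadditive.comp_add]
    rfl
  map_smul' c f := by
    rw [res, env_smul, Linear.smul_comp, Linear.comp_smul]
    rfl

theorem res_sum {x y : A} {ι : Type*} (s : Finset ι) (f : ι → ((⟨x⟩ : TZero δ) ⟶ ⟨y⟩)) :
    res δ (∑ i ∈ s, f i) = ∑ i ∈ s, res δ (f i) :=
  map_sum (resLinear δ x y) f s

theorem res_smul {x y : A} (c : K) (f : (⟨x⟩ : TZero δ) ⟶ ⟨y⟩) : res δ (c • f) = c • res δ f :=
  map_smul (resLinear δ x y) c f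

theorem res_zsmul {x y : A} (c : ℤ) (f : (⟨x⟩ : TZero δ) ⟶ ⟨y⟩) : res δ (c • f) = c • res δ f :=
  map_zsmul (resLinear δ x y) c f

theorem res_zero (x y : A) : res δ (0 : (⟨x⟩ : TZero δ) ⟶ ⟨y⟩) = 0 :=
  map_zero (resLinear δ x y)

theorem res_id (x : A) : res δ (𝟙 (⟨x⟩ : TZero δ)) = 𝟙 (star δ x) := by
  rw [res, env_id, Category.id_comp, starIncl_starProj]

theorem res_pTop_comp {x y : A} (g : (⟨x⟩ : TZero δ) ⟶ ⟨y⟩) : res δ (pTop δ x ≫ g) = res δ g :=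
  res_congr δ (by rw [Category.assoc, pTop_idem_assoc])

theorem res_comp_pTop {x y : A} (g : (⟨x⟩ : TZero δ) ⟶ ⟨y⟩) : res δ (g ≫ pTop δ y) = res δ g :=
  res_congr δ (by rw [Category.assoc, pTop_idem])

theorem round_eq_res {x y : A} (r : R x y) :
    round δ r = res δ (cograph δ r.left ≫ pTop δ r.obj ≫ graph δ r.right) := by
  rw [round, res, starProj_starIncl_eq]
  simp only [env_comp, Category.assoc]
  rfl

theorem curly_eq_res {x y : A} (r : R x y) : curly δ r = res δ (rel δ r.1) := rfl

/-- The intermediate p_y^* of `res_comp` is absorbed, because a surjective e carries [x]^* into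
[y]^*. -/
theorem res_graph_comp {x y z : A} (e : x ⟶ y) [IsSurj e] (g : (⟨y⟩ : TZero δ) ⟶ ⟨z⟩) :
    res δ (graph δ e) ≫ res δ g = res δ (graph δ e ≫ g) := by
  rw [res_comp, ← res_pTop_comp, pTop_graph_pTop_assoc, res_pTop_comp]

/-- The expansion of `{r}` in terms of the `(u)`. -/
theorem curly_eq_sum {x y : A} (r : R x y) [DecidablePred fun u : R x y => u.1 ≤ r.1] :
    curly δ r = ∑ u : R x y with u.1 ≤ r.1, round δ u := by
  classical
  rw [curly_eq_res, ← res_pTop_comp, ← res_comp_pTop, Category.assoc, pTop_rel_pTop, res_sum]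
  refine Finset.sum_congr (by ext; simp) fun u _ => (round_eq_res δ u).symm

/-- Independence: coefficients at elements of R(x, y) can be read off after multiplication by the
idempotents. Generation: the canonical functor is full, and a relation with a non-surjective
projection restricts to zero. -/
theorem curly_basis (x y : A) :
    ∃ b : Module.Basis (R x y) K (star δ x ⟶ star δ y), ∀ r, b r = curly δ r := by
  classical
  have hli : LinearIndependent K fun r : R x y => curly δ r := by
    rw [Fintype.linearIndependent_iff]
    intro c hc s
    have h₁ : res δ (∑ r : R x y, c r • rel δ r.1) = res δ 0 := by
      rw [res_sum, res_zero, ← hc]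
      exact Finset.sum_congr rfl fun r _ => res_smul δ _ _
    have h₂ := congrArg (coeff δ s.1) (pTop_eq_of_res_eq δ h₁)
    rw [coeff_pTop_comp_pTop, coeff_pTop_comp_pTop, map_zero, map_sum,
      Finset.sum_eq_single s] at h₂
    · rwa [map_smul, coeff_rel_self, smul_eq_mul, mul_one] at h₂
    · intro r _ hr
      rw [map_smul, coeff_rel_of_ne δ (fun h => hr (Subtype.ext h)), smul_zero]
    · simp
  refine ⟨Module.Basis.mk hli ?_, fun r => Module.Basis.mk_apply hli _ r⟩
  rintro f -
  obtain ⟨g, rfl⟩ := res_surjective δ f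
  obtain ⟨c, rfl⟩ := hom_eq_sum δ g
  rw [res_sum]
  refine Submodule.sum_mem _ fun r _ => ?_
  rw [res_smul]
  refine Submodule.smul_mem _ _ ?_
  by_cases hl : IsSurj (r.arrow ≫ fst x y)
  · by_cases hr : IsSurj (r.arrow ≫ snd x y)
    · exact Submodule.subset_span ⟨⟨r, hl, hr⟩, rfl⟩
    · rw [← res_comp_pTop, rel_eq, Category.assoc, graph_comp_pTop_eq_zero δ _ hr, comp_zero,
        res_zero]
      exact Submodule.zero_mem _
  · rw [← res_pTop_comp, rel_eq, ← Category.assoc, pTop_comp_cograph_eq_zero δ _ hl, zero_comp,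
      res_zero]
    exact Submodule.zero_mem _

theorem round_basis (x y : A) :
    ∃ b : Module.Basis (R x y) K (star δ x ⟶ star δ y), ∀ r, b r = round δ r := by
  classical
  obtain ⟨b, hb⟩ := curly_basis δ x y
  have := Module.Finite.of_basis b
  -- T sends {r} to (r). As {r} is a sum of elements (u), T is a surjective endomorphism of a finite
  -- module over a commutative ring, hence bijective; the triangular matrix need not be inverted.
  let T := b.constr K fun r => round δ r
  have hT : Function.Surjective T := by
    rw [← LinearMap.range_eq_top, ← top_le_iff, ← b.span_eq, Submodule.span_le]
    rintro _ ⟨r, rfl⟩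
    rw [hb, curly_eq_sum]
    exact Submodule.sum_mem _ fun u _ => ⟨b u, b.constr_basis K _ u⟩
  exact ⟨b.map (LinearEquiv.ofBijective T ⟨OrzechProperty.injective_of_surjective_endomorphism T hT,
    hT⟩), fun r => b.constr_basis K _ r⟩

end Res

/-! ### Spans of surjective morphisms, and inclusions into tensor products -/

section Spans

open TZero

variable {A : Type u} [Category.{v} A] [CartesianMonoidalCategory A] [IsRegular A]

theorem R.mono_toSpan {t x y : A} (a : t ⟶ x) (b : t ⟶ y) [IsSurj a] [IsSurj b]
    [Mono (lift a b)] : Mono (R.toSpan a b) := by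
  have : toIm (lift a b) ≫ (im (lift a b)).arrow = lift a b := toIm_arrow _
  exact mono_of_mono_fac this

theorem R.isIso_toSpan {t x y : A} (a : t ⟶ x) (b : t ⟶ y) [IsSurj a] [IsSurj b]
    [Mono (lift a b)] : IsIso (R.toSpan a b) :=
  have := R.mono_toSpan a b
  isIso_of_isSurj_of_mono inferInstance

variable [SubobjectFinite A] {K : Type w} [CommRing K] (δ : DegreeFunction A K)

/-- Apply both absorption lemmas: the transposed graph of the inverse is the graph of e, so p_x^*
and p_y^* can each be added or removed. -/
theorem pTop_graph_iso {x y : A} (e : x ≅ y) :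
    pTop δ x ≫ graph δ e.hom = graph δ e.hom ≫ pTop δ y := by
  have h := pTop_cograph_pTop δ e.inv
  have h' := cograph_iso (δ := δ) e.symm
  simp only [Iso.symm_hom, Iso.symm_inv] at h'
  rw [h', pTop_graph_pTop] at h
  exact h

theorem cograph_pTop_graph_iso {x y : A} (e : x ≅ y) :
    cograph δ e.hom ≫ pTop δ x ≫ graph δ e.hom = pTop δ y := by
  rw [pTop_graph_iso, cograph_iso, ← Category.assoc, ← graph_comp, e.inv_hom_id, graph_id,
    Category.id_comp]

/-- Factor t → x × y through its image; the surjective part contributes the scalar ω by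
`cograph_pTop_graph_self`. -/
theorem res_span_eq_omega {t x y : A} (a : t ⟶ x) (b : t ⟶ y) [IsSurj a] [IsSurj b] :
    res δ (cograph δ a ≫ pTop δ t ≫ graph δ b) =
      omega δ (R.toSpan a b) • round δ (R.ofSpan a b) := by
  have h : cograph δ a ≫ pTop δ t ≫ graph δ b = cograph δ (R.ofSpan a b).left ≫
      (cograph δ (R.toSpan a b) ≫ pTop δ t ≫ graph δ (R.toSpan a b)) ≫
        graph δ (R.ofSpan a b).right := by
    simp only [Category.assoc]
    rw [← graph_comp, ← Category.assoc (cograph δ (R.ofSpan a b).left), ← cograph_comp,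
      R.toSpan_left, R.toSpan_right]
  rw [h, cograph_pTop_graph_self, Linear.smul_comp, Linear.comp_smul, res_smul, ← round_eq_res]

theorem round_ofSpan {t x y : A} (a : t ⟶ x) (b : t ⟶ y) [IsSurj a] [IsSurj b]
    [Mono (lift a b)] :
    round δ (R.ofSpan a b) = res δ (cograph δ a ≫ pTop δ t ≫ graph δ b) := by
  have := R.isIso_toSpan a b
  have h := cograph_pTop_graph_iso δ (asIso (R.toSpan a b))
  rw [asIso_hom] at h
  rw [round_eq_res, ← h]
  simp only [Category.assoc]
  rw [← graph_comp, ← Category.assoc, ← cograph_comp, R.toSpan_left, R.toSpan_right]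

/-- Without an idempotent at t, passing to the image costs the degree instead of ω. This accounts
for the different coefficients in the two product formulas. -/
theorem res_span_eq_deg {t x y : A} (a : t ⟶ x) (b : t ⟶ y) [IsSurj a] [IsSurj b] :
    res δ (cograph δ a ≫ graph δ b) = δ.deg (R.toSpan a b) • curly δ (R.ofSpan a b) := by
  rw [cograph_comp_graph, spanHom_eq, res_smul, curly_eq_res]
  rfl

theorem curly_ofSpan {t x y : A} (a : t ⟶ x) (b : t ⟶ y) [IsSurj a] [IsSurj b]
    [Mono (lift a b)] : curly δ (R.ofSpan a b) = res δ (cograph δ a ≫ graph δ b) := by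
  have := R.isIso_toSpan a b
  rw [res_span_eq_deg, δ.deg_iso, one_smul]

theorem curly_eq {x y : A} (r : R x y) :
    curly δ r = res δ (cograph δ r.left ≫ graph δ r.right) := by
  rw [curly_eq_res, rel_eq]
  rfl

theorem res_graph_starIncl {x y : A} (e : x ⟶ y) [IsSurj e] :
    res δ (graph δ e) ≫ starIncl δ y = starIncl δ x ≫ env δ (graph δ e) := by
  rw [res, Category.assoc, Category.assoc, starProj_starIncl_eq, ← starIncl_pTop δ x,
    Category.assoc, Category.assoc, ← env_comp, ← env_comp, pTop_graph_pTop,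
    env_comp]

theorem res_graph_starIncl_assoc {x y : A} (e : x ⟶ y) [IsSurj e]
    {Z : Envelope δ} (h : gen δ y ⟶ Z) :
    res δ (graph δ e) ≫ starIncl δ y ≫ h = starIncl δ x ≫ env δ (graph δ e) ≫ h :=
  (reassoc_of% (res_graph_starIncl δ e)) h

theorem starProj_res_cograph {x y : A} (e : x ⟶ y) [IsSurj e] :
    starProj δ y ≫ res δ (cograph δ e) = env δ (cograph δ e) ≫ starProj δ x := by
  rw [res, ← Category.assoc, starProj_starIncl_eq, ← pTop_starProj δ x, ← env_comp_assoc,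
    ← env_comp_assoc, Category.assoc, pTop_cograph_pTop, env_comp_assoc]

/-- The inclusion of `[x]^* ⊗ [y]^*` into `[x × y]`. -/
noncomputable def tIncl (x y : A) : star δ x ⊗ star δ y ⟶ gen δ (x ⊗ y) :=
  (starIncl δ x ⊗ₘ starIncl δ y) ≫ (genTensor δ x y).hom

/-- The projection of `[x × y]` onto `[x]^* ⊗ [y]^*`. -/
noncomputable def tProj (x y : A) : gen δ (x ⊗ y) ⟶ star δ x ⊗ star δ y :=
  (genTensor δ x y).inv ≫ (starProj δ x ⊗ₘ starProj δ y)

theorem tIncl_tProj (x y : A) : tIncl δ x y ≫ tProj δ x y = 𝟙 _ := by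
  rw [tIncl, tProj, Category.assoc, Iso.hom_inv_id_assoc, tensorHom_comp_tensorHom,
    starIncl_starProj, starIncl_starProj, id_tensorHom_id]

theorem tProj_tIncl (x y : A) :
    tProj δ x y ≫ tIncl δ x y = env δ (ten (pTop δ x) (pTop δ y)) := by
  rw [tIncl, tProj, Category.assoc, tensorHom_comp_tensorHom_assoc, starProj_starIncl_eq,
    starProj_starIncl_eq, genTensor_naturality, Iso.inv_hom_id_assoc]

theorem tProj_tIncl_assoc (x y : A)
    {Z : Envelope δ} (h : gen δ (x ⊗ y) ⟶ Z) :
    tProj δ x y ≫ tIncl δ x y ≫ h = env δ (ten (pTop δ x) (pTop δ y)) ≫ h :=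
  (reassoc_of% (tProj_tIncl δ x y)) h

instance (x y : A) : Mono (tIncl δ x y) := mono_of_mono_fac (tIncl_tProj δ x y)

instance (x y : A) : Epi (tProj δ x y) := epi_of_epi_fac (tIncl_tProj δ x y)

instance (x : A) : Mono (starIncl δ x) := mono_of_mono_fac (starIncl_starProj δ x)

theorem res_tensor {x y x' y' : A} (g : (⟨x⟩ : TZero δ) ⟶ ⟨y⟩) (h : (⟨x'⟩ : TZero δ) ⟶ ⟨y'⟩) :
    res δ g ⊗ₘ res δ h = tIncl δ x x' ≫ env δ (ten g h) ≫ tProj δ y y' := by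
  have e : env δ (ten g h) ≫ (genTensor δ y y').inv = (genTensor δ x x').inv ≫
      (env δ g ⊗ₘ env δ h) := by
    rw [Iso.eq_inv_comp, ← Category.assoc, Iso.comp_inv_eq, genTensor_naturality]
  rw [tIncl, tProj, reassoc_of% e, Category.assoc, Iso.hom_inv_id_assoc, tensorHom_comp_tensorHom,
    tensorHom_comp_tensorHom]
  rfl

theorem tensor_res_graph_tIncl {x y x' y' : A} (e : x ⟶ y) (e' : x' ⟶ y') [IsSurj e] [IsSurj e'] :
    (res δ (graph δ e) ⊗ₘ res δ (graph δ e')) ≫ tIncl δ y y' =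
      tIncl δ x x' ≫ env δ (graph δ (e ⊗ₘ e')) := by
  rw [tIncl, tensorHom_comp_tensorHom_assoc, res_graph_starIncl, res_graph_starIncl,
    ← tensorHom_comp_tensorHom, Category.assoc, genTensor_naturality, ten_graph, tIncl,
    Category.assoc]

theorem tProj_tensor_res_cograph {x y x' y' : A} (e : x ⟶ y) (e' : x' ⟶ y') [IsSurj e]
    [IsSurj e'] : tProj δ y y' ≫ (res δ (cograph δ e) ⊗ₘ res δ (cograph δ e')) =
      env δ (cograph δ (e ⊗ₘ e')) ≫ tProj δ x x' := by
  have h : env δ (cograph δ (e ⊗ₘ e')) ≫ (genTensor δ x x').inv =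
      (genTensor δ y y').inv ≫
        (env δ (cograph δ e) ⊗ₘ env δ (cograph δ e')) := by
    rw [Iso.eq_inv_comp, ← Category.assoc, Iso.comp_inv_eq, genTensor_naturality,
      ten_cograph]
  rw [tProj, Category.assoc, tensorHom_comp_tensorHom, starProj_res_cograph,
    starProj_res_cograph, ← tensorHom_comp_tensorHom, ← reassoc_of% h, tProj]

theorem tProj_tensor_res_cograph_assoc {x y x' y' : A} (e : x ⟶ y) (e' : x' ⟶ y') [IsSurj e]
    [IsSurj e']
    {Z : Envelope δ} (h : star δ x ⊗ star δ x' ⟶ Z) :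
    tProj δ y y' ≫ (res δ (cograph δ e) ⊗ₘ res δ (cograph δ e')) ≫ h =
      env δ (cograph δ (e ⊗ₘ e')) ≫ tProj δ x x' ≫ h :=
  (reassoc_of% (tProj_tensor_res_cograph δ e e')) h

/-- The inclusion of `[t]^*` into `[x]^* ⊗ [y]^*`. -/
noncomputable def pairIncl {t x y : A} (l : t ⟶ x ⊗ y) : star δ t ⟶ star δ x ⊗ star δ y :=
  starIncl δ t ≫ env δ (graph δ l) ≫ tProj δ x y

/-- The projection of `[x]^* ⊗ [y]^*` onto `[t]^*`. -/
noncomputable def pairProj {t x y : A} (l : t ⟶ x ⊗ y) : star δ x ⊗ star δ y ⟶ star δ t :=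
  tIncl δ x y ≫ env δ (cograph δ l) ≫ starProj δ t

section

variable {t x y : A} (l : t ⟶ x ⊗ y) [IsSurj (l ≫ fst x y)] [IsSurj (l ≫ snd x y)]

/-- The idempotent p_x^* ⊗ p_y^* hidden in `tProj δ x y ≫ tIncl δ x y` is absorbed, both legs of l
being surjective. So `pairIncl` is the honest restriction of [l], and identities about it can be
tested on graphs after the monomorphism `tIncl`. -/
theorem pairIncl_tIncl :
    pairIncl δ l ≫ tIncl δ x y = starIncl δ t ≫ env δ (graph δ l) := by
  rw [pairIncl, Category.assoc, Category.assoc, tProj_tIncl, ← starIncl_pTop δ t,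
    Category.assoc, Category.assoc, ← env_comp, ← env_comp, ← env_comp, pTop_graph_ten]

theorem pairIncl_tIncl_assoc
    {Z : Envelope δ} (h : gen δ (x ⊗ y) ⟶ Z) :
    pairIncl δ l ≫ tIncl δ x y ≫ h = starIncl δ t ≫ env δ (graph δ l) ≫ h :=
  (reassoc_of% (pairIncl_tIncl δ l)) h

theorem tProj_pairProj :
    tProj δ x y ≫ pairProj δ l = env δ (cograph δ l) ≫ starProj δ t := by
  rw [pairProj, tProj_tIncl_assoc, ← pTop_starProj δ t, ← env_comp_assoc,
    ← env_comp_assoc, ← env_comp_assoc,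
    Category.assoc, ten_cograph_pTop]

/-- Reduces orthogonality and splitting of the summands of [x]^* ⊗ [y]^* to the calculus for the
single object x × y. -/
theorem pairIncl_pairProj {s : A} (m : s ⟶ x ⊗ y) :
    pairIncl δ l ≫ pairProj δ m = res δ (graph δ l ≫ cograph δ m) := by
  rw [pairProj, pairIncl_tIncl_assoc, res, env_comp, Category.assoc]

end

theorem pairProj_pairIncl {t x y : A} (l : t ⟶ x ⊗ y) : pairProj δ l ≫ pairIncl δ l =
    tIncl δ x y ≫ env δ (cograph δ l ≫ pTop δ t ≫ graph δ l) ≫ tProj δ x y := by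
  rw [pairProj, pairIncl, env_comp, env_comp, ← starProj_starIncl_eq]
  simp only [Category.assoc]

instance isSurj_lift_fst {t x y : A} (a : t ⟶ x) (b : t ⟶ y) [h : IsSurj a] :
    IsSurj (lift a b ≫ fst x y) := by rwa [lift_fst]

instance isSurj_lift_snd {t x y : A} (a : t ⟶ x) (b : t ⟶ y) [h : IsSurj b] :
    IsSurj (lift a b ≫ snd x y) := by rwa [lift_snd]

theorem pairIncl_pairProj_of_ne {x y : A} {r s : R x y} (h : r ≠ s) :
    pairIncl δ (lift r.left r.right) ≫ pairProj δ (lift s.left s.right) = 0 := by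
  rw [pairIncl_pairProj, ← res_pTop_comp, ← res_comp_pTop, R.lift_left_right, R.lift_left_right,
    Category.assoc, Category.assoc]
  have := pTop_graph_cograph_pTop_of_ne δ (fun e => h (Subtype.ext e))
  erw [this, res_zero]

theorem sum_pairProj_pairIncl (x y : A) :
    ∑ r : R x y, pairProj δ (lift r.left r.right) ≫ pairIncl δ (lift r.left r.right) = 𝟙 _ := by
  simp only [pairProj_pairIncl]
  rw [← Preadditive.comp_sum, ← Preadditive.sum_comp]
  rw [← env_sum, ← pTop_ten_pTop, ← tProj_tIncl]
  simp only [Category.assoc, tIncl_tProj, Category.comp_id]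

end Spans

/-! ### The envelope is a system -/

section System

open TZero

variable {A : Type u} [Category.{v} A] [CartesianMonoidalCategory A] [IsRegular A]
  [SubobjectFinite A] {K : Type w} [CommRing K] (δ : DegreeFunction A K)

theorem envelope_incl_proj {x y : A} (r : R x y) :
    pairIncl δ (lift r.left r.right) ≫ pairProj δ (lift r.left r.right) = 𝟙 _ := by
  rw [pairIncl_pairProj, graph_comp_cograph_self, res_id]

theorem pairIncl_iso {t t' x y : A} (e : t ≅ t') (l : t' ⟶ x ⊗ y) :
    pairIncl δ (e.hom ≫ l) = res δ (graph δ e.hom) ≫ pairIncl δ l := by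
  rw [pairIncl, pairIncl, res_graph_starIncl_assoc, graph_comp, env_comp, Category.assoc]

theorem pairProj_iso {t t' x y : A} (e : t ≅ t') (l : t' ⟶ x ⊗ y) :
    pairProj δ (e.hom ≫ l) ≫ res δ (graph δ e.hom) = pairProj δ l := by
  have h := cograph_iso (δ := δ) e.symm
  simp only [Iso.symm_hom, Iso.symm_inv] at h
  rw [pairProj, pairProj, ← h, Category.assoc, Category.assoc, starProj_res_cograph,
    ← env_comp_assoc, ← cograph_comp, e.inv_hom_id_assoc]

/-- Tested after the monomorphism `tIncl δ x' y'`, where both sides are graphs. Besides naturality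
under isomorphisms it yields one half of the tensor formula for the round basis; the next lemma is
the transposed half. -/
theorem pairIncl_tensor_res_graph {t x y x' y' : A} (l : t ⟶ x ⊗ y) [IsSurj (l ≫ fst x y)]
    [IsSurj (l ≫ snd x y)] (f : x ⟶ x') (g : y ⟶ y') [IsSurj f] [IsSurj g] :
    pairIncl δ l ≫ (res δ (graph δ f) ⊗ₘ res δ (graph δ g)) = pairIncl δ (l ≫ (f ⊗ₘ g)) := by
  have h₁ : IsSurj ((l ≫ (f ⊗ₘ g)) ≫ fst x' y') := by
    rw [Category.assoc, tensorHom_fst, ← Category.assoc]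
    infer_instance
  have h₂ : IsSurj ((l ≫ (f ⊗ₘ g)) ≫ snd x' y') := by
    rw [Category.assoc, tensorHom_snd, ← Category.assoc]
    infer_instance
  rw [← cancel_mono (tIncl δ x' y'), Category.assoc, tensor_res_graph_tIncl, pairIncl_tIncl_assoc,
    pairIncl_tIncl, graph_comp, env_comp]

theorem tensor_res_cograph_pairProj {t x y x' y' : A} (l : t ⟶ x ⊗ y) [IsSurj (l ≫ fst x y)]
    [IsSurj (l ≫ snd x y)] (f : x ⟶ x') (g : y ⟶ y') [IsSurj f] [IsSurj g] :
    (res δ (cograph δ f) ⊗ₘ res δ (cograph δ g)) ≫ pairProj δ l = pairProj δ (l ≫ (f ⊗ₘ g)) := by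
  have h₁ : IsSurj ((l ≫ (f ⊗ₘ g)) ≫ fst x' y') := by
    rw [Category.assoc, tensorHom_fst, ← Category.assoc]
    infer_instance
  have h₂ : IsSurj ((l ≫ (f ⊗ₘ g)) ≫ snd x' y') := by
    rw [Category.assoc, tensorHom_snd, ← Category.assoc]
    infer_instance
  rw [← cancel_epi (tProj δ x' y'), tProj_tensor_res_cograph_assoc, tProj_pairProj,
    tProj_pairProj, cograph_comp, env_comp, Category.assoc]

theorem lift_comp_tensorHom {t x y x' y' : A} (a : t ⟶ x) (b : t ⟶ y) (f : x ⟶ x') (g : y ⟶ y') :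
    lift a b ≫ (f ⊗ₘ g) = lift (a ≫ f) (b ≫ g) := by
  ext <;> simp

theorem toUnit_arrow (u : Subobject (𝟙_ A)) : toUnit (u : A) = u.arrow := toUnit_unique _ _

theorem unit_orthogonal {u v : Subobject (𝟙_ A)} (h : u ≠ v) :
    res δ (graph δ (toUnit (u : A)) ≫ cograph δ (toUnit (v : A))) = 0 := by
  rw [toUnit_arrow, toUnit_arrow, ← res_pTop_comp, ← res_comp_pTop, Category.assoc,
    Category.assoc, pTop_graph_cograph_pTop_of_ne δ h, res_zero]

variable (mor : ∀ {x y : A}, R x y → (star δ x ⟶ star δ y))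

theorem envelopeData_incl {t x y : A} (a : t ⟶ x) (b : t ⟶ y) [IsSurj a] [IsSurj b]
    [Mono (lift a b)] : (envelopeData δ mor).incl a b = pairIncl δ (lift a b) := rfl

theorem envelopeData_proj {t x y : A} (a : t ⟶ x) (b : t ⟶ y) [IsSurj a] [IsSurj b]
    [Mono (lift a b)] : (envelopeData δ mor).proj a b = pairProj δ (lift a b) := by
  rw [pairProj, tIncl, Category.assoc]
  rfl

/-- The inclusion of `[u]^*` into the unit object. -/
noncomputable def unitEmb (u : A) : star δ u ⟶ 𝟙_ (Envelope δ) :=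
  starIncl δ u ≫ env δ (graph δ (toUnit u)) ≫ (genUnit δ).hom

/-- The projection of the unit object onto `[u]^*`. -/
noncomputable def unitPr (u : A) : 𝟙_ (Envelope δ) ⟶ star δ u :=
  (genUnit δ).inv ≫ env δ (cograph δ (toUnit u)) ≫ starProj δ u

theorem envelopeData_unitIncl (u : A) [Mono (toUnit u)] :
    (envelopeData δ mor).unitIncl u = unitEmb δ u := rfl

theorem envelopeData_unitProj (u : A) [Mono (toUnit u)] :
    (envelopeData δ mor).unitProj u = unitPr δ u := rfl

theorem unitEmb_unitPr (u v : A) :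
    unitEmb δ u ≫ unitPr δ v = res δ (graph δ (toUnit u) ≫ cograph δ (toUnit v)) := by
  rw [unitEmb, unitPr, Category.assoc, Category.assoc, Iso.hom_inv_id_assoc, ← env_comp_assoc]
  rfl

theorem unitPr_unitEmb (u : A) : unitPr δ u ≫ unitEmb δ u =
    (genUnit δ).inv ≫ env δ (cograph δ (toUnit u) ≫ pTop δ u ≫ graph δ (toUnit u)) ≫
      (genUnit δ).hom := by
  rw [unitEmb, unitPr, env_comp, env_comp, ← starProj_starIncl_eq]
  simp only [Category.assoc]

theorem sum_unitPr_unitEmb :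
    ∑ u : Subobject (𝟙_ A), unitPr δ (u : A) ≫ unitEmb δ (u : A) = 𝟙 (𝟙_ (Envelope δ)) := by
  simp only [unitPr_unitEmb, toUnit_arrow]
  rw [← Preadditive.comp_sum, ← Preadditive.sum_comp, ← env_sum, sum_pTop, env_id,
    Category.id_comp, Iso.inv_hom_id]

theorem unitEmb_iso {u u' : A} (e : u ≅ u') :
    unitEmb δ u = res δ (graph δ e.hom) ≫ unitEmb δ u' := by
  rw [unitEmb, unitEmb, res_graph_starIncl_assoc, ← env_comp_assoc, ← graph_comp,
    toUnit_unique (e.hom ≫ toUnit u') (toUnit u)]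

theorem unitPr_iso {u u' : A} (e : u ≅ u') :
    unitPr δ u ≫ res δ (graph δ e.hom) = unitPr δ u' := by
  have h := cograph_iso (δ := δ) e.symm
  simp only [Iso.symm_hom, Iso.symm_inv] at h
  rw [unitPr, unitPr, ← h, Category.assoc, Category.assoc, starProj_res_cograph,
    ← env_comp_assoc, ← cograph_comp, toUnit_unique (e.inv ≫ toUnit u) (toUnit u')]

/-- After embedding the target into [x × (y × z)], each side is the restriction to [w]^* of the
graph of a morphism w → x × (y × z). These two morphisms of `A` agree because p and q induce the
same morphism to y. -/
theorem envelope_associator {w r s x y z : A} (p : w ⟶ r) (q : w ⟶ s) (a : r ⟶ x) (b : r ⟶ y)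
    (c : s ⟶ y) (d : s ⟶ z) [IsSurj p] [IsSurj q] [IsSurj a] [IsSurj b] [IsSurj c] [IsSurj d]
    (h : p ≫ b = q ≫ c) :
    pairIncl δ (lift p (q ≫ d)) ≫ (pairIncl δ (lift a b) ▷ star δ z) ≫
        (α_ (star δ x) (star δ y) (star δ z)).hom =
      pairIncl δ (lift (p ≫ a) q) ≫ (star δ x ◁ pairIncl δ (lift c d)) := by
  -- J is the embedding of the target; a tensor product of split monomorphisms is split, so it can
  -- be cancelled.
  let J := (starIncl δ x ⊗ₘ tIncl δ y z) ≫ (genTensor δ x (y ⊗ z)).hom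
  have hJ : Mono J := by
    have : (starIncl δ x ⊗ₘ tIncl δ y z) ≫ (starProj δ x ⊗ₘ tProj δ y z) = 𝟙 _ := by
      rw [tensorHom_comp_tensorHom, starIncl_starProj, tIncl_tProj, id_tensorHom_id]
    have := mono_of_mono_fac this
    exact mono_comp _ _
  rw [← cancel_mono J]
  have h₁ : (α_ (star δ x) (star δ y) (star δ z)).hom ≫ J =
      (tIncl δ x y ⊗ₘ starIncl δ z) ≫ (genTensor δ (x ⊗ y) z).hom ≫
        env δ (graph δ (α_ x y z).hom) := by
    have h₂ : starIncl δ x ⊗ₘ tIncl δ y z =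
        (starIncl δ x ⊗ₘ starIncl δ y ⊗ₘ starIncl δ z) ≫ gen δ x ◁ (genTensor δ y z).hom := by
      rw [← id_tensorHom, tensorHom_comp_tensorHom, Category.comp_id]
      rfl
    have h₃ : tIncl δ x y ⊗ₘ starIncl δ z = ((starIncl δ x ⊗ₘ starIncl δ y) ⊗ₘ starIncl δ z) ≫
        (genTensor δ x y).hom ▷ gen δ z := by
      rw [← tensorHom_id, tensorHom_comp_tensorHom, Category.comp_id]
      rfl
    simp only [J]
    rw [h₂, h₃, Category.assoc, Category.assoc, genTensor_associator,
      MonoidalCategory.associator_naturality_assoc]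
  have h₄ : pairIncl δ (lift a b) ▷ star δ z ≫ (tIncl δ x y ⊗ₘ starIncl δ z) =
      (starIncl δ r ⊗ₘ starIncl δ z) ≫ (env δ (graph δ (lift a b)) ⊗ₘ env δ (graph δ (𝟙 z))) := by
    rw [← tensorHom_id, tensorHom_comp_tensorHom, tensorHom_comp_tensorHom, pairIncl_tIncl,
      graph_id, env_id, Category.id_comp, Category.comp_id]
  have h₅ : star δ x ◁ pairIncl δ (lift c d) ≫ (starIncl δ x ⊗ₘ tIncl δ y z) =
      (starIncl δ x ⊗ₘ starIncl δ s) ≫ (env δ (graph δ (𝟙 x)) ⊗ₘ env δ (graph δ (lift c d))) := by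
    rw [← id_tensorHom, tensorHom_comp_tensorHom, tensorHom_comp_tensorHom, pairIncl_tIncl,
      graph_id, env_id, Category.id_comp, Category.comp_id]
  rw [Category.assoc, Category.assoc, h₁, reassoc_of% h₄, Category.assoc]
  simp only [J]
  rw [reassoc_of% h₅, genTensor_naturality, genTensor_naturality_assoc, ten_graph, ten_graph]
  -- The only place where the compatibility of p and q over y is used.
  have h₈ : lift p (q ≫ d) ≫ (lift a b ⊗ₘ 𝟙 z) ≫ (α_ x y z).hom =
      lift (p ≫ a) q ≫ (𝟙 x ⊗ₘ lift c d) := by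
    ext <;> simp [h]
  have hT : ∀ a b : A, (starIncl δ a ⊗ₘ starIncl δ b) ≫ (genTensor δ a b).hom = tIncl δ a b :=
    fun _ _ => rfl
  rw [← Category.assoc (starIncl δ r ⊗ₘ starIncl δ z), hT,
    ← Category.assoc (starIncl δ x ⊗ₘ starIncl δ s), hT, pairIncl_tIncl_assoc,
    pairIncl_tIncl_assoc, ← env_comp, ← env_comp, ← env_comp, ← graph_comp, ← graph_comp,
    ← graph_comp, h₈]

theorem envelope_braiding [BraidedCategory A] {t x y : A} (a : t ⟶ x) (b : t ⟶ y) [IsSurj a]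
    [IsSurj b] : pairIncl δ (lift a b) ≫ (β_ (star δ x) (star δ y)).hom =
      pairIncl δ (lift b a) := by
  have h := genTensor_braiding δ x y
  have h₁ : lift a b ≫ (β_ x y).hom = lift b a := by ext <;> simp
  rw [← cancel_mono (tIncl δ y x), Category.assoc, pairIncl_tIncl]
  rw [tIncl, ← BraidedCategory.braiding_naturality_assoc, ← h, ← Category.assoc (_ ⊗ₘ _), ← tIncl,
    pairIncl_tIncl_assoc, ← env_comp, ← graph_comp, h₁]

theorem envelope_leftUnitor {u x : A} (e : x ⟶ u) [IsSurj e] :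
    pairIncl δ (lift e (𝟙 x)) ≫ (unitEmb δ u ▷ star δ x) ≫ (λ_ (star δ x)).hom = 𝟙 _ := by
  have h₁ : unitEmb δ u ▷ star δ x ≫ 𝟙_ (Envelope δ) ◁ starIncl δ x =
      (starIncl δ u ⊗ₘ starIncl δ x) ≫
        (env δ (graph δ (toUnit u)) ⊗ₘ env δ (graph δ (𝟙 x))) ≫ (genUnit δ).hom ▷ gen δ x := by
    rw [unitEmb, graph_id, env_id, ← tensorHom_id, ← id_tensorHom, ← tensorHom_id,
      tensorHom_comp_tensorHom, tensorHom_comp_tensorHom, tensorHom_comp_tensorHom]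
    simp only [Category.id_comp, Category.comp_id]
  have h₂ : lift e (𝟙 x) ≫ (toUnit u ⊗ₘ 𝟙 x) ≫ (λ_ x).hom = 𝟙 x := by simp
  have h₃ : unitEmb δ u ▷ star δ x ≫ 𝟙_ (Envelope δ) ◁ starIncl δ x ≫ (λ_ (gen δ x)).hom =
      tIncl δ u x ≫ env δ (graph δ ((toUnit u ⊗ₘ 𝟙 x) ≫ (λ_ x).hom)) := by
    have h₄ := genTensor_naturality δ (graph δ (toUnit u))
      (graph δ (𝟙 x))
    rw [ten_graph] at h₄
    calc _ = ((starIncl δ u ⊗ₘ starIncl δ x) ≫ (env δ (graph δ (toUnit u)) ⊗ₘ env δ (graph δ (𝟙 x))) ≫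
        (genUnit δ).hom ▷ gen δ x) ≫ (λ_ (gen δ x)).hom := by rw [← h₁, Category.assoc]
      _ = (starIncl δ u ⊗ₘ starIncl δ x) ≫ (env δ (graph δ (toUnit u)) ⊗ₘ env δ (graph δ (𝟙 x))) ≫
        (genUnit δ).hom ▷ gen δ x ≫ (λ_ (gen δ x)).hom := by simp only [Category.assoc]
      _ = (starIncl δ u ⊗ₘ starIncl δ x) ≫ ((env δ (graph δ (toUnit u)) ⊗ₘ env δ (graph δ (𝟙 x))) ≫
        (genTensor δ _ _).hom) ≫ env δ (graph δ (λ_ x).hom) := by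
          rw [genTensor_leftUnitor, Category.assoc]
      _ = _ := by
          rw [h₄, tIncl, graph_comp, env_comp]
          simp only [Category.assoc]
  rw [← cancel_mono (starIncl δ x), Category.assoc, Category.assoc,
    ← MonoidalCategory.leftUnitor_naturality, h₃, pairIncl_tIncl_assoc, ← env_comp, ← graph_comp,
    h₂, graph_id, env_id, Category.id_comp]
  exact Category.comp_id _

theorem envelope_rightUnitor {u x : A} (e : x ⟶ u) [IsSurj e] :
    pairIncl δ (lift (𝟙 x) e) ≫ (star δ x ◁ unitEmb δ u) ≫ (ρ_ (star δ x)).hom = 𝟙 _ := by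
  have h₁ : star δ x ◁ unitEmb δ u ≫ starIncl δ x ▷ 𝟙_ (Envelope δ) =
      (starIncl δ x ⊗ₘ starIncl δ u) ≫
        (env δ (graph δ (𝟙 x)) ⊗ₘ env δ (graph δ (toUnit u))) ≫ gen δ x ◁ (genUnit δ).hom := by
    rw [unitEmb, graph_id, env_id, ← tensorHom_id, ← id_tensorHom, ← id_tensorHom,
      tensorHom_comp_tensorHom, tensorHom_comp_tensorHom, tensorHom_comp_tensorHom]
    simp only [Category.id_comp, Category.comp_id]
  have h₂ : lift (𝟙 x) e ≫ (𝟙 x ⊗ₘ toUnit u) ≫ (ρ_ x).hom = 𝟙 x := by simp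
  have h₃ : star δ x ◁ unitEmb δ u ≫ starIncl δ x ▷ 𝟙_ (Envelope δ) ≫ (ρ_ (gen δ x)).hom =
      tIncl δ x u ≫ env δ (graph δ ((𝟙 x ⊗ₘ toUnit u) ≫ (ρ_ x).hom)) := by
    have h₄ := genTensor_naturality δ (graph δ (𝟙 x))
      (graph δ (toUnit u))
    rw [ten_graph] at h₄
    calc _ = ((starIncl δ x ⊗ₘ starIncl δ u) ≫ (env δ (graph δ (𝟙 x)) ⊗ₘ env δ (graph δ (toUnit u))) ≫
        gen δ x ◁ (genUnit δ).hom) ≫ (ρ_ (gen δ x)).hom := by rw [← h₁, Category.assoc]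
      _ = (starIncl δ x ⊗ₘ starIncl δ u) ≫ (env δ (graph δ (𝟙 x)) ⊗ₘ env δ (graph δ (toUnit u))) ≫
        gen δ x ◁ (genUnit δ).hom ≫ (ρ_ (gen δ x)).hom := by simp only [Category.assoc]
      _ = (starIncl δ x ⊗ₘ starIncl δ u) ≫ ((env δ (graph δ (𝟙 x)) ⊗ₘ env δ (graph δ (toUnit u))) ≫
        (genTensor δ _ _).hom) ≫ env δ (graph δ (ρ_ x).hom) := by
          rw [genTensor_rightUnitor, Category.assoc]
      _ = _ := by
          rw [h₄, tIncl, graph_comp, env_comp]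
          simp only [Category.assoc]
  rw [← cancel_mono (starIncl δ x), Category.assoc, Category.assoc,
    ← MonoidalCategory.rightUnitor_naturality, h₃, pairIncl_tIncl_assoc, ← env_comp, ← graph_comp,
    h₂, graph_id, env_id, Category.id_comp]
  exact Category.comp_id _

theorem sum_gen (x : A) : ∑ u : Subobject x,
    (env δ (cograph δ u.arrow) ≫ starProj δ (u : A)) ≫ starIncl δ (u : A) ≫
      env δ (graph δ u.arrow) = 𝟙 (gen δ x) := by
  rw [← env_id, ← sum_pTop, env_sum]
  refine Finset.sum_congr rfl fun u _ => ?_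
  rw [env_comp, env_comp, ← starProj_starIncl_eq]
  simp only [Category.assoc]

/-- An object whose identity factors through a finite sum is a retract of the sum. -/
theorem exists_retract_of_sum {D : Type u₁} [Category.{v₁} D] [Preadditive D]
    [HasFiniteBiproducts D] {I : Type*} (F : I → D) {J : Type} [Fintype J] (x : J → I) (X : D)
    (s : ∀ j, X ⟶ F (x j)) (r : ∀ j, F (x j) ⟶ X) (h : ∑ j, s j ≫ r j = 𝟙 X) :
    ∃ (n : ℕ) (y : Fin n → I), Nonempty (Retract X (⨁ fun i => F (y i))) := by
  let e := (Fintype.equivFin J).symm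
  refine ⟨Fintype.card J, fun i => x (e i), ⟨⟨biproduct.lift fun i => s (e i),
    biproduct.desc fun i => r (e i), ?_⟩⟩⟩
  rw [biproduct.lift_desc, ← h]
  exact Equiv.sum_comp e fun j => s j ≫ r j

theorem mat_sum_apply {C : Type u₁} [Category.{v₁} C] [Preadditive C] {M N : Mat_ C} {ι : Type*}
    (s : Finset ι) (f : ι → (M ⟶ N)) (i : M.ι) (j : N.ι) :
    (∑ k ∈ s, f k) i j = ∑ k ∈ s, f k i j :=
  map_sum (AddMonoidHom.mk' (fun f : M ⟶ N => f i j) fun _ _ => rfl) f s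

theorem karoubi_sum_f {C : Type u₁} [Category.{v₁} C] [Preadditive C] {P Q : Karoubi C} {ι : Type*}
    (s : Finset ι) (f : ι → (P ⟶ Q)) : (∑ k ∈ s, f k).f = ∑ k ∈ s, (f k).f :=
  map_sum (Karoubi.inclusionHom P Q) f s

/-- The identity of an object of the envelope factors through a finite sum of the `[x]`. -/
theorem exists_gen_sum (X : Envelope δ) : ∃ (x : X.X.ι → A) (s : ∀ i, X ⟶ gen δ (x i))
    (r : ∀ i, gen δ (x i) ⟶ X), ∑ i, s i ≫ r i = 𝟙 X := by
  have hp : ∀ j k, ∑ i, X.p j i ≫ X.p i k = X.p j k := fun j k => by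
    rw [← Mat_.comp_apply, X.idem]
  -- The i-th column and the i-th row of the idempotent matrix: the products sum up to its square,
  -- which is the identity of X in the Karoubi envelope.
  refine ⟨fun i => (X.X.X i).obj, fun i => ⟨fun j _ => X.p j i, ?_⟩,
    fun i => ⟨fun _ j => X.p i j, ?_⟩, ?_⟩
  · erw [Category.comp_id]
    ext j k
    exact hp j i
  · erw [Category.id_comp]
    ext j k
    exact hp i k
  · ext : 1
    rw [karoubi_sum_f]
    ext j k
    rw [mat_sum_apply]
    refine Eq.trans (Finset.sum_congr rfl fun i _ => ?_) (hp j k)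
    exact Fintype.sum_unique (ι := PUnit) (fun _ => X.p j i ≫ X.p i k)

theorem envelope_generate (X : Envelope δ) :
    ∃ (n : ℕ) (x : Fin n → A), Nonempty (Retract X (⨁ fun i => star δ (x i))) := by
  obtain ⟨x, s, r, h⟩ := exists_gen_sum δ X
  -- The subobjects are numbered by `Fin` because `exists_retract_of_sum` takes its index set in
  -- `Type`.
  refine exists_retract_of_sum (star δ) (J := Σ i, Fin (Fintype.card (Subobject (x i))))
    (fun j => (((Fintype.equivFin (Subobject (x j.1))).symm j.2 : Subobject (x j.1)) : A)) X
    (fun j => s j.1 ≫ env δ (cograph δ (Subobject.arrow _)) ≫ starProj δ _)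
    (fun j => starIncl δ _ ≫ env δ (graph δ (Subobject.arrow _)) ≫ r j.1) ?_
  rw [← h, Fintype.sum_sigma]
  refine Finset.sum_congr rfl fun i _ => ?_
  rw [← Category.id_comp (r i), ← sum_gen, Preadditive.sum_comp, Preadditive.comp_sum,
    ← Equiv.sum_comp (Fintype.equivFin (Subobject (x i))).symm]
  exact Finset.sum_congr rfl fun u _ => by simp only [Category.assoc]

end System

/-- The index type is in an arbitrary universe so that it can be `Subobject x`. -/
theorem biproduct_lift_desc {C : Type u₁} [Category.{v₁} C] [Preadditive C] {J : Type w} [Fintype J]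
    {f : J → C} [HasBiproduct f] {T U : C} (g : ∀ j, T ⟶ f j) (h : ∀ j, f j ⟶ U) :
    biproduct.lift g ≫ biproduct.desc h = ∑ j : J, g j ≫ h j := by
  classical
  have e : biproduct.lift g = ∑ j, g j ≫ biproduct.ι f j := by
    refine biproduct.hom_ext _ _ fun j => ?_
    simp only [Preadditive.sum_comp, biproduct.ι_π, comp_dite, biproduct.lift_π, Category.assoc,
      comp_zero, Finset.sum_dite_eq', Finset.mem_univ, eqToHom_refl, Category.comp_id, if_true]
  simp only [e, Preadditive.sum_comp, Category.assoc, biproduct.ι_desc]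

/-! ### The round and the curly family satisfy the axioms and the formulas -/

section EnvelopeSystem

open TZero

variable {A : Type u} [Category.{v} A] [CartesianMonoidalCategory A] [IsRegular A]
  [SubobjectFinite A] {K : Type w} [CommRing K] (δ : DegreeFunction A K)

theorem pairProj_natural {t x y x' y' : A} (a : t ⟶ x) (b : t ⟶ y) [IsSurj a] [IsSurj b]
    (f : x ≅ x') (g : y ≅ y') : (res δ (graph δ f.hom) ⊗ₘ res δ (graph δ g.hom)) ≫
      pairProj δ (lift a b ≫ (f.hom ⊗ₘ g.hom)) = pairProj δ (lift a b) := by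
  rw [← tensor_res_cograph_pairProj, tensorHom_comp_tensorHom_assoc, res_graph_comp,
    res_graph_comp, graph_comp_cograph_self, graph_comp_cograph_self, res_id, res_id,
    id_tensorHom_id, Category.id_comp]

/-- Isolates what depends on the choice of basis: the basis property, the value at graphs of
isomorphisms, and naturality. All other axioms involve the family only through `isoMor`. -/
theorem envelopeData_isSystem [BraidedCategory A] (mor : ∀ {x y : A}, R x y → (star δ x ⟶ star δ y))
    (hb : ∀ x y : A, ∃ b : Module.Basis (R x y) K (star δ x ⟶ star δ y), ∀ r, b r = mor r)
    (hiso : ∀ {x y : A} (f : x ≅ y), mor (R.ofSpan (𝟙 x) f.hom) = res δ (graph δ f.hom))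
    (hnat : ∀ {x y x' y' : A} (f : x ≅ x') (g : y ≅ y') (r : R x y),
      res δ (graph δ f.hom) ≫ mor (R.ofSpan (r.left ≫ f.hom) (r.right ≫ g.hom)) =
        mor r ≫ res δ (graph δ g.hom)) : (envelopeData δ mor).IsSystem K := by
  have hi : ∀ {x y : A} (f : x ≅ y), (envelopeData δ mor).isoMor f = res δ (graph δ f.hom) := hiso
  constructor
  · exact envelope_generate δ
  · exact hb
  · intro x
    rw [hi, Iso.refl_hom, graph_id, res_id]
    rfl
  · intro x y z f g
    rw [hi, hi, hi, Iso.trans_hom, graph_comp]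
    exact (res_graph_comp δ _ _).symm
  · intro x y x' y' f g r
    rw [hi, hi]
    exact hnat f g r
  · intro x y r
    rw [envelopeData_incl, envelopeData_proj]
    exact envelope_incl_proj δ r
  · intro x y r s h
    rw [envelopeData_incl, envelopeData_proj]
    exact pairIncl_pairProj_of_ne δ h
  · intro x y
    simp only [envelopeData_incl, envelopeData_proj]
    exact sum_pairProj_pairIncl δ x y
  · intro t t' x y e a b _ _ _ _
    rw [envelopeData_incl, envelopeData_incl, hi, ← comp_lift]
    exact pairIncl_iso δ e _
  · intro t t' x y e a b _ _ _ _
    rw [envelopeData_proj, envelopeData_proj, hi, ← comp_lift]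
    exact pairProj_iso δ e _
  · intro t x y x' y' a b _ _ _ f g _
    rw [envelopeData_incl, envelopeData_incl, hi, hi, ← lift_comp_tensorHom]
    exact (pairIncl_tensor_res_graph δ (lift a b) f.hom g.hom).symm
  · intro t x y x' y' a b _ _ _ f g _
    rw [envelopeData_proj, envelopeData_proj, hi, hi, ← lift_comp_tensorHom]
    exact pairProj_natural δ a b f g
  · intro u
    rw [envelopeData_unitIncl, envelopeData_unitProj]
    refine (unitEmb_unitPr δ _ _).trans ?_
    rw [graph_comp_cograph_self, res_id]
    rfl
  · intro u v h
    rw [envelopeData_unitIncl, envelopeData_unitProj]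
    exact (unitEmb_unitPr δ _ _).trans (unit_orthogonal δ h)
  · simp only [envelopeData_unitIncl, envelopeData_unitProj]
    exact sum_unitPr_unitEmb δ
  · intro u u' e _ _
    rw [hi]
    exact unitEmb_iso δ e
  · intro u u' e _ _
    rw [hi]
    exact unitPr_iso δ e
  · intro w r s x y z p q a b c d _ _ _ _ _ _ _ _ _ _ h
    exact envelope_associator δ p q a b c d h
  · intro t x y a b _ _ _ _
    exact envelope_braiding δ a b
  · intro u x e _ _
    exact envelope_leftUnitor δ e
  · intro u x e _ _
    exact envelope_rightUnitor δ e

theorem round_iso {x y : A} (f : x ≅ y) :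
    round δ (R.ofSpan (𝟙 x) f.hom) = res δ (graph δ f.hom) := by
  rw [round_ofSpan, cograph_id, Category.id_comp, res_pTop_comp]

theorem curly_iso {x y : A} (f : x ≅ y) :
    curly δ (R.ofSpan (𝟙 x) f.hom) = res δ (graph δ f.hom) := by
  rw [curly_ofSpan, cograph_id, Category.id_comp]

instance mono_lift_comp_iso {t x y x' y' : A} (a : t ⟶ x) (b : t ⟶ y) [Mono (lift a b)]
    (f : x ≅ x') (g : y ≅ y') : Mono (lift (a ≫ f.hom) (b ≫ g.hom)) := by
  rw [← lift_comp_tensorHom]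
  exact mono_comp _ _

theorem graph_cograph_comp_iso {t x x' : A} (f : x ≅ x') (a : t ⟶ x) :
    graph δ f.hom ≫ cograph δ (a ≫ f.hom) = cograph δ a := by
  rw [cograph_comp, graph_comp_cograph_self_assoc]

theorem round_natural {x y x' y' : A} (f : x ≅ x') (g : y ≅ y') (r : R x y) :
    res δ (graph δ f.hom) ≫ round δ (R.ofSpan (r.left ≫ f.hom) (r.right ≫ g.hom)) =
      round δ r ≫ res δ (graph δ g.hom) := by
  have h := pTop_graph_pTop δ r.right
  rw [round_ofSpan, res_graph_comp, reassoc_of% (graph_cograph_comp_iso δ f r.left), graph_comp,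
    round_eq_res, res_comp, Category.assoc, Category.assoc, reassoc_of% h]

theorem curly_natural {x y x' y' : A} (f : x ≅ x') (g : y ≅ y') (r : R x y) :
    res δ (graph δ f.hom) ≫ curly δ (R.ofSpan (r.left ≫ f.hom) (r.right ≫ g.hom)) =
      curly δ r ≫ res δ (graph δ g.hom) := by
  rw [curly_ofSpan, res_graph_comp, reassoc_of% (graph_cograph_comp_iso δ f r.left), graph_comp,
    curly_eq, res_comp, pTop_graph_iso, ← Category.assoc, ← Category.assoc, res_comp_pTop,
    Category.assoc]

theorem roundData_isSystem [BraidedCategory A] : (roundData δ).IsSystem K :=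
  envelopeData_isSystem δ (round δ) (round_basis δ) (round_iso δ) (round_natural δ)

theorem curlyData_isSystem [BraidedCategory A] : (curlyData δ).IsSystem K :=
  envelopeData_isSystem δ (curly δ) (curly_basis δ) (curly_iso δ) (curly_natural δ)

open scoped Classical in
-- The middle p_y^* is absorbed, leaving the morphism [r]^* → [s]^* expanded by
-- `pTop_graph_cograph_pTop`. Each u then gives a span from x to z, and passing to its image costs
-- ω.
theorem round_comp {x y z : A} (r : R x y) (s : R y z) :
    round δ r ≫ round δ s = ∑ u : R r.obj s.obj with u.left ≫ r.right = u.right ≫ s.left,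
      omega δ (R.toSpan (u.left ≫ r.left) (u.right ≫ s.right)) •
        round δ (R.ofSpan (u.left ≫ r.left) (u.right ≫ s.right)) := by
  have h := pTop_graph_pTop δ r.right
  have h' : (cograph δ r.left ≫ pTop δ r.obj ≫ graph δ r.right) ≫ pTop δ y ≫
      cograph δ s.left ≫ pTop δ s.obj ≫ graph δ s.right = cograph δ r.left ≫
        (pTop δ r.obj ≫ graph δ r.right ≫ cograph δ s.left ≫ pTop δ s.obj) ≫
          graph δ s.right := by
    simp only [Category.assoc]
    rw [reassoc_of% h]
  rw [round_eq_res, round_eq_res, res_comp, h', pTop_graph_cograph_pTop, Preadditive.sum_comp,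
    Preadditive.comp_sum, res_sum]
  refine Finset.sum_congr rfl fun u _ => ?_
  rw [← res_span_eq_omega, cograph_comp, graph_comp]
  simp only [Category.assoc]

/-- (r) factors through [r]^*. This factorization makes its tensor products computable. -/
theorem round_eq_comp {x y : A} (r : R x y) :
    round δ r = res δ (cograph δ r.left) ≫ res δ (graph δ r.right) := by
  rw [round_eq_res, res_comp]

theorem round_ofSpan_eq_comp {t x y : A} (a : t ⟶ x) (b : t ⟶ y) [IsSurj a] [IsSurj b]
    [Mono (lift a b)] :
    round δ (R.ofSpan a b) = res δ (cograph δ a) ≫ res δ (graph δ b) := by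
  rw [round_ofSpan, res_comp]

theorem toSpan_lift {t x y : A} (a : t ⟶ x) (b : t ⟶ y) [IsSurj a] [IsSurj b] :
    R.toSpan a b ≫ lift (R.ofSpan a b).left (R.ofSpan a b).right = lift a b := by
  rw [comp_lift, R.toSpan_left, R.toSpan_right]

/-- A morphism to w is determined by its components in x, y, x' and y', and these can be read off
from r_w and r'_w. -/
theorem mono_lift_toSpan {x y x' y' : A} (r : R x y) (r' : R x' y') (w : R r.obj r'.obj) :
    Mono (lift (R.toSpan (w.left ≫ r.left) (w.right ≫ r'.left))
      (R.toSpan (w.left ≫ r.right) (w.right ≫ r'.right))) where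
  right_cancellation k l h := by
    have h₁ := h =≫ fst _ _
    have h₂ := h =≫ snd _ _
    simp only [Category.assoc, lift_fst, lift_snd] at h₁ h₂
    have e₁ := h₁ =≫ (R.ofSpan (w.left ≫ r.left) (w.right ≫ r'.left)).left
    have e₂ := h₁ =≫ (R.ofSpan (w.left ≫ r.left) (w.right ≫ r'.left)).right
    have e₃ := h₂ =≫ (R.ofSpan (w.left ≫ r.right) (w.right ≫ r'.right)).left
    have e₄ := h₂ =≫ (R.ofSpan (w.left ≫ r.right) (w.right ≫ r'.right)).right
    simp only [Category.assoc, R.toSpan_left, R.toSpan_right] at e₁ e₂ e₃ e₄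
    rw [← cancel_mono (lift w.left w.right)]
    apply CartesianMonoidalCategory.hom_ext
    · rw [← cancel_mono (lift r.left r.right)]
      apply CartesianMonoidalCategory.hom_ext <;>
        simpa only [Category.assoc, lift_fst, lift_snd]
    · rw [← cancel_mono (lift r'.left r'.right)]
      apply CartesianMonoidalCategory.hom_ext <;>
        simpa only [Category.assoc, lift_fst, lift_snd]

/-- By `round_eq_comp` the tensor product passes through [r]^* ⊗ [r']^*, where the decomposition
into the [w]^* is inserted. On the summand w the transposed half factors through r_w and the other
half through r'_w, and what remains between them is (w). -/
theorem round_tensor {x y x' y' : A} (r : R x y) (r' : R x' y') :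
    round δ r ⊗ₘ round δ r' = ∑ w : R r.obj r'.obj,
      pairProj δ (lift (R.ofSpan (w.left ≫ r.left) (w.right ≫ r'.left)).left
          (R.ofSpan (w.left ≫ r.left) (w.right ≫ r'.left)).right) ≫
        round δ (R.ofSpan (R.toSpan (w.left ≫ r.left) (w.right ≫ r'.left))
          (R.toSpan (w.left ≫ r.right) (w.right ≫ r'.right))) ≫
        pairIncl δ (lift (R.ofSpan (w.left ≫ r.right) (w.right ≫ r'.right)).left
          (R.ofSpan (w.left ≫ r.right) (w.right ≫ r'.right)).right) := by
  have hc : ∀ {t s x y : A} (e : t ⟶ s) [IsSurj e] (l : s ⟶ x ⊗ y),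
      pairProj δ l ≫ res δ (cograph δ e) = pairProj δ (e ≫ l) := by
    intro t s x y e _ l
    rw [pairProj, pairProj, Category.assoc, Category.assoc, starProj_res_cograph, cograph_comp,
      env_comp_assoc]
  have hg : ∀ {t s x y : A} (e : t ⟶ s) [IsSurj e] (l : s ⟶ x ⊗ y),
      res δ (graph δ e) ≫ pairIncl δ l = pairIncl δ (e ≫ l) := by
    intro t s x y e _ l
    rw [pairIncl, pairIncl, res_graph_starIncl_assoc, graph_comp, env_comp_assoc]
  rw [round_eq_comp, round_eq_comp, ← tensorHom_comp_tensorHom,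
    ← Category.id_comp (res δ (graph δ r.right) ⊗ₘ _), ← sum_pairProj_pairIncl,
    Preadditive.sum_comp, Preadditive.comp_sum]
  refine Finset.sum_congr rfl fun w _ => ?_
  have := mono_lift_toSpan r r' w
  have h₁ := tensor_res_cograph_pairProj δ (lift w.left w.right) r.left r'.left
  have h₂ := pairIncl_tensor_res_graph δ (lift w.left w.right) r.right r'.right
  rw [lift_comp_tensorHom, ← toSpan_lift (w.left ≫ r.left) (w.right ≫ r'.left), ← hc] at h₁
  rw [lift_comp_tensorHom, ← toSpan_lift (w.left ≫ r.right) (w.right ≫ r'.right), ← hg] at h₂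
  rw [round_ofSpan_eq_comp]
  calc _ = ((res δ (cograph δ r.left) ⊗ₘ res δ (cograph δ r'.left)) ≫
        pairProj δ (lift w.left w.right)) ≫ pairIncl δ (lift w.left w.right) ≫
          (res δ (graph δ r.right) ⊗ₘ res δ (graph δ r'.right)) := by simp only [Category.assoc]
    _ = _ := by
      rw [h₁, h₂]
      simp only [Category.assoc]

theorem roundData_roundLaws : (roundData δ).RoundLaws δ where
  comp r s := round_comp δ r s
  tensor r r' := by
    refine (round_tensor δ r r').trans (Finset.sum_congr rfl fun w _ => ?_)
    exact congrArg (· ≫ _) (envelopeData_proj δ (round δ) _ _).symm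

theorem zsmul_smul_eq {x y : A} (n : ℤ) (c : K) (f : star δ x ⟶ star δ y) :
    n • c • f = ((n : K) * c) • f := by
  rw [mul_smul, Int.cast_smul_eq_zsmul]

open scoped Classical in
-- Expand the middle p_y^* into the p_{y'} and apply base change. A term whose legs onto x and z are
-- surjective is a degree times a basis element; the other terms are killed by p_x^* or p_z^*.
theorem curly_comp {x y z : A} (r : R x y) (s : R y z) :
    curly δ r ≫ curly δ s = ∑ y' : Subobject y,
      if h : IsSurj (pullback.fst r.right y'.arrow ≫ r.left) ∧
          IsSurj (pullback.snd y'.arrow s.left ≫ s.right) then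
        have := h.1
        have := h.2
        ((mu y' ⊤ : K) * δ.deg (R.toSpan (SubobjectData.tripleLeft r s y')
          (SubobjectData.tripleRight r s y'))) •
          curly δ (R.ofSpan (SubobjectData.tripleLeft r s y') (SubobjectData.tripleRight r s y'))
      else 0 := by
  rw [curly_eq, curly_eq, res_comp, pTop_eq_sum, Preadditive.sum_comp, Preadditive.comp_sum,
    res_sum]
  refine Finset.sum_congr rfl fun y' _ => ?_
  -- Two base changes produce r ×_y y' and y' ×_y s. The third, to the triple product, is postponed,
  -- since the surjectivity conditions concern these two legs.
  have key : (cograph δ r.left ≫ graph δ r.right) ≫ pSub δ y' ≫ cograph δ s.left ≫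
      graph δ s.right = cograph δ (pullback.fst r.right y'.arrow ≫ r.left) ≫
        (graph δ (pullback.snd r.right y'.arrow) ≫ cograph δ (pullback.fst y'.arrow s.left)) ≫
          graph δ (pullback.snd y'.arrow s.left ≫ s.right) := by
    have h₁ := graph_comp_cograph δ (IsPullback.of_hasPullback r.right y'.arrow)
    have h₂ := graph_comp_cograph δ (IsPullback.of_hasPullback y'.arrow s.left)
    rw [pSub, cograph_comp, graph_comp]
    simp only [Category.assoc]
    rw [reassoc_of% h₁, reassoc_of% h₂]
  rw [Preadditive.zsmul_comp, Preadditive.comp_zsmul, res_zsmul, key]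
  split_ifs with h
  · have := h.1
    have := h.2
    have h₃ := graph_comp_cograph δ (IsPullback.of_hasPullback (pullback.snd r.right y'.arrow)
      (pullback.fst y'.arrow s.left))
    have h₄ : cograph δ (pullback.fst r.right y'.arrow ≫ r.left) ≫
        (graph δ (pullback.snd r.right y'.arrow) ≫ cograph δ (pullback.fst y'.arrow s.left)) ≫
          graph δ (pullback.snd y'.arrow s.left ≫ s.right) =
        cograph δ (SubobjectData.tripleLeft r s y') ≫
          graph δ (SubobjectData.tripleRight r s y') := by
      rw [h₃, SubobjectData.tripleLeft, SubobjectData.tripleRight, cograph_comp δ (pullback.fst _ _)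
        (pullback.fst _ _ ≫ _), graph_comp (pullback.snd _ _) (pullback.snd _ _ ≫ _)]
      simp only [Category.assoc]
    rw [h₄, res_span_eq_deg, zsmul_smul_eq]
  · rw [not_and_or] at h
    obtain h | h := h
    · rw [← res_pTop_comp, ← Category.assoc, pTop_comp_cograph_eq_zero δ _ h, zero_comp, res_zero,
        smul_zero]
    · rw [← res_comp_pTop, Category.assoc, Category.assoc, graph_comp_pTop_eq_zero δ _ h,
        comp_zero, comp_zero, res_zero, smul_zero]

theorem ten_rel {x y x' y' : A} (r : R x y) (r' : R x' y') : ten (rel δ r.1) (rel δ r'.1) =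
    cograph δ (r.left ⊗ₘ r'.left) ≫ graph δ (r.right ⊗ₘ r'.right) := by
  rw [rel_eq, rel_eq, ten_comp, ten_cograph, ten_graph]
  rfl

theorem res_comp₃ {x y : A} {Y Z : TZero δ} (f : (⟨x⟩ : TZero δ) ⟶ Y) (g : Y ⟶ Z)
    (h : Z ⟶ (⟨y⟩ : TZero δ)) :
    res δ (f ≫ g ≫ h) = starIncl δ x ≫ env δ f ≫ env δ g ≫ env δ h ≫ starProj δ y := by
  rw [res, env_comp, env_comp, Category.assoc, Category.assoc]

/-- The component of `{r} ⊗ {r'}` between the summands given by `u` and `v`. -/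
noncomputable def curlyComponent {x y x' y' : A} (r : R x y) (r' : R x' y') (u : R x x')
    (v : R y y') : star δ u.obj ⟶ star δ v.obj :=
  res δ (x := u.obj) (y := v.obj) (graph δ u.1.arrow ≫ (cograph δ (r.left ⊗ₘ r'.left) ≫
    graph δ (r.right ⊗ₘ r'.right)) ≫ cograph δ v.1.arrow)

/-- Insert the decompositions of source and target; a component is the relation r × r' restricted to
u and v. -/
theorem curly_tensor {x y x' y' : A} (r : R x y) (r' : R x' y') :
    curly δ r ⊗ₘ curly δ r' = ∑ u : R x x', ∑ v : R y y', pairProj δ (lift u.left u.right) ≫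
      curlyComponent δ r r' u v ≫ pairIncl δ (lift v.left v.right) := by
  have h : ∀ (u : R x x') (v : R y y'), pairIncl δ (lift u.left u.right) ≫
      (curly δ r ⊗ₘ curly δ r') ≫ pairProj δ (lift v.left v.right) =
      curlyComponent δ r r' u v := by
    intro u v
    rw [curly_eq_res, curly_eq_res, res_tensor, Category.assoc, Category.assoc, tProj_pairProj,
      pairIncl_tIncl_assoc, R.lift_left_right, R.lift_left_right, ten_rel]
    exact (res_comp₃ δ (x := u.obj) (y := v.obj) _ _ _).symm
  rw [← Category.id_comp (curly δ r ⊗ₘ curly δ r'), ← sum_pairProj_pairIncl δ x x',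
    Preadditive.sum_comp]
  refine Finset.sum_congr rfl fun u _ => ?_
  rw [← Category.comp_id (curly δ r ⊗ₘ curly δ r'), ← sum_pairProj_pairIncl δ y y',
    Preadditive.comp_sum, Preadditive.comp_sum]
  refine Finset.sum_congr rfl fun v _ => ?_
  rw [← h]
  simp only [Category.assoc]

/-- The convention that `extMor` is zero for a non-surjective leg agrees with the calculus, as the
idempotents kill such spans. -/
theorem curly_extMor {t x y : A} (a : t ⟶ x) (b : t ⟶ y) (hm : Mono (lift a b)) :
    (curlyData δ).extMor a b = res δ (cograph δ a ≫ graph δ b) := by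
  unfold SubobjectData.extMor
  split_ifs with hs
  · have h₁ := hs.1
    have h₂ := hs.2
    exact curly_ofSpan δ _ _
  · symm
    rw [not_and_or] at hs
    obtain hs | hs := hs
    · rw [← res_pTop_comp, ← Category.assoc, pTop_comp_cograph_eq_zero δ _ hs, zero_comp]
      exact res_zero δ _ _
    · rw [← res_comp_pTop, Category.assoc, graph_comp_pTop_eq_zero δ _ hs, comp_zero]
      exact res_zero δ _ _

open scoped Classical in
theorem curly_tensor_coeff {x y x' y' : A} (r : R x y) (r' : R x' y') (u : R x x') (v : R y y') :
    curlyComponent δ r r' u v =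
      if _h : HasPullback u.1.arrow (r.left ⊗ₘ r'.left) then
        if _h' : HasPullback (pullback.snd u.1.arrow (r.left ⊗ₘ r'.left) ≫ (r.right ⊗ₘ r'.right))
            v.1.arrow then
          (curlyData δ).extMor (t := pullback (pullback.snd u.1.arrow (r.left ⊗ₘ r'.left) ≫
                (r.right ⊗ₘ r'.right)) v.1.arrow) (x := u.obj) (y := v.obj)
              (pullback.fst _ _ ≫ pullback.fst _ _) (pullback.snd _ _)
        else 0
      else 0 := by
  -- The first pullback always exists, one of its legs being surjective. Only the second may fail to
  -- exist, and then the composition is zero.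
  have hP : HasPullback u.1.arrow (r.left ⊗ₘ r'.left) := inferInstance
  have H := IsPullback.of_hasPullback u.1.arrow (r.left ⊗ₘ r'.left)
  have key : graph δ u.1.arrow ≫ (cograph δ (r.left ⊗ₘ r'.left) ≫ graph δ (r.right ⊗ₘ r'.right)) ≫
      cograph δ v.1.arrow = cograph δ (pullback.fst u.1.arrow (r.left ⊗ₘ r'.left)) ≫
        graph δ (pullback.snd u.1.arrow (r.left ⊗ₘ r'.left) ≫ (r.right ⊗ₘ r'.right)) ≫
          cograph δ v.1.arrow := by
    have h₁ := graph_comp_cograph δ H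
    simp only [Category.assoc]
    rw [reassoc_of% h₁, graph_comp, Category.assoc]
  rw [dif_pos hP]
  refine (congrArg (res δ (x := u.obj) (y := v.obj)) key).trans ?_
  split_ifs with h'
  · have H' := IsPullback.of_hasPullback (pullback.snd u.1.arrow (r.left ⊗ₘ r'.left) ≫
      (r.right ⊗ₘ r'.right)) v.1.arrow
    rw [graph_comp_cograph δ H', ← Category.assoc, ← cograph_comp]
    -- The iterated pullback is a relation between u and v: its component in r × r' is determined by
    -- the images in x × x' and y × y', hence by those in u and v.
    have hm : Mono (lift (pullback.fst (pullback.snd u.1.arrow (r.left ⊗ₘ r'.left) ≫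
        (r.right ⊗ₘ r'.right)) v.1.arrow ≫ pullback.fst u.1.arrow (r.left ⊗ₘ r'.left))
        (pullback.snd (pullback.snd u.1.arrow (r.left ⊗ₘ r'.left) ≫
          (r.right ⊗ₘ r'.right)) v.1.arrow)) := by
      constructor
      intro Z k l hkl
      have e₁ := hkl =≫ fst _ _
      have e₂ := hkl =≫ snd _ _
      simp only [Category.assoc, lift_fst, lift_snd] at e₁ e₂
      refine H'.hom_ext (H.hom_ext (by simpa only [Category.assoc]) ?_) e₂
      have a₁ := e₁ =≫ u.1.arrow
      have a₂ := e₂ =≫ v.1.arrow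
      simp only [Category.assoc, H.w] at a₁
      simp only [Category.assoc, ← H'.w] at a₂
      rw [← cancel_mono (lift (r.left ⊗ₘ r'.left) (r.right ⊗ₘ r'.right))]
      apply CartesianMonoidalCategory.hom_ext
      · simpa only [Category.assoc, lift_fst] using a₁
      · simpa only [Category.assoc, lift_snd] using a₂
    exact (curly_extMor δ (x := u.obj) (y := v.obj) _ _ hm).symm
  · rw [graph_comp_cograph_eq_zero δ _ v.1.arrow
      (fun f g hfg => h' (IsRegular.hasPullback_of_comm f g _ _ hfg)), comp_zero]
    exact res_zero δ _ _

theorem curlyData_curlyLaws : (curlyData δ).CurlyLaws δ where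
  comp r s := curly_comp δ r s
  tensor r r' := by
    refine (curly_tensor δ r r').trans (Finset.sum_congr rfl fun u _ =>
      Finset.sum_congr rfl fun v _ => ?_)
    have h : HasPullback u.1.arrow (r.left ⊗ₘ r'.left) := inferInstance
    rw [dif_pos h]
    by_cases h' : HasPullback (pullback.snd u.1.arrow (r.left ⊗ₘ r'.left) ≫
      (r.right ⊗ₘ r'.right)) v.1.arrow
    · rw [dif_pos h']
      have e := curly_tensor_coeff δ r r' u v
      rw [dif_pos h, dif_pos h'] at e
      rw [e]
      exact congrArg (· ≫ _) (envelopeData_proj δ (curly δ) _ _).symm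
    · rw [dif_neg h']
      have e : curlyComponent δ r r' u v = 0 :=
        (curly_tensor_coeff δ r r' u v).trans (by rw [dif_pos h, dif_neg h']; rfl)
      rw [e, zero_comp, comp_zero]
      rfl

theorem isIso_biproduct_desc (x : A) : IsIso (biproduct.desc fun y : Subobject x =>
    starIncl δ (y : A) ≫ (toEnvelope δ).map (graph δ y.arrow)) := by
  refine ⟨⟨biproduct.lift fun y : Subobject x => env δ (cograph δ y.arrow) ≫ starProj δ (y : A),
    ?_, ?_⟩⟩
  · refine biproduct.hom_ext _ _ fun u => biproduct.hom_ext' _ _ fun v => ?_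
    rw [Category.assoc, biproduct.lift_π, biproduct.ι_desc_assoc, Category.id_comp]
    have h : (starIncl δ (v : A) ≫ (toEnvelope δ).map (graph δ v.arrow)) ≫
        env δ (cograph δ u.arrow) ≫ starProj δ (u : A) =
          res δ (graph δ v.arrow ≫ cograph δ u.arrow) := by
      rw [res, env_comp, Category.assoc, Category.assoc]
      rfl
    rw [h]
    by_cases huv : v = u
    · subst huv
      rw [graph_comp_cograph_self, res_id, biproduct.ι_π_self]
    · rw [biproduct.ι_π_ne _ huv, ← res_pTop_comp, ← res_comp_pTop, Category.assoc,
        Category.assoc, pTop_graph_cograph_pTop_of_ne δ huv, res_zero]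
  · exact (biproduct_lift_desc _ _).trans (sum_gen δ x)

end EnvelopeSystem

/-! ### Comparison of two generated categories -/

section Comparison

variable {ι : Type u} (K : Type w) [CommRing K]
  {C : Type u₁} [Category.{v₁} C] [Preadditive C] [Linear K C]
  {D : Type u₂} [Category.{v₂} D] [Preadditive D] [Linear K D]

/-- A `K`-linear isomorphism between the full subcategories on two families of objects. -/
structure Comparison (P : ι → C) (Q : ι → D) where
  /-- the isomorphism of morphism modules -/
  equiv : ∀ {x y : ι}, (P x ⟶ P y) ≃ₗ[K] (Q x ⟶ Q y)
  map_id : ∀ x : ι, equiv (𝟙 (P x)) = 𝟙 (Q x)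
  map_comp : ∀ {x y z : ι} (f : P x ⟶ P y) (g : P y ⟶ P z), equiv (f ≫ g) = equiv f ≫ equiv g

variable {K} {P : ι → C} {Q : ι → D}

/-- The inverse isomorphism. -/
def Comparison.symm (Φ : Comparison K P Q) : Comparison K Q P where
  equiv := Φ.equiv.symm
  map_id x := by rw [LinearEquiv.symm_apply_eq, Φ.map_id]
  map_comp f g := by
    rw [LinearEquiv.symm_apply_eq, Φ.map_comp, LinearEquiv.apply_symm_apply,
      LinearEquiv.apply_symm_apply]

/-- A matching of `X` and `Y`: presentations of `X` and `Y` as direct summands of direct sums of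
objects of the given families, which correspond to each other. -/
structure Matching (Φ : Comparison K P Q) (J : Type*) [Fintype J] (X : C) (Y : D) where
  /-- the objects of the families -/
  idx : J → ι
  /-- the inclusion of `X` -/
  s : ∀ j, X ⟶ P (idx j)
  /-- the projection to `X` -/
  r : ∀ j, P (idx j) ⟶ X
  /-- the inclusion of `Y` -/
  σ : ∀ j, Y ⟶ Q (idx j)
  /-- the projection to `Y` -/
  ρ : ∀ j, Q (idx j) ⟶ Y
  sum_s_r : ∑ j, s j ≫ r j = 𝟙 X
  sum_σ_ρ : ∑ j, σ j ≫ ρ j = 𝟙 Y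
  ρ_σ : ∀ j k, ρ j ≫ σ k = Φ.equiv (r j ≫ s k)

namespace Matching

variable {Φ : Comparison K P Q} {J J' J'' : Type*} [Fintype J] [Fintype J'] [Fintype J'']
  {X X' X'' : C} {Y Y' Y'' : D} (m : Matching Φ J X Y) (m' : Matching Φ J' X' Y')
  (m'' : Matching Φ J'' X'' Y'')

/-- The matching with the roles of the two categories exchanged. -/
def symm : Matching Φ.symm J Y X where
  idx := m.idx
  s := m.σ
  r := m.ρ
  σ := m.s
  ρ := m.r
  sum_s_r := m.sum_σ_ρ
  sum_σ_ρ := m.sum_s_r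
  ρ_σ j k := by
    rw [m.ρ_σ]
    exact (Φ.equiv.symm_apply_apply _).symm

/-- The matching of two corresponding members of the families. -/
def single (Φ : Comparison K P Q) (x : ι) : Matching Φ Unit (P x) (Q x) where
  idx _ := x
  s _ := 𝟙 _
  r _ := 𝟙 _
  σ _ := 𝟙 _
  ρ _ := 𝟙 _
  sum_s_r := by simp
  sum_σ_ρ := by simp
  ρ_σ _ _ := by rw [Category.comp_id, Category.comp_id, Φ.map_id]

/-- The morphism which corresponds to a morphism between two matched objects. -/
def map (f : X ⟶ X') : Y ⟶ Y' :=
  ∑ j, ∑ k, m.σ j ≫ Φ.equiv (m.r j ≫ f ≫ m'.s k) ≫ m'.ρ k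

theorem hom_ext {g g' : Y ⟶ Y'} (h : ∀ j k, m.ρ j ≫ g ≫ m'.σ k = m.ρ j ≫ g' ≫ m'.σ k) :
    g = g' := by
  have e : ∀ g : Y ⟶ Y', g = ∑ j, ∑ k, m.σ j ≫ (m.ρ j ≫ g ≫ m'.σ k) ≫ m'.ρ k := by
    intro g
    calc g = (∑ j, m.σ j ≫ m.ρ j) ≫ g ≫ ∑ k, m'.σ k ≫ m'.ρ k := by
          rw [m.sum_σ_ρ, m'.sum_σ_ρ, Category.id_comp, Category.comp_id]
      _ = _ := by
          simp only [Preadditive.sum_comp, Preadditive.comp_sum, Category.assoc]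
          rw [Finset.sum_comm]
  rw [e g, e g']
  simp only [h]

/-- Φ is defined only between members of the family; this computes its value on a composition
through X by means of the presentation of X. -/
theorem equiv_sum_comp {x y : ι} (f : P x ⟶ X) (g : X ⟶ P y) :
    ∑ j, Φ.equiv (f ≫ m.s j) ≫ Φ.equiv (m.r j ≫ g) = Φ.equiv (f ≫ g) := by
  simp only [← Φ.map_comp, ← map_sum]
  congr 1
  calc ∑ j, (f ≫ m.s j) ≫ m.r j ≫ g = f ≫ (∑ j, m.s j ≫ m.r j) ≫ g := by
        simp only [Preadditive.sum_comp, Preadditive.comp_sum, Category.assoc]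
    _ = f ≫ g := by rw [m.sum_s_r, Category.id_comp]

/-- The characteristic property of `map`: the components of the image are the Φ-images of the
components. With `hom_ext` it gives `map_eq`, by which all later identities are checked. -/
theorem ρ_map_σ (f : X ⟶ X') (j : J) (k : J') :
    m.ρ j ≫ map m m' f ≫ m'.σ k = Φ.equiv (m.r j ≫ f ≫ m'.s k) := by
  simp only [map, Preadditive.sum_comp, Preadditive.comp_sum, Category.assoc]
  simp only [m'.ρ_σ, ← Category.assoc (m.ρ j), m.ρ_σ]
  calc ∑ a, ∑ b, Φ.equiv (m.r j ≫ m.s a) ≫ Φ.equiv (m.r a ≫ f ≫ m'.s b) ≫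
        Φ.equiv (m'.r b ≫ m'.s k) =
      ∑ a, Φ.equiv (m.r j ≫ m.s a) ≫ Φ.equiv (m.r a ≫ f ≫ m'.s k) := by
        refine Finset.sum_congr rfl fun a _ => ?_
        rw [← Preadditive.comp_sum]
        have := m'.equiv_sum_comp (m.r a ≫ f) (m'.s k)
        simp only [Category.assoc] at this
        rw [this]
    _ = _ := m.equiv_sum_comp _ _

theorem map_eq {f : X ⟶ X'} {g : Y ⟶ Y'}
    (h : ∀ j k, m.ρ j ≫ g ≫ m'.σ k = Φ.equiv (m.r j ≫ f ≫ m'.s k)) : map m m' f = g :=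
  m.hom_ext m' fun j k => by rw [ρ_map_σ, h]

theorem map_id : map m m (𝟙 X) = 𝟙 Y :=
  map_eq _ _ fun j k => by rw [Category.id_comp, Category.id_comp, m.ρ_σ]

theorem map_comp (f : X ⟶ X') (g : X' ⟶ X'') :
    map m m'' (f ≫ g) = map m m' f ≫ map m' m'' g := by
  refine map_eq _ _ fun j k => ?_
  calc m.ρ j ≫ (map m m' f ≫ map m' m'' g) ≫ m''.σ k =
      m.ρ j ≫ map m m' f ≫ (∑ l, m'.σ l ≫ m'.ρ l) ≫ map m' m'' g ≫ m''.σ k := by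
        rw [m'.sum_σ_ρ, Category.id_comp, Category.assoc]
    _ = ∑ l, (m.ρ j ≫ map m m' f ≫ m'.σ l) ≫ m'.ρ l ≫ map m' m'' g ≫ m''.σ k := by
        simp only [Preadditive.sum_comp, Preadditive.comp_sum, Category.assoc]
    _ = ∑ l, Φ.equiv ((m.r j ≫ f) ≫ m'.s l) ≫ Φ.equiv (m'.r l ≫ g ≫ m''.s k) := by
        simp only [ρ_map_σ, Category.assoc]
    _ = _ := by rw [m'.equiv_sum_comp]; simp only [Category.assoc]

theorem map_add (f g : X ⟶ X') : map m m' (f + g) = map m m' f + map m m' g := by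
  simp only [map, Preadditive.add_comp, Preadditive.comp_add, _root_.map_add,
    Finset.sum_add_distrib]

theorem map_smul (c : K) (f : X ⟶ X') : map m m' (c • f) = c • map m m' f := by
  simp only [map, Linear.smul_comp, Linear.comp_smul, _root_.map_smul, Finset.smul_sum]

theorem symm_map_map (f : X ⟶ X') : map m.symm m'.symm (map m m' f) = f :=
  map_eq _ _ fun j k => by
    change _ = Φ.equiv.symm (m.ρ j ≫ map m m' f ≫ m'.σ k)
    rw [ρ_map_σ, LinearEquiv.symm_apply_apply]
    rfl

theorem map_symm_map (g : Y ⟶ Y') : map m m' (map m.symm m'.symm g) = g :=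
  symm_map_map m.symm m'.symm g

theorem map_bijective : Function.Bijective (map m m') :=
  Function.bijective_iff_has_inverse.2
    ⟨map m.symm m'.symm, symm_map_map m m', map_symm_map m m'⟩

variable {Z : D} (n : Matching Φ J' X Z)

/-- The isomorphism between two objects which are matched with the same object. -/
def iso : Y ≅ Z where
  hom := map m n (𝟙 X)
  inv := map n m (𝟙 X)
  hom_inv_id := by rw [← map_comp, Category.id_comp, map_id]
  inv_hom_id := by rw [← map_comp, Category.id_comp, map_id]

end Matching

theorem Comparison.exists_matching [HasFiniteBiproducts C] [HasFiniteBiproducts D]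
    [IsIdempotentComplete D] (Φ : Comparison K P Q) {X : C} {n : ℕ} (x : Fin n → ι)
    (R : Retract X (⨁ fun i => P (x i))) : ∃ Y : D, Nonempty (Matching Φ (Fin n) X Y) := by
  let s : ∀ j, X ⟶ P (x j) := fun j => R.i ≫ biproduct.π _ j
  let r : ∀ j, P (x j) ⟶ X := fun j => biproduct.ι (fun i => P (x i)) j ≫ R.r
  have hsr : ∑ j, s j ≫ r j = 𝟙 X := by
    calc ∑ j, s j ≫ r j = R.i ≫ (∑ j, biproduct.π (fun i => P (x i)) j ≫ biproduct.ι (fun i => P (x i)) j) ≫ R.r := by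
          simp only [s, r, Preadditive.sum_comp, Preadditive.comp_sum, Category.assoc]
      _ = 𝟙 X := by rw [biproduct.total, Category.id_comp, R.retract]
  -- X is the image of the idempotent matrix with entries r j ≫ s k; its Φ-image is an idempotent
  -- matrix whose splitting is the matched object.
  let e : (⨁ fun i => Q (x i)) ⟶ ⨁ fun i => Q (x i) :=
    biproduct.desc fun j => biproduct.lift fun k => Φ.equiv (r j ≫ s k)
  have hπ : ∀ k, e ≫ biproduct.π _ k = biproduct.desc fun j => Φ.equiv (r j ≫ s k) := fun k =>
    biproduct.hom_ext' _ _ fun j => by simp [e]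
  have he : e ≫ e = e := by
    refine biproduct.hom_ext _ _ fun k => biproduct.hom_ext' _ _ fun j => ?_
    rw [Category.assoc, hπ, biproduct.ι_desc, biproduct.ι_desc_assoc, biproduct.lift_desc]
    simp only [← Φ.map_comp, ← map_sum]
    congr 1
    calc ∑ l, (r j ≫ s l) ≫ r l ≫ s k = r j ≫ (∑ l, s l ≫ r l) ≫ s k := by
          simp only [Preadditive.sum_comp, Preadditive.comp_sum, Category.assoc]
      _ = r j ≫ s k := by rw [hsr, Category.id_comp]
  obtain ⟨Y, i, q, hiq, hqi⟩ := IsIdempotentComplete.idempotents_split _ e he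
  refine ⟨Y, ⟨⟨x, s, r, fun j => i ≫ biproduct.π _ j, fun j => biproduct.ι (fun i => Q (x i)) j ≫ q, hsr, ?_, ?_⟩⟩⟩
  · calc ∑ j, (i ≫ biproduct.π (fun i => Q (x i)) j) ≫ biproduct.ι (fun i => Q (x i)) j ≫ q =
          i ≫ (∑ j, biproduct.π (fun i => Q (x i)) j ≫ biproduct.ι (fun i => Q (x i)) j) ≫ q := by
          simp only [Preadditive.sum_comp, Preadditive.comp_sum, Category.assoc]
      _ = 𝟙 Y := by rw [biproduct.total, Category.id_comp, hiq]
  · intro j k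
    rw [Category.assoc, reassoc_of% hqi, hπ, biproduct.ι_desc]

namespace Matching

variable {Φ : Comparison K P Q} {n : C → ℕ} {F : C → D}
  (m : ∀ X : C, Matching Φ (Fin (n X)) X (F X))

/-- The functor given by a choice of matched objects. -/
def functor : C ⥤ D where
  obj := F
  map {X X'} f := map (m X) (m X') f
  map_id X := map_id (m X)
  map_comp f g := map_comp _ _ _ f g

instance : (functor m).Faithful where
  map_injective {X X'} := (map_bijective (m X) (m X')).injective

instance : (functor m).Full where
  map_surjective {X X'} := (map_bijective (m X) (m X')).surjective

instance : (functor m).Additive where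
  map_add {X X' f g} := map_add (m X) (m X') f g

instance : (functor m).Linear K where
  map_smul {X X'} f c := map_smul (m X) (m X') c f

theorem functor_isEquivalence
    (h : ∀ Y : D, ∃ (X : C) (k : ℕ), Nonempty (Matching Φ (Fin k) X Y)) :
    (functor m).IsEquivalence where
  essSurj := ⟨fun Y => by
    obtain ⟨X, k, ⟨l⟩⟩ := h Y
    exact ⟨X, ⟨iso (m X) l⟩⟩⟩

end Matching

end Comparison

/-! ### Consequences of the properties of a system -/

section

variable {A : Type u} [Category.{v} A] [CartesianMonoidalCategory A] [IsRegular A]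

/-- Any two morphisms to a subobject of the terminal object agree, so t → x is injective as well as
surjective. -/
theorem R.isIso_right_of_mono_toUnit {u x : A} [Mono (toUnit u)] (t : R u x) : IsIso t.right := by
  have : Mono t.right := ⟨fun f g h => by
    rw [← cancel_mono (lift t.left t.right)]
    apply CartesianMonoidalCategory.hom_ext
    · rw [← cancel_mono (toUnit u)]
      exact toUnit_unique _ _
    · simpa using h⟩
  exact isIso_of_isSurj_of_mono (inferInstance : IsSurj t.right)

theorem R.isIso_left_of_mono_toUnit {u x : A} [Mono (toUnit u)] (t : R x u) : IsIso t.left := by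
  have : Mono t.left := ⟨fun f g h => by
    rw [← cancel_mono (lift t.left t.right)]
    apply CartesianMonoidalCategory.hom_ext
    · simpa using h
    · rw [← cancel_mono (toUnit u)]
      exact toUnit_unique _ _⟩
  exact isIso_of_isSurj_of_mono (inferInstance : IsSurj t.left)

end

namespace SubobjectData

variable {A : Type u} [Category.{v} A] [CartesianMonoidalCategory A] [IsRegular A]

section

variable {D : Type u₁} [Category.{v₁} D] [MonoidalCategory D] (M : SubobjectData A D)

theorem incl_congr {t x y : A} {a a' : t ⟶ x} {b b' : t ⟶ y} [IsSurj a] [IsSurj b]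
    [Mono (lift a b)] [IsSurj a'] [IsSurj b'] [Mono (lift a' b')] (ha : a = a') (hb : b = b') :
    M.incl a b = M.incl a' b' := by
  subst ha hb
  rfl

theorem proj_congr {t x y : A} {a a' : t ⟶ x} {b b' : t ⟶ y} [IsSurj a] [IsSurj b]
    [Mono (lift a b)] [IsSurj a'] [IsSurj b'] [Mono (lift a' b')] (ha : a = a') (hb : b = b') :
    M.proj a b = M.proj a' b' := by
  subst ha hb
  rfl

end

variable [SubobjectFinite A] {K : Type w} [CommRing K]
  {D : Type u₁} [Category.{v₁} D] [Preadditive D] [Linear K D] [HasFiniteBiproducts D]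
  [MonoidalCategory D] [SymmetricCategory D] {M : SubobjectData A D} (hM : M.IsSystem K)

namespace IsSystem

include hM

theorem isoMor_hom_inv {x y : A} (e : x ≅ y) : M.isoMor e ≫ M.isoMor e.symm = 𝟙 _ := by
  rw [← hM.isoMor_trans, Iso.self_symm_id, hM.isoMor_refl]

theorem incl_eq {t x y : A} (a : t ⟶ x) (b : t ⟶ y) [IsSurj a] [IsSurj b] [Mono (lift a b)]
    (e : t ≅ (R.ofSpan a b).obj) (he : e.hom = R.toSpan a b) :
    M.incl a b = M.isoMor e ≫ M.incl (R.ofSpan a b).left (R.ofSpan a b).right := by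
  have ha : e.hom ≫ (R.ofSpan a b).left = a := by rw [he, R.toSpan_left]
  have hb : e.hom ≫ (R.ofSpan a b).right = b := by rw [he, R.toSpan_right]
  have hm : Mono (lift (e.hom ≫ (R.ofSpan a b).left) (e.hom ≫ (R.ofSpan a b).right)) := by
    rw [ha, hb]
    infer_instance
  rw [← hM.incl_source]
  exact M.incl_congr ha.symm hb.symm

theorem proj_eq {t x y : A} (a : t ⟶ x) (b : t ⟶ y) [IsSurj a] [IsSurj b] [Mono (lift a b)]
    (e : t ≅ (R.ofSpan a b).obj) (he : e.hom = R.toSpan a b) :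
    M.proj a b = M.proj (R.ofSpan a b).left (R.ofSpan a b).right ≫ M.isoMor e.symm := by
  have ha : e.hom ≫ (R.ofSpan a b).left = a := by rw [he, R.toSpan_left]
  have hb : e.hom ≫ (R.ofSpan a b).right = b := by rw [he, R.toSpan_right]
  have hm : Mono (lift (e.hom ≫ (R.ofSpan a b).left) (e.hom ≫ (R.ofSpan a b).right)) := by
    rw [ha, hb]
    infer_instance
  rw [← hM.proj_source e, Category.assoc, hM.isoMor_hom_inv, Category.comp_id]
  exact M.proj_congr ha.symm hb.symm

/-- The associativity axiom with s the image of w in y × z, in the form needed for iterated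
decompositions. -/
theorem incl_associator {x y z : A} (t : R x y) (w : R t.obj z)
    [Mono (lift (w.left ≫ t.left) (R.toSpan (w.left ≫ t.right) w.right))] :
    M.incl w.left w.right ≫ (M.incl t.left t.right ▷ M.obj z) ≫
        (α_ (M.obj x) (M.obj y) (M.obj z)).hom =
      M.incl (w.left ≫ t.left) (R.toSpan (w.left ≫ t.right) w.right) ≫
        (M.obj x ◁ M.incl (R.ofSpan (w.left ≫ t.right) w.right).left
          (R.ofSpan (w.left ≫ t.right) w.right).right) := by
  have h : R.toSpan (w.left ≫ t.right) w.right ≫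
      (R.ofSpan (w.left ≫ t.right) w.right).right = w.right := R.toSpan_right _ _
  have hm : Mono (lift w.left (R.toSpan (w.left ≫ t.right) w.right ≫
      (R.ofSpan (w.left ≫ t.right) w.right).right)) := by
    rw [h]
    infer_instance
  rw [← hM.associator w.left (R.toSpan (w.left ≫ t.right) w.right) t.left t.right
    (R.ofSpan (w.left ≫ t.right) w.right).left (R.ofSpan (w.left ≫ t.right) w.right).right
    (R.toSpan_left _ _).symm]
  congr 1
  exact M.incl_congr rfl h.symm

/-- The components of the associativity constraint. -/
theorem associator_component {x y z x' y' z' : A} {X Y Z : D} (f : M.obj x ⟶ X) (g : M.obj y ⟶ Y)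
    (h : M.obj z ⟶ Z) (f' : X ⟶ M.obj x') (g' : Y ⟶ M.obj y') (h' : Z ⟶ M.obj z') (t : R x y)
    (w : R t.obj z) (t' : R y' z') (w' : R x' t'.obj)
    [Mono (lift (w.left ≫ t.left) (R.toSpan (w.left ≫ t.right) w.right))] :
    (M.incl w.left w.right ≫ ((M.incl t.left t.right ≫ (f ⊗ₘ g)) ⊗ₘ h)) ≫ (α_ X Y Z).hom ≫
        ((f' ⊗ₘ ((g' ⊗ₘ h') ≫ M.proj t'.left t'.right)) ≫ M.proj w'.left w'.right) =
      M.incl (w.left ≫ t.left) (R.toSpan (w.left ≫ t.right) w.right) ≫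
        ((f ≫ f') ⊗ₘ (M.incl (R.ofSpan (w.left ≫ t.right) w.right).left
          (R.ofSpan (w.left ≫ t.right) w.right).right ≫ ((g ≫ g') ⊗ₘ (h ≫ h')) ≫
            M.proj t'.left t'.right)) ≫ M.proj w'.left w'.right := by
  have e₁ : (M.incl t.left t.right ≫ (f ⊗ₘ g)) ⊗ₘ h =
      (M.incl t.left t.right ▷ M.obj z) ≫ ((f ⊗ₘ g) ⊗ₘ h) := by
    rw [← tensorHom_id, MonoidalCategory.tensorHom_comp_tensorHom, Category.id_comp]
  have e₂ := hM.incl_associator t w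
  rw [e₁]
  simp only [Category.assoc]
  rw [associator_naturality_assoc, reassoc_of% e₂, ← id_tensorHom]
  simp only [MonoidalCategory.tensorHom_comp_tensorHom_assoc, Category.id_comp]

/-- The unit axiom is stated for a relation whose leg to x is the identity; transport along
`t.right` gives the general case. -/
theorem incl_unitIncl_leftUnitor {u x : A} [Mono (toUnit u)] (t : R u x) [IsIso t.right] :
    M.incl t.left t.right ≫ (M.unitIncl u ▷ M.obj x) ≫ (λ_ (M.obj x)).hom =
      M.isoMor (asIso t.right) := by
  have h₁ : (asIso t.right).hom ≫ inv t.right ≫ t.left = t.left := by simp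
  have h₂ : (asIso t.right).hom ≫ 𝟙 x = t.right := by simp
  have hm : Mono (lift ((asIso t.right).hom ≫ inv t.right ≫ t.left)
      ((asIso t.right).hom ≫ 𝟙 x)) := by
    rw [h₁, h₂]
    infer_instance
  have e : M.incl t.left t.right = M.isoMor (asIso t.right) ≫
      M.incl (inv t.right ≫ t.left) (𝟙 x) := by
    rw [← hM.incl_source]
    exact M.incl_congr h₁.symm h₂.symm
  rw [e, Category.assoc, hM.leftUnitor, Category.comp_id]

theorem incl_unitIncl_rightUnitor {u x : A} [Mono (toUnit u)] (t : R x u) [IsIso t.left] :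
    M.incl t.left t.right ≫ (M.obj x ◁ M.unitIncl u) ≫ (ρ_ (M.obj x)).hom =
      M.isoMor (asIso t.left) := by
  have h₁ : (asIso t.left).hom ≫ inv t.left ≫ t.right = t.right := by simp
  have h₂ : (asIso t.left).hom ≫ 𝟙 x = t.left := by simp
  have hm : Mono (lift ((asIso t.left).hom ≫ 𝟙 x)
      ((asIso t.left).hom ≫ inv t.left ≫ t.right)) := by
    rw [h₁, h₂]
    infer_instance
  have e : M.incl t.left t.right = M.isoMor (asIso t.left) ≫
      M.incl (𝟙 x) (inv t.left ≫ t.right) := by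
    rw [← hM.incl_source]
    exact M.incl_congr h₂.symm h₁.symm
  rw [e, Category.assoc, hM.rightUnitor, Category.comp_id]

end IsSystem

end SubobjectData

/-! ### Comparison of two systems -/

section TensorComparison

variable {A : Type u} [Category.{v} A] [CartesianMonoidalCategory A] [IsRegular A]
  [SubobjectFinite A] {K : Type w} [CommRing K]
  {C : Type u₁} [Category.{v₁} C] [Preadditive C] [Linear K C] [HasFiniteBiproducts C]
  [MonoidalCategory C] [SymmetricCategory C]
  {D : Type u₂} [Category.{v₂} D] [Preadditive D] [Linear K D] [HasFiniteBiproducts D]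
  [MonoidalCategory D] [SymmetricCategory D]

/-- A comparison which is compatible with the morphisms attached to relations and with the
components of tensor products of morphisms. -/
structure IsTensorComparison (M : SubobjectData A C) (N : SubobjectData A D)
    (Φ : Comparison K M.obj N.obj) : Prop where
  equiv_mor : ∀ {x y : A} (r : R x y), Φ.equiv (M.mor r) = N.mor r
  equiv_tensor : ∀ {x y x' y' : A} (f : M.obj x ⟶ M.obj y) (g : M.obj x' ⟶ M.obj y') (u : R x x')
    (v : R y y'), Φ.equiv (M.incl u.left u.right ≫ (f ⊗ₘ g) ≫ M.proj v.left v.right) =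
      N.incl u.left u.right ≫ (Φ.equiv f ⊗ₘ Φ.equiv g) ≫ N.proj v.left v.right

namespace IsTensorComparison

variable {M : SubobjectData A C} {N : SubobjectData A D} {Φ : Comparison K M.obj N.obj}
  (hΦ : IsTensorComparison M N Φ) (hM : M.IsSystem K) (hN : N.IsSystem K)

include hΦ

theorem equiv_isoMor {x y : A} (e : x ≅ y) : Φ.equiv (M.isoMor e) = N.isoMor e :=
  hΦ.equiv_mor _

include hM hN

/-- Extends `equiv_tensor` from chosen subobjects to arbitrary jointly monic pairs, since these
differ by isomorphisms, which Φ respects. -/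
theorem equiv_incl_tensor_proj {t t' x y x' y' : A} (f : M.obj x ⟶ M.obj y)
    (g : M.obj x' ⟶ M.obj y') (a : t ⟶ x) (b : t ⟶ x') (c : t' ⟶ y) (d : t' ⟶ y') [IsSurj a]
    [IsSurj b] [IsSurj c] [IsSurj d] [Mono (lift a b)] [Mono (lift c d)] :
    Φ.equiv (M.incl a b ≫ (f ⊗ₘ g) ≫ M.proj c d) =
      N.incl a b ≫ (Φ.equiv f ⊗ₘ Φ.equiv g) ≫ N.proj c d := by
  have := R.isIso_toSpan a b
  have := R.isIso_toSpan c d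
  have h := hΦ.equiv_tensor f g (R.ofSpan a b) (R.ofSpan c d)
  rw [hM.incl_eq a b (asIso (R.toSpan a b)) rfl, hM.proj_eq c d (asIso (R.toSpan c d)) rfl,
    hN.incl_eq a b (asIso (R.toSpan a b)) rfl, hN.proj_eq c d (asIso (R.toSpan c d)) rfl]
  simp only [Category.assoc]
  rw [← reassoc_of% h, ← hΦ.equiv_isoMor, ← hΦ.equiv_isoMor, ← Φ.map_comp, ← Φ.map_comp]
  simp only [Category.assoc]

theorem equiv_incl_proj {t t' x x' : A} (a : t ⟶ x) (b : t ⟶ x') (c : t' ⟶ x) (d : t' ⟶ x')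
    [IsSurj a] [IsSurj b] [IsSurj c] [IsSurj d] [Mono (lift a b)] [Mono (lift c d)] :
    Φ.equiv (M.incl a b ≫ M.proj c d) = N.incl a b ≫ N.proj c d := by
  have h := hΦ.equiv_incl_tensor_proj hM hN (𝟙 (M.obj x)) (𝟙 (M.obj x')) a b c d
  simpa only [Φ.map_id, MonoidalCategory.id_tensorHom_id, Category.id_comp] using h

theorem equiv_unitIncl_unitProj (u : A) [Mono (toUnit u)] (v : Subobject (𝟙_ A)) :
    Φ.equiv (M.unitIncl u ≫ M.unitProj (v : A)) = N.unitIncl u ≫ N.unitProj (v : A) := by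
  have e : u ≅ (Subobject.mk (toUnit u) : A) := (Subobject.underlyingIso (toUnit u)).symm
  rw [hM.unitIncl_source e, hN.unitIncl_source e, Category.assoc, Category.assoc]
  by_cases h : Subobject.mk (toUnit u) = v
  · rw [← h, hM.unitIncl_unitProj, hN.unitIncl_unitProj, Category.comp_id, Category.comp_id,
      hΦ.equiv_isoMor]
  · rw [hM.unitIncl_unitProj_of_ne _ _ h, hN.unitIncl_unitProj_of_ne _ _ h, comp_zero, comp_zero,
      map_zero]

/-- The matching of the unit objects. -/
noncomputable def unitMatching : Matching Φ (Subobject (𝟙_ A)) (𝟙_ C) (𝟙_ D) where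
  idx u := (u : A)
  s u := M.unitProj (u : A)
  r u := M.unitIncl (u : A)
  σ u := N.unitProj (u : A)
  ρ u := N.unitIncl (u : A)
  sum_s_r := hM.sum_unitProj_unitIncl
  sum_σ_ρ := hN.sum_unitProj_unitIncl
  ρ_σ u v := (hΦ.equiv_unitIncl_unitProj hM hN (u : A) v).symm

end IsTensorComparison

end TensorComparison

/-! ### Components of the constraints in a system -/

theorem mono_lift_assoc {A : Type u} [Category.{v} A] [CartesianMonoidalCategory A] [IsRegular A]
    {x y z : A} (t : R x y) (w : R t.obj z) :
    Mono (lift (w.left ≫ t.left) (R.toSpan (w.left ≫ t.right) w.right)) := ⟨fun f g h => by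
  have h₁ := h =≫ fst _ _
  have h₂ := h =≫ snd _ _
  simp only [Category.assoc, lift_fst, lift_snd] at h₁ h₂
  have h₃ := h₂ =≫ (R.ofSpan (w.left ≫ t.right) w.right).left
  have h₄ := h₂ =≫ (R.ofSpan (w.left ≫ t.right) w.right).right
  simp only [Category.assoc, R.toSpan_left, R.toSpan_right] at h₃ h₄
  rw [← cancel_mono (lift w.left w.right)]
  apply CartesianMonoidalCategory.hom_ext
  · rw [← cancel_mono (lift t.left t.right)]
    apply CartesianMonoidalCategory.hom_ext
    · simpa using h₁
    · simpa using h₃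
  · simpa using h₄⟩

instance mono_lift_swap {A : Type u} [Category.{v} A] [CartesianMonoidalCategory A]
    {x y : A} (t : R x y) : Mono (lift t.right t.left) := ⟨fun f g h => by
  have h₁ := h =≫ fst _ _
  have h₂ := h =≫ snd _ _
  simp only [Category.assoc, lift_fst, lift_snd] at h₁ h₂
  rw [← cancel_mono (lift t.left t.right)]
  apply CartesianMonoidalCategory.hom_ext
  · simpa using h₂
  · simpa using h₁⟩

namespace SubobjectData

variable {A : Type u} [Category.{v} A] [CartesianMonoidalCategory A] [IsRegular A]
  {C : Type u₁} [Category.{v₁} C] [MonoidalCategory C]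

section

variable (M : SubobjectData A C)

theorem tensor_component
    {t t' x x' z z' : A} {X X' Z Z' : C} (a : t ⟶ x) (b : t ⟶ x') (c : t' ⟶ z) (d : t' ⟶ z')
    [IsSurj a] [IsSurj b] [IsSurj c] [IsSurj d] [Mono (lift a b)] [Mono (lift c d)]
    (r : M.obj x ⟶ X) (r' : M.obj x' ⟶ X') (f : X ⟶ Z) (f' : X' ⟶ Z') (s : Z ⟶ M.obj z)
    (s' : Z' ⟶ M.obj z') :
    (M.incl a b ≫ (r ⊗ₘ r')) ≫ (f ⊗ₘ f') ≫ (s ⊗ₘ s') ≫ M.proj c d =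
      M.incl a b ≫ ((r ≫ f ≫ s) ⊗ₘ (r' ≫ f' ≫ s')) ≫ M.proj c d := by
  simp only [Category.assoc, MonoidalCategory.tensorHom_comp_tensorHom_assoc]

theorem component_single
    {t x y : A} (a : t ⟶ x) (b : t ⟶ y) [IsSurj a] [IsSurj b] [Mono (lift a b)] (t' : R x y) :
    𝟙 (M.obj t) ≫ M.incl a b ≫ (𝟙 (M.obj x) ⊗ₘ 𝟙 (M.obj y)) ≫ M.proj t'.left t'.right =
      M.incl a b ≫ M.proj t'.left t'.right := by
  rw [MonoidalCategory.id_tensorHom_id, Category.id_comp, Category.id_comp]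

end

namespace IsSystem

variable [SubobjectFinite A] {K : Type w} [CommRing K] [Preadditive C] [Linear K C]
  [HasFiniteBiproducts C] [SymmetricCategory C] {M : SubobjectData A C} (hM : M.IsSystem K)

include hM

theorem leftUnitor_component {u x : A} [Mono (toUnit u)] (t : R u x)
    [IsIso t.right] {X Z : C} (f : M.obj x ⟶ X) (g : X ⟶ Z) :
    (M.incl t.left t.right ≫ (M.unitIncl u ⊗ₘ f)) ≫ (λ_ X).hom ≫ g =
      M.isoMor (asIso t.right) ≫ f ≫ g := by
  have e := hM.incl_unitIncl_leftUnitor t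
  rw [MonoidalCategory.tensorHom_def]
  simp only [Category.assoc, leftUnitor_naturality_assoc]
  rw [reassoc_of% e]

theorem rightUnitor_component {u x : A} [Mono (toUnit u)] (t : R x u)
    [IsIso t.left] {X Z : C} (f : M.obj x ⟶ X) (g : X ⟶ Z) :
    (M.incl t.left t.right ≫ (f ⊗ₘ M.unitIncl u)) ≫ (ρ_ X).hom ≫ g =
      M.isoMor (asIso t.left) ≫ f ≫ g := by
  have e := hM.incl_unitIncl_rightUnitor t
  rw [MonoidalCategory.tensorHom_def']
  simp only [Category.assoc, rightUnitor_naturality_assoc]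
  rw [reassoc_of% e]

theorem braiding_component {x y x' y' : A} (t : R x y) (t' : R y' x') {X Y : C}
    (f : M.obj x ⟶ X) (g : M.obj y ⟶ Y) (f' : X ⟶ M.obj x') (g' : Y ⟶ M.obj y') :
    (M.incl t.left t.right ≫ (f ⊗ₘ g)) ≫ (β_ X Y).hom ≫ (g' ⊗ₘ f') ≫ M.proj t'.left t'.right =
      M.incl t.right t.left ≫ ((g ≫ g') ⊗ₘ (f ≫ f')) ≫ M.proj t'.left t'.right := by
  have e := hM.braiding t.left t.right
  simp only [Category.assoc, BraidedCategory.braiding_naturality_assoc]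
  rw [reassoc_of% e]
  simp only [MonoidalCategory.tensorHom_comp_tensorHom_assoc]

/-- Tensor the two presentations and insert, for each pair of indices, the decomposition into
relations. -/
theorem sum_tensor_tensor [MonoidalPreadditive C] {J J' : Type*}
    [Fintype J] [Fintype J'] {X X' : C} {x : J → A} {x' : J' → A} (s : ∀ j, X ⟶ M.obj (x j))
    (r : ∀ j, M.obj (x j) ⟶ X) (s' : ∀ j, X' ⟶ M.obj (x' j)) (r' : ∀ j, M.obj (x' j) ⟶ X')
    (h : ∑ j, s j ≫ r j = 𝟙 X) (h' : ∑ j, s' j ≫ r' j = 𝟙 X') :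
    ∑ a : (Σ p : J × J', R (x p.1) (x' p.2)),
      ((s a.1.1 ⊗ₘ s' a.1.2) ≫ M.proj a.2.left a.2.right) ≫
        M.incl a.2.left a.2.right ≫ (r a.1.1 ⊗ₘ r' a.1.2) = 𝟙 (X ⊗ X') := by
  rw [Fintype.sum_sigma]
  have e : ∀ p : J × J', ∑ t : R (x p.1) (x' p.2), ((s p.1 ⊗ₘ s' p.2) ≫ M.proj t.left t.right) ≫
      M.incl t.left t.right ≫ (r p.1 ⊗ₘ r' p.2) = (s p.1 ≫ r p.1) ⊗ₘ (s' p.2 ≫ r' p.2) := by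
    intro p
    calc _ = (s p.1 ⊗ₘ s' p.2) ≫ (∑ t : R (x p.1) (x' p.2), M.proj t.left t.right ≫
          M.incl t.left t.right) ≫ (r p.1 ⊗ₘ r' p.2) := by
          simp only [Preadditive.sum_comp, Preadditive.comp_sum, Category.assoc]
      _ = _ := by
          rw [hM.sum_proj_incl, Category.id_comp, MonoidalCategory.tensorHom_comp_tensorHom]
  simp only [e, Fintype.sum_prod_type]
  simp only [← tensor_sum, ← sum_tensor, h, h', MonoidalCategory.id_tensorHom_id]

end IsSystem

end SubobjectData

/-! ### Tensor products of matchings and transport of the constraints -/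

namespace IsTensorComparison

variable {A : Type u} [Category.{v} A] [CartesianMonoidalCategory A] [IsRegular A]
  [SubobjectFinite A] {K : Type w} [CommRing K]
  {C : Type u₁} [Category.{v₁} C] [Preadditive C] [Linear K C] [HasFiniteBiproducts C]
  [MonoidalCategory C] [SymmetricCategory C] [MonoidalPreadditive C]
  {D : Type u₂} [Category.{v₂} D] [Preadditive D] [Linear K D] [HasFiniteBiproducts D]
  [MonoidalCategory D] [SymmetricCategory D] [MonoidalPreadditive D]
  {M : SubobjectData A C} {N : SubobjectData A D} {Φ : Comparison K M.obj N.obj}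
  (hΦ : IsTensorComparison M N Φ) (hM : M.IsSystem K) (hN : N.IsSystem K)

section

variable {J J' J'' : Type*} [Fintype J] [Fintype J'] [Fintype J''] {X X' X'' : C} {Y Y' Y'' : D}
  (m : Matching Φ J X Y) (m' : Matching Φ J' X' Y') (m'' : Matching Φ J'' X'' Y'')

/-- The matching of the tensor products. -/
noncomputable def tensorMatching :
    Matching Φ (Σ p : J × J', R (m.idx p.1) (m'.idx p.2)) (X ⊗ X') (Y ⊗ Y') where
  idx a := a.2.obj
  s a := (m.s a.1.1 ⊗ₘ m'.s a.1.2) ≫ M.proj a.2.left a.2.right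
  r a := M.incl a.2.left a.2.right ≫ (m.r a.1.1 ⊗ₘ m'.r a.1.2)
  σ a := (m.σ a.1.1 ⊗ₘ m'.σ a.1.2) ≫ N.proj a.2.left a.2.right
  ρ a := N.incl a.2.left a.2.right ≫ (m.ρ a.1.1 ⊗ₘ m'.ρ a.1.2)
  sum_s_r := hM.sum_tensor_tensor _ _ _ _ m.sum_s_r m'.sum_s_r
  sum_σ_ρ := hN.sum_tensor_tensor _ _ _ _ m.sum_σ_ρ m'.sum_σ_ρ
  ρ_σ a b := by
    simp only [Category.assoc, MonoidalCategory.tensorHom_comp_tensorHom_assoc, m.ρ_σ, m'.ρ_σ]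
    exact (hΦ.equiv_tensor _ _ _ _).symm

variable {L L' : Type*} [Fintype L] [Fintype L'] {Z Z' : C} {W W' : D} (n : Matching Φ L Z W)
  (n' : Matching Φ L' Z' W')

theorem map_tensor (f : X ⟶ Z) (g : X' ⟶ Z') :
    Matching.map (hΦ.tensorMatching hM hN m m') (hΦ.tensorMatching hM hN n n') (f ⊗ₘ g) =
      m.map n f ⊗ₘ m'.map n' g :=
  Matching.map_eq _ _ fun a b => by
    have e₁ := N.tensor_component a.2.left a.2.right b.2.left b.2.right (m.ρ a.1.1) (m'.ρ a.1.2)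
      (m.map n f) (m'.map n' g) (n.σ b.1.1) (n'.σ b.1.2)
    have e₂ := M.tensor_component a.2.left a.2.right b.2.left b.2.right (m.r a.1.1) (m'.r a.1.2)
      f g (n.s b.1.1) (n'.s b.1.2)
    rw [Matching.ρ_map_σ, Matching.ρ_map_σ, ← hΦ.equiv_tensor, ← e₂] at e₁
    exact e₁

/-- By `associator_component` the components are given by one expression in `incl`, `proj`, the
tensor product and the composites r ≫ s. It holds in both categories, and Φ respects all its
ingredients. The other constraints are treated in the same way. -/
theorem map_associator :
    Matching.map (hΦ.tensorMatching hM hN (hΦ.tensorMatching hM hN m m') m'')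
      (hΦ.tensorMatching hM hN m (hΦ.tensorMatching hM hN m' m'')) (α_ X X' X'').hom =
      (α_ Y Y' Y'').hom := by
  refine Matching.map_eq _ _ ?_
  rintro ⟨⟨⟨⟨i, j⟩, t⟩, k⟩, w⟩ ⟨⟨i', ⟨⟨j', k'⟩, t'⟩⟩, w'⟩
  -- The index sets of nested matchings mention their `idx` fields; these are unfolded to expose the
  -- underlying relations.
  change R (m.idx i) (m'.idx j) at t
  change R t.obj (m''.idx k) at w
  change R (m'.idx j') (m''.idx k') at t'
  change R (m.idx i') t'.obj at w'
  have : Mono (lift (w.left ≫ t.left) (R.toSpan (w.left ≫ t.right) w.right)) :=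
    mono_lift_assoc t w
  have e₁ := hN.associator_component (m.ρ i) (m'.ρ j) (m''.ρ k) (m.σ i') (m'.σ j') (m''.σ k')
    t w t' w'
  have e₂ := hM.associator_component (m.r i) (m'.r j) (m''.r k) (m.s i') (m'.s j') (m''.s k')
    t w t' w'
  rw [m.ρ_σ, m'.ρ_σ, m''.ρ_σ, ← hΦ.equiv_incl_tensor_proj hM hN,
    ← hΦ.equiv_incl_tensor_proj hM hN, ← e₂] at e₁
  exact e₁

theorem map_leftUnitor :
    Matching.map (hΦ.tensorMatching hM hN (hΦ.unitMatching hM hN) m) m (λ_ X).hom =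
      (λ_ Y).hom := by
  refine Matching.map_eq _ _ ?_
  rintro ⟨⟨u, i⟩, t⟩ j
  change R (u : A) (m.idx i) at t
  have ht : IsIso t.right := t.isIso_right_of_mono_toUnit
  have e₁ := hN.leftUnitor_component t (m.ρ i) (m.σ j)
  have e₂ := hM.leftUnitor_component t (m.r i) (m.s j)
  rw [m.ρ_σ, ← hΦ.equiv_isoMor, ← Φ.map_comp, ← e₂] at e₁
  exact e₁

theorem map_rightUnitor :
    Matching.map (hΦ.tensorMatching hM hN m (hΦ.unitMatching hM hN)) m (ρ_ X).hom =
      (ρ_ Y).hom := by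
  refine Matching.map_eq _ _ ?_
  rintro ⟨⟨i, u⟩, t⟩ j
  change R (m.idx i) (u : A) at t
  have ht : IsIso t.left := t.isIso_left_of_mono_toUnit
  have e₁ := hN.rightUnitor_component t (m.ρ i) (m.σ j)
  have e₂ := hM.rightUnitor_component t (m.r i) (m.s j)
  rw [m.ρ_σ, ← hΦ.equiv_isoMor, ← Φ.map_comp, ← e₂] at e₁
  exact e₁

theorem map_braiding :
    Matching.map (hΦ.tensorMatching hM hN m m') (hΦ.tensorMatching hM hN m' m) (β_ X X').hom =
      (β_ Y Y').hom := by
  refine Matching.map_eq _ _ ?_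
  rintro ⟨⟨i, j⟩, t⟩ ⟨⟨j', i'⟩, t'⟩
  change R (m.idx i) (m'.idx j) at t
  change R (m'.idx j') (m.idx i') at t'
  have e₁ := hN.braiding_component t t' (m.ρ i) (m'.ρ j) (m.σ i') (m'.σ j')
  have e₂ := hM.braiding_component t t' (m.r i) (m'.r j) (m.s i') (m'.s j')
  rw [m.ρ_σ, m'.ρ_σ, ← hΦ.equiv_incl_tensor_proj hM hN, ← e₂] at e₁
  exact e₁

theorem map_incl {t x y : A} (a : t ⟶ x) (b : t ⟶ y) [IsSurj a] [IsSurj b] [Mono (lift a b)] :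
    Matching.map (Matching.single Φ t)
      (hΦ.tensorMatching hM hN (Matching.single Φ x) (Matching.single Φ y)) (M.incl a b) =
      N.incl a b := by
  refine Matching.map_eq _ _ ?_
  rintro ⟨⟩ ⟨⟨⟨⟩, ⟨⟩⟩, t'⟩
  change R x y at t'
  refine Eq.trans ?_ (congrArg Φ.equiv (M.component_single a b t')).symm
  refine (N.component_single a b t').trans ?_
  exact (hΦ.equiv_incl_proj hM hN a b t'.left t'.right).symm

theorem map_unitIncl (u : A) [Mono (toUnit u)] :
    Matching.map (Matching.single Φ u) (hΦ.unitMatching hM hN) (M.unitIncl u) = N.unitIncl u := by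
  refine Matching.map_eq _ _ ?_
  rintro ⟨⟩ v
  refine (Category.id_comp _).trans ?_
  refine Eq.trans ?_ (congrArg Φ.equiv (Category.id_comp _)).symm
  exact (hΦ.equiv_unitIncl_unitProj hM hN u v).symm

end

end IsTensorComparison

/-! ### The symmetric monoidal equivalence -/

namespace IsTensorComparison

variable {A : Type u} [Category.{v} A] [CartesianMonoidalCategory A] [IsRegular A]
  [SubobjectFinite A] {K : Type w} [CommRing K]
  {C : Type u₁} [Category.{v₁} C] [Preadditive C] [Linear K C] [HasFiniteBiproducts C]
  [MonoidalCategory C] [SymmetricCategory C] [MonoidalPreadditive C]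
  {D : Type u₂} [Category.{v₂} D] [Preadditive D] [Linear K D] [HasFiniteBiproducts D]
  [MonoidalCategory D] [SymmetricCategory D] [MonoidalPreadditive D]
  {M : SubobjectData A C} {N : SubobjectData A D} {Φ : Comparison K M.obj N.obj}
  (hΦ : IsTensorComparison M N Φ) (hM : M.IsSystem K) (hN : N.IsSystem K)

section

variable {n : C → ℕ} {F : C → D} (m : ∀ X : C, Matching Φ (Fin (n X)) X (F X))

/-- The monoidal structure of the functor given by a choice of matched objects. -/
noncomputable def coreMonoidal : (Matching.functor m).CoreMonoidal where
  εIso := Matching.iso (hΦ.unitMatching hM hN) (m (𝟙_ C))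
  μIso X Y := Matching.iso (hΦ.tensorMatching hM hN (m X) (m Y)) (m (X ⊗ Y))
  μIso_hom_natural_left {X Y} f X' := by
    have e := hΦ.map_tensor hM hN (m X) (m X') (m Y) (m X') f (𝟙 X')
    rw [Matching.map_id, tensorHom_id, tensorHom_id] at e
    -- Each structure isomorphism is the image of an identity between two matchings of the same
    -- object. So this law and the following ones reduce to functoriality of `map` and the
    -- transported constraints.
    change (m X).map (m Y) f ▷ F X' ≫ (hΦ.tensorMatching hM hN (m Y) (m X')).map (m _) (𝟙 _) =
      (hΦ.tensorMatching hM hN (m X) (m X')).map (m _) (𝟙 _) ≫ (m (X ⊗ X')).map (m (Y ⊗ X')) _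
    rw [← e, ← Matching.map_comp, ← Matching.map_comp, Category.comp_id, Category.id_comp]
  μIso_hom_natural_right {X Y} X' f := by
    have e := hΦ.map_tensor hM hN (m X') (m X) (m X') (m Y) (𝟙 X') f
    rw [Matching.map_id, id_tensorHom, id_tensorHom] at e
    change F X' ◁ (m X).map (m Y) f ≫ (hΦ.tensorMatching hM hN (m X') (m Y)).map (m _) (𝟙 _) =
      (hΦ.tensorMatching hM hN (m X') (m X)).map (m _) (𝟙 _) ≫ (m (X' ⊗ X)).map (m (X' ⊗ Y)) _
    rw [← e, ← Matching.map_comp, ← Matching.map_comp, Category.comp_id, Category.id_comp]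
  associativity X Y Z := by
    have e₁ := hΦ.map_tensor hM hN (hΦ.tensorMatching hM hN (m X) (m Y)) (m Z) (m (X ⊗ Y)) (m Z)
      (𝟙 (X ⊗ Y)) (𝟙 Z)
    have e₂ := hΦ.map_tensor hM hN (m X) (hΦ.tensorMatching hM hN (m Y) (m Z)) (m X) (m (Y ⊗ Z))
      (𝟙 X) (𝟙 (Y ⊗ Z))
    rw [Matching.map_id, tensorHom_id, tensorHom_id, id_whiskerRight] at e₁
    rw [Matching.map_id, id_tensorHom, id_tensorHom, whiskerLeft_id] at e₂
    change (hΦ.tensorMatching hM hN (m X) (m Y)).map (m _) (𝟙 _) ▷ F Z ≫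
        (hΦ.tensorMatching hM hN (m (X ⊗ Y)) (m Z)).map (m _) (𝟙 _) ≫
          (m ((X ⊗ Y) ⊗ Z)).map (m (X ⊗ Y ⊗ Z)) (α_ X Y Z).hom = (α_ (F X) (F Y) (F Z)).hom ≫
      F X ◁ (hΦ.tensorMatching hM hN (m Y) (m Z)).map (m _) (𝟙 _) ≫
        (hΦ.tensorMatching hM hN (m X) (m (Y ⊗ Z))).map (m _) (𝟙 _)
    rw [← e₁, ← e₂, ← hΦ.map_associator hM hN (m X) (m Y) (m Z)]
    simp only [← Matching.map_comp, Category.id_comp, Category.comp_id]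
  left_unitality X := by
    have e := hΦ.map_tensor hM hN (hΦ.unitMatching hM hN) (m X) (m (𝟙_ C)) (m X) (𝟙 (𝟙_ C)) (𝟙 X)
    rw [Matching.map_id, tensorHom_id, tensorHom_id, id_whiskerRight] at e
    change (λ_ (F X)).hom = (hΦ.unitMatching hM hN).map (m _) (𝟙 _) ▷ F X ≫
      (hΦ.tensorMatching hM hN (m (𝟙_ C)) (m X)).map (m _) (𝟙 _) ≫ (m (𝟙_ C ⊗ X)).map (m X) _
    rw [← e, ← hΦ.map_leftUnitor hM hN (m X)]
    simp only [← Matching.map_comp, Category.id_comp]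
  right_unitality X := by
    have e := hΦ.map_tensor hM hN (m X) (hΦ.unitMatching hM hN) (m X) (m (𝟙_ C)) (𝟙 X) (𝟙 (𝟙_ C))
    rw [Matching.map_id, id_tensorHom, id_tensorHom, whiskerLeft_id] at e
    change (ρ_ (F X)).hom = F X ◁ (hΦ.unitMatching hM hN).map (m _) (𝟙 _) ≫
      (hΦ.tensorMatching hM hN (m X) (m (𝟙_ C))).map (m _) (𝟙 _) ≫ (m (X ⊗ 𝟙_ C)).map (m X) _
    rw [← e, ← hΦ.map_rightUnitor hM hN (m X)]
    simp only [← Matching.map_comp, Category.id_comp]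

/-- The functor given by a choice of matched objects is symmetric monoidal. -/
noncomputable abbrev functorBraided : (Matching.functor m).Braided :=
  letI := (hΦ.coreMonoidal hM hN m).toMonoidal
  { braided := fun X Y => by
      change (hΦ.tensorMatching hM hN (m X) (m Y)).map (m _) (𝟙 _) ≫
          (m (X ⊗ Y)).map (m (Y ⊗ X)) (β_ X Y).hom =
        (β_ (F X) (F Y)).hom ≫ (hΦ.tensorMatching hM hN (m Y) (m X)).map (m _) (𝟙 _)
      rw [← hΦ.map_braiding hM hN (m X) (m Y)]
      simp only [← Matching.map_comp, Category.id_comp, Category.comp_id] }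

end

include hΦ hM hN

theorem equivalent [IsIdempotentComplete C] [IsIdempotentComplete D] : M.Equivalent K N := by
  have h₁ : ∀ X : C, ∃ (n : ℕ) (Y : D), Nonempty (Matching Φ (Fin n) X Y) := fun X => by
    obtain ⟨n, x, ⟨r⟩⟩ := hM.generate X
    obtain ⟨Y, hY⟩ := Φ.exists_matching x r
    exact ⟨n, Y, hY⟩
  -- Used for essential surjectivity: the construction of matched objects is applied to the inverse
  -- comparison.
  have h₂ : ∀ Y : D, ∃ (X : C) (n : ℕ), Nonempty (Matching Φ (Fin n) X Y) := fun Y => by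
    obtain ⟨n, x, ⟨r⟩⟩ := hN.generate Y
    obtain ⟨X, ⟨l⟩⟩ := Φ.symm.exists_matching x r
    exact ⟨X, n, ⟨l.symm⟩⟩
  choose n F m using h₁
  replace m := fun X => (m X).some
  let φ : ∀ x : A, F (M.obj x) ≅ N.obj x := fun x => Matching.iso (m (M.obj x)) (.single Φ x)
  refine ⟨Matching.functor m, hΦ.functorBraided hM hN m, Matching.functor_isEquivalence m h₂,
    inferInstance, inferInstance, φ, ?_, ?_, ?_⟩
  · intro x y r
    have e : Matching.map (.single Φ x) (.single Φ y) (M.mor r) = N.mor r := by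
      refine Matching.map_eq _ _ fun _ _ => ?_
      refine ((Category.id_comp _).trans (Category.comp_id _)).trans ?_
      rw [← hΦ.equiv_mor]
      exact congrArg _ ((Category.id_comp _).trans (Category.comp_id _)).symm
    rw [← e]
    change (m (M.obj x)).map (m (M.obj y)) (M.mor r) ≫ (m (M.obj y)).map (.single Φ y) (𝟙 _) =
      (m (M.obj x)).map (.single Φ x) (𝟙 _) ≫ Matching.map (.single Φ x) (.single Φ y) (M.mor r)
    rw [← Matching.map_comp, ← Matching.map_comp, Category.comp_id, Category.id_comp]
  · intro t x y a b _ _ _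
    change Matching.map (m (M.obj t)) (m (M.obj x ⊗ M.obj y)) (M.incl a b) =
      Matching.map (m (M.obj t)) (.single Φ t) (𝟙 _) ≫ N.incl a b ≫
        (Matching.map (.single Φ x) (m (M.obj x)) (𝟙 _) ⊗ₘ
          Matching.map (.single Φ y) (m (M.obj y)) (𝟙 _)) ≫
        Matching.map (hΦ.tensorMatching hM hN (m (M.obj x)) (m (M.obj y)))
          (m (M.obj x ⊗ M.obj y)) (𝟙 _)
    rw [← hΦ.map_incl hM hN a b, ← hΦ.map_tensor hM hN]
    simp only [← Matching.map_comp, Category.id_comp, Category.comp_id,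
      MonoidalCategory.id_tensorHom_id]
  · intro u _
    change Matching.map (m (M.obj u)) (m (𝟙_ C)) (M.unitIncl u) =
      Matching.map (m (M.obj u)) (.single Φ u) (𝟙 _) ≫ N.unitIncl u ≫
        Matching.map (hΦ.unitMatching hM hN) (m (𝟙_ C)) (𝟙 _)
    rw [← hΦ.map_unitIncl hM hN u]
    simp only [← Matching.map_comp, Category.id_comp, Category.comp_id]

end IsTensorComparison

/-! ### Comparison of two systems with the same formulas -/

section

variable {A : Type u} [Category.{v} A] [CartesianMonoidalCategory A] [IsRegular A]
  [SubobjectFinite A] {K : Type w} [CommRing K]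
  {C : Type u₁} [Category.{v₁} C] [Preadditive C] [Linear K C] [HasFiniteBiproducts C]
  [MonoidalCategory C] [SymmetricCategory C]
  {D : Type u₂} [Category.{v₂} D] [Preadditive D] [Linear K D] [HasFiniteBiproducts D]
  [MonoidalCategory D] [SymmetricCategory D]
  {M : SubobjectData A C} {N : SubobjectData A D}

theorem SubobjectData.IsSystem.hom_induction (hM : M.IsSystem K) {x y : A}
    {p : (M.obj x ⟶ M.obj y) → Prop} (mor : ∀ r : R x y, p (M.mor r)) (zero : p 0)
    (add : ∀ f g, p f → p g → p (f + g)) (smul : ∀ (c : K) f, p f → p (c • f))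
    (f : M.obj x ⟶ M.obj y) : p f := by
  obtain ⟨b, hb⟩ := hM.basis x y
  have hf : f ∈ Submodule.span K (Set.range b) := by rw [b.span_eq]; trivial
  refine Submodule.span_induction ?_ zero (fun f g _ _ => add f g) (fun c f _ => smul c f) hf
  rintro _ ⟨r, rfl⟩
  rw [hb]
  exact mor r

/-- The linear isomorphism which identifies the bases of two systems. -/
noncomputable def homEquiv (hM : M.IsSystem K) (hN : N.IsSystem K) (x y : A) :
    (M.obj x ⟶ M.obj y) ≃ₗ[K] (N.obj x ⟶ N.obj y) :=
  (hM.basis x y).choose.equiv (hN.basis x y).choose (Equiv.refl _)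

theorem homEquiv_mor (hM : M.IsSystem K) (hN : N.IsSystem K) {x y : A} (r : R x y) :
    homEquiv hM hN x y (M.mor r) = N.mor r := by
  rw [← (hM.basis x y).choose_spec, homEquiv, Module.Basis.equiv_apply, (hN.basis x y).choose_spec]
  rfl

/-- Two systems in which the basis elements are multiplied in the same way can be compared. -/
noncomputable def comparison (hM : M.IsSystem K) (hN : N.IsSystem K)
    (h : ∀ {x y z : A} (r : R x y) (s : R y z),
      homEquiv hM hN x z (M.mor r ≫ M.mor s) = N.mor r ≫ N.mor s) :
    Comparison K M.obj N.obj where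
  equiv := homEquiv hM hN _ _
  map_id x := by
    rw [← hM.isoMor_refl, ← hN.isoMor_refl]
    exact homEquiv_mor hM hN _
  map_comp {x y z} f g := by
    induction f using hM.hom_induction with
    | mor r =>
      induction g using hM.hom_induction with
      | mor s => rw [h, homEquiv_mor, homEquiv_mor]
      | zero => simp only [comp_zero, map_zero]
      | add g g' h h' => simp only [Preadditive.comp_add, map_add, h, h']
      | smul c g h => simp only [Linear.comp_smul, map_smul, h]
    | zero => simp only [zero_comp, map_zero]
    | add f f' h h' => simp only [Preadditive.add_comp, map_add, h, h']
    | smul c f h => simp only [Linear.smul_comp, map_smul, h]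

/-- By orthogonality both sides vanish unless u = u' and v = v', and then they reduce to the middle
morphism. Thus tensor formulas in block form are respected by Φ. -/
theorem Comparison.equiv_incl_proj_incl_proj (Φ : Comparison K M.obj N.obj) (hM : M.IsSystem K)
    (hN : N.IsSystem K) {x y x' y' : A} (u u' : R x x') (v v' : R y y')
    (f : M.obj u'.obj ⟶ M.obj v'.obj) :
    Φ.equiv (M.incl u.left u.right ≫ (M.proj u'.left u'.right ≫ f ≫ M.incl v'.left v'.right) ≫
      M.proj v.left v.right) =
    N.incl u.left u.right ≫ (N.proj u'.left u'.right ≫ Φ.equiv f ≫ N.incl v'.left v'.right) ≫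
      N.proj v.left v.right := by
  simp only [Category.assoc]
  by_cases hu : u = u'
  · subst hu
    by_cases hv : v' = v
    · subst hv
      rw [reassoc_of% hM.incl_proj u, hM.incl_proj v', reassoc_of% hN.incl_proj u,
        hN.incl_proj v', Category.comp_id, Category.comp_id]
    · rw [hM.incl_proj_of_ne _ _ hv, hN.incl_proj_of_ne _ _ hv]
      simp only [comp_zero, map_zero]
  · rw [← Category.assoc (M.incl _ _), ← Category.assoc (N.incl _ _), hM.incl_proj_of_ne _ _ hu,
      hN.incl_proj_of_ne _ _ hu]
    simp only [zero_comp, map_zero]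

variable [MonoidalPreadditive C] [MonoidalLinear K C] [MonoidalPreadditive D] [MonoidalLinear K D]

theorem isTensorComparison (Φ : Comparison K M.obj N.obj) (hM : M.IsSystem K)
    (h : ∀ {x y : A} (r : R x y), Φ.equiv (M.mor r) = N.mor r)
    (h' : ∀ {x y x' y' : A} (r : R x y) (r' : R x' y') (u : R x x') (v : R y y'),
      Φ.equiv (M.incl u.left u.right ≫ (M.mor r ⊗ₘ M.mor r') ≫ M.proj v.left v.right) =
        N.incl u.left u.right ≫ (N.mor r ⊗ₘ N.mor r') ≫ N.proj v.left v.right) :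
    IsTensorComparison M N Φ where
  equiv_mor := h
  equiv_tensor f g u v := by
    induction f using hM.hom_induction with
    | mor r =>
      induction g using hM.hom_induction with
      | mor s => rw [h', h, h]
      | zero => simp only [MonoidalPreadditive.tensor_zero, zero_comp, comp_zero, map_zero]
      | add g g' h h' =>
        simp only [MonoidalPreadditive.tensor_add, Preadditive.add_comp, Preadditive.comp_add,
          map_add, h, h']
      | smul c g h =>
        simp only [smul_tensorHom_right, Linear.smul_comp, Linear.comp_smul, map_smul, h]
    | zero => simp only [MonoidalPreadditive.zero_tensor, zero_comp, comp_zero, map_zero]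
    | add f f' h h' =>
      simp only [MonoidalPreadditive.add_tensor, Preadditive.add_comp, Preadditive.comp_add,
        map_add, h, h']
    | smul c f h =>
      simp only [smul_tensorHom_left, Linear.smul_comp, Linear.comp_smul, map_smul, h]

variable [IsIdempotentComplete C] [IsIdempotentComplete D] (δ : DegreeFunction A K)

/-- The coefficients in the formulas depend only on `A` and δ, so the linear isomorphism matching
the bases respects composition and the components of tensor products. -/
theorem equivalent_of_roundLaws (hM : M.IsSystem K) (hN : N.IsSystem K) (h : M.RoundLaws δ)
    (h' : N.RoundLaws δ) : M.Equivalent K N := by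
  let Φ : Comparison K M.obj N.obj := comparison hM hN fun r s => by
    rw [h.comp, h'.comp]
    simp only [map_sum, map_smul, homEquiv_mor]
  have hΦ : ∀ {x y : A} (r : R x y), Φ.equiv (M.mor r) = N.mor r := homEquiv_mor hM hN
  refine (isTensorComparison Φ hM hΦ fun r r' u v => ?_).equivalent hM hN
  rw [h.tensor, h'.tensor]
  simp only [Preadditive.sum_comp, Preadditive.comp_sum, map_sum]
  refine Finset.sum_congr rfl fun w _ => ?_
  rw [Φ.equiv_incl_proj_incl_proj hM hN, hΦ]

theorem equivalent_of_curlyLaws (hM : M.IsSystem K) (hN : N.IsSystem K) (h : M.CurlyLaws δ)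
    (h' : N.CurlyLaws δ) : M.Equivalent K N := by
  let Φ : Comparison K M.obj N.obj := comparison hM hN fun r s => by
    rw [h.comp, h'.comp, map_sum]
    refine Finset.sum_congr rfl fun y' _ => ?_
    split_ifs
    · rw [map_smul, homEquiv_mor]
    · rw [map_zero]
  have hΦ : ∀ {x y : A} (r : R x y), Φ.equiv (M.mor r) = N.mor r := homEquiv_mor hM hN
  -- The case distinction in `extMor` concerns only `A`, hence is the same for both systems.
  have hext : ∀ {t x y : A} (a : t ⟶ x) (b : t ⟶ y), Φ.equiv (M.extMor a b) = N.extMor a b := by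
    intro t x y a b
    unfold SubobjectData.extMor
    split_ifs
    · rw [hΦ]
    · rw [map_zero]
  refine (isTensorComparison Φ hM hΦ fun r r' u v => ?_).equivalent hM hN
  rw [h.tensor, h'.tensor]
  simp only [Preadditive.sum_comp, Preadditive.comp_sum, map_sum]
  refine Finset.sum_congr rfl fun u' _ => Finset.sum_congr rfl fun v' _ => ?_
  have h₀ : Φ.equiv (M.incl u.left u.right ≫ 0 ≫ M.proj v.left v.right) =
      N.incl u.left u.right ≫ 0 ≫ N.proj v.left v.right := by
    simp only [zero_comp, comp_zero, map_zero]
  have h₁ : HasPullback u'.1.arrow (r.left ⊗ₘ r'.left) := inferInstance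
  rw [dif_pos h₁, dif_pos h₁]
  by_cases h₂ : HasPullback (pullback.snd u'.1.arrow (r.left ⊗ₘ r'.left) ≫
    (r.right ⊗ₘ r'.right)) v'.1.arrow
  · rw [dif_pos h₂, dif_pos h₂]
    exact (Φ.equiv_incl_proj_incl_proj hM hN u u' v v' _).trans (congrArg (fun f =>
      N.incl u.left u.right ≫ (N.proj u'.left u'.right ≫ f ≫ N.incl v'.left v'.right) ≫
        N.proj v.left v.right) (hext _ _))
  · rw [dif_neg h₂, dif_neg h₂]
    exact h₀

end

end TensorEnvelope

open TensorEnvelope in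
theorem theorem1p1 {A : Type u} [Category.{v} A] [CartesianMonoidalCategory A] [BraidedCategory A]
    [IsRegular A] [SubobjectFinite A] {K : Type w} [CommRing K] (δ : DegreeFunction A K) :
    -- `[x]^*` is a direct summand of `[x]`, cut out by the idempotent `p_x^*`
    (∀ x : A, starIncl δ x ≫ starProj δ x = 𝟙 (star δ x) ∧
      starProj δ x ≫ starIncl δ x = (toEnvelope δ).map (pStar δ (⊤ : Subobject x))) ∧
    -- the canonical morphism `⨁_{y ⊆ x} [y]^* ⟶ [x]` is an isomorphism
    (∀ x : A, IsIso (biproduct.desc fun y : Subobject x =>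
      starIncl δ (y : A) ≫ (toEnvelope δ).map (TZero.graph δ y.arrow))) ∧
    -- for an isomorphism `f : x ≅ y`, the morphism `[f]` induces the morphism `[x]^* ⟶ [y]^*` that
    -- is attached to the graph of `f`
    (∀ {x y : A} (f : x ≅ y),
      starIncl δ x ≫ (toEnvelope δ).map (TZero.graph δ f.hom) =
        (roundData δ).isoMor f ≫ starIncl δ y ∧
      starIncl δ x ≫ (toEnvelope δ).map (TZero.graph δ f.hom) =
        (curlyData δ).isoMor f ≫ starIncl δ y) ∧
    -- generators, bases, tensor products of objects and constraints, and the formulas for the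
    -- composition and the tensor product of morphisms
    ((roundData δ).IsSystem K ∧ (roundData δ).RoundLaws δ) ∧
    ((curlyData δ).IsSystem K ∧ (curlyData δ).CurlyLaws δ) ∧
    -- uniqueness
    (∀ (D : Type u₁) [Category.{v₁} D] [Preadditive D] [Linear K D] [HasFiniteBiproducts D]
      [IsIdempotentComplete D] [MonoidalCategory D] [SymmetricCategory D] [MonoidalPreadditive D]
      [MonoidalLinear K D] (M : SubobjectData A D),
      (M.IsSystem K → M.RoundLaws δ → (roundData δ).Equivalent K M) ∧
      (M.IsSystem K → M.CurlyLaws δ → (curlyData δ).Equivalent K M)) := by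
  refine ⟨fun x => ⟨starIncl_starProj δ x, starProj_starIncl δ x⟩, isIso_biproduct_desc δ,
    fun f => ⟨?_, ?_⟩, ⟨roundData_isSystem δ, roundData_roundLaws δ⟩,
    ⟨curlyData_isSystem δ, curlyData_curlyLaws δ⟩, fun D _ _ _ _ _ _ _ _ _ M => ⟨fun h h' => ?_,
    fun h h' => ?_⟩⟩
  · exact ((congrArg (· ≫ starIncl δ _) (round_iso δ f)).trans (res_graph_starIncl δ f.hom)).symm
  · exact ((congrArg (· ≫ starIncl δ _) (curly_iso δ f)).trans (res_graph_starIncl δ f.hom)).symm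
  · exact equivalent_of_roundLaws δ (roundData_isSystem δ) h (roundData_roundLaws δ) h'
  · exact equivalent_of_curlyLaws δ (curlyData_isSystem δ) h (curlyData_curlyLaws δ) h'
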